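/- Fix countably infinite, pairwise disjoint sets of concept names, role names and individual names. $\mathcal{ELIO}$ concepts are given by $C ::= \top \mid A \mid \{a\} \mid C \sqcap C \mid \exists R.C$, where $A$ is a concept name, $a$ an individual name and $R$ a role name $r$ or an inverse role $r^-$; $\mathcal{EL}$ concepts are those without nominals $\{a\}$ and without inverse roles. A knowledge base (KB) $\mathcal{K}=(\mathcal{T},\mathcal{A})$ consists of a finite set $\mathcal{T}$ of concept inclusions $C\sqsubseteq D$ and a finite set $\mathcal{A}$ of assertions $A(a)$ and $R(a,b)$ (with $R$ a role name in the case of $\mathcal{EL}$). Interpretations have a non-empty domain and interpret each individual name by a domain element; the unique name assumption is not made, i.e. distinct individual names may denote the same element. Write $\mathcal{I}\subseteq\mathcal{J}$ if $\mathcal{I}$ and $\mathcal{J}$ have the same domain, agree on all individual names, and $p^{\mathcal{I}}\subseteq p^{\mathcal{J}}$ for every concept or role name $p$; write $\mathcal{I}\subsetneq\mathcal{J}$ if moreover $p^{\mathcal{I}}\subsetneq p^{\mathcal{J}}$ for some $p$. A minimal model of $\mathcal{K}$ is a model $\mathcal{I}$ of $\mathcal{K}$ such that no $\mathcal{J}\subsetneq\mathcal{I}$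 is a model of $\mathcal{K}$. For $\mathcal{L}\in\{\mathcal{EL},\mathcal{ELIO}\}$, the problem MinModSat in $\mathcal{L}$ is: given an $\mathcal{L}$ KB $\mathcal{K}$ and an $\mathcal{L}$ concept $C$, decide whether $\mathcal{K}$ has a minimal model $\mathcal{I}$ with $C^{\mathcal{I}}\neq\emptyset$. Theorem. Without the unique name assumption: (1) MinModSat in $\mathcal{ELIO}$ is $\mathsf{P}$-complete, that is, it is in $\mathsf{P}$ and every problem in $\mathsf{P}$ reduces to it by a logarithmic-space many-one reduction. (2) MinModSat in $\mathcal{EL}$ is already $\mathsf{P}$-hard under logarithmic-space many-one reductions. (3) Every $\mathcal{ELIO}$ KB $\mathcal{K}=(\mathcal{T},\mathcal{A})$ has a representative minimal model $\mathcal{I}_{\mathcal{K}}$ with a one-element domain $\{e\}$: an $\mathcal{ELIO}$ concept $C$ is satisfied in some minimal model of $\mathcal{K}$ if and only if $C^{\mathcal{I}_{\mathcal{K}}}\neq\emptyset$. It is computed by a fixpoint iteration: start from the interpretation with domain $\{e\}$ in which exactly the concept and role names occurring in $\mathcal{A}$ are non-empty, and in each round, for every $C\sqsubseteq D$ in $\mathcal{T}$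 such that $e$ satisfies $C$, make all concept and role names that occur in $D$ non-empty; $\mathcal{I}_{\mathcal{K}}$ is the interpretation reached after $|\mathcal{T}|$ rounds, and a further round does not change it. -/

import Mathlib

universe u

namespace MinMod

/-! ## Syntax of ELIO -/

/-- Names are finite binary strings: a countably infinite set. Concept, role and individual names
are kept apart by the positions in which they occur. -/
abbrev Name : Type := List Bool

/-- Elements of `N_R^±`: a role name `r` or its inverse `r⁻`. -/
inductive Role : Type
  | name (r : Name)
  | inv (r : Name)

/-- ELIO concepts: `⊤ | A | {a} | C ⊓ D | ∃ R. C` with `R` a role name or an inverse role. -/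
inductive Concept : Type
  | top
  | atom (A : Name)
  | nominal (a : Name)
  | inter (C D : Concept)
  | ex (R : Role) (C : Concept)

/-- A concept inclusion `lhs ⊑ rhs`. -/
structure Inclusion : Type where
  lhs : Concept
  rhs : Concept

/-- ABox assertions `A(a)` and `R(a, b)`. -/
inductive Assertion : Type
  | concept (A a : Name)
  | role (R : Role) (a b : Name)

/-- ELIO knowledge bases; the finite sets of inclusions and assertions are listed. -/
structure KB : Type where
  tbox : List Inclusion
  abox : List Assertion

/-! ## The fragment EL: no nominals and no inverse roles -/

def Role.IsEL : Role → Prop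
  | .name _ => True
  | .inv _ => False

def Concept.IsEL : Concept → Prop
  | .top => True
  | .atom _ => True
  | .nominal _ => False
  | .inter C D => C.IsEL ∧ D.IsEL
  | .ex R C => R.IsEL ∧ C.IsEL

def Inclusion.IsEL (i : Inclusion) : Prop := i.lhs.IsEL ∧ i.rhs.IsEL

def Assertion.IsEL : Assertion → Prop
  | .concept _ _ => True
  | .role R _ _ => R.IsEL

def KB.IsEL (K : KB) : Prop := (∀ i ∈ K.tbox, i.IsEL) ∧ ∀ s ∈ K.abox, s.IsEL

/-! ## Semantics -/

/-- An interpretation with domain `Δ` (nonempty, since individual names denote elements of it).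
The unique name assumption is not made: `ind` need not be injective. -/
structure Interp (Δ : Type u) : Type u where
  con : Name → Set Δ
  rol : Name → Set (Δ × Δ)
  ind : Name → Δ

section
variable {Δ : Type u}

/-- The extension of a role. -/
def Role.ext (I : Interp Δ) : Role → Set (Δ × Δ)
  | .name r => I.rol r
  | .inv r => {p | (p.2, p.1) ∈ I.rol r}

/-- The extension `C^I` of a concept. -/
def Concept.ext (I : Interp Δ) : Concept → Set Δ
  | .top => Set.univ
  | .atom A => I.con A
  | .nominal a => {I.ind a}
  | .inter C D => C.ext I ∩ D.ext I
  | .ex R C => {d | ∃ e, (d, e) ∈ R.ext I ∧ e ∈ C.ext I}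

def Inclusion.Holds (I : Interp Δ) (i : Inclusion) : Prop := i.lhs.ext I ⊆ i.rhs.ext I

def Assertion.Holds (I : Interp Δ) : Assertion → Prop
  | .concept A a => I.ind a ∈ I.con A
  | .role R a b => (I.ind a, I.ind b) ∈ R.ext I

/-- `I ⊨ K`. -/
def IsModel (I : Interp Δ) (K : KB) : Prop :=
  (∀ i ∈ K.tbox, i.Holds I) ∧ ∀ s ∈ K.abox, s.Holds I

/-- `I ⊆ J`: same domain and individuals, smaller or equal extensions of all predicates. -/
def Interp.Sub (I J : Interp Δ) : Prop :=
  (∀ a, I.ind a = J.ind a) ∧ (∀ A, I.con A ⊆ J.con A) ∧ ∀ r, I.rol r ⊆ J.rol r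

/-- `I ⊊ J`: moreover some predicate has a strictly smaller extension. -/
def Interp.SSub (I J : Interp Δ) : Prop :=
  I.Sub J ∧ ((∃ A, I.con A ⊂ J.con A) ∨ ∃ r, I.rol r ⊂ J.rol r)

/-- `I` is a minimal model of `K`. -/
def IsMinimalModel (I : Interp Δ) (K : KB) : Prop :=
  IsModel I K ∧ ¬ ∃ J : Interp Δ, J.SSub I ∧ IsModel J K

end

/-- `C` is satisfied in some minimal model of `K` (without the unique name assumption). -/
def SatInMinimalModel (K : KB) (C : Concept) : Prop :=
  ∃ (Δ : Type u) (I : Interp Δ), IsMinimalModel I K ∧ (C.ext I).Nonempty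

/-! ## The one-element interpretation obtained by a fixpoint iteration -/

/-- The concept names occurring in a concept. -/
def Concept.conceptNames : Concept → Set Name
  | .top => ∅
  | .atom A => {A}
  | .nominal _ => ∅
  | .inter C D => C.conceptNames ∪ D.conceptNames
  | .ex _ C => C.conceptNames

def Role.roleName : Role → Name
  | .name r => r
  | .inv r => r

/-- The role names occurring in a concept. -/
def Concept.roleNames : Concept → Set Name
  | .top => ∅
  | .atom _ => ∅
  | .nominal _ => ∅
  | .inter C D => C.roleNames ∪ D.roleNames
  | .ex R C => {R.roleName} ∪ C.roleNames

/-- The interpretation with the single element `()` in which exactly the predicates asserted by the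
ABox hold. -/
def KB.start (K : KB) : Interp Unit where
  con A := {_e | ∃ a, Assertion.concept A a ∈ K.abox}
  rol r := {_e | ∃ R a b, Assertion.role R a b ∈ K.abox ∧ R.roleName = r}
  ind _ := ()

/-- One round: for each inclusion `C ⊑ D` of the TBox whose left side holds at the element, make all
predicates occurring in `D` true. -/
def KB.fire (K : KB) (I : Interp Unit) : Interp Unit where
  con A := {e | e ∈ I.con A ∨ ∃ i ∈ K.tbox, e ∈ i.lhs.ext I ∧ A ∈ i.rhs.conceptNames}
  rol r := {p | p ∈ I.rol r ∨ ∃ i ∈ K.tbox, p.1 ∈ i.lhs.ext I ∧ r ∈ i.rhs.roleNames}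
  ind a := I.ind a

/-- As many rounds as the TBox has inclusions. -/
def KB.representative (K : KB) : Interp Unit := K.fire^[K.tbox.length] K.start

/-! ## Encoding instances as words over a finite alphabet -/

inductive Token : Type
  | bit (b : Bool)
  | endName
  | name | inv
  | top | atom | nominal | inter | ex
  | incl
  | conceptAssertion | roleAssertion
  | goal
  deriving DecidableEq, Fintype

def encodeName (n : Name) : List Token := n.map .bit ++ [.endName]

def Role.encode : Role → List Token
  | .name r => .name :: encodeName r
  | .inv r => .inv :: encodeName r

/-- Prefix notation. -/
def Concept.encode : Concept → List Token
  | .top => [.top]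
  | .atom A => .atom :: encodeName A
  | .nominal a => .nominal :: encodeName a
  | .inter C D => .inter :: (C.encode ++ D.encode)
  | .ex R C => .ex :: (R.encode ++ C.encode)

def Inclusion.encode (i : Inclusion) : List Token := .incl :: (i.lhs.encode ++ i.rhs.encode)

def Assertion.encode : Assertion → List Token
  | .concept A a => .conceptAssertion :: (encodeName A ++ encodeName a)
  | .role R a b => .roleAssertion :: (R.encode ++ (encodeName a ++ encodeName b))

/-- The word that presents the instance `(K, C)`. -/
def encodeInstance (K : KB) (C : Concept) : List Token :=
  K.tbox.flatMap Inclusion.encode ++ (K.abox.flatMap Assertion.encode ++ .goal :: C.encode)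

theorem encodeName_prefix {m n : Name} {s t : List Token}
    (h : encodeName m ++ s = encodeName n ++ t) : m = n ∧ s = t := by
  induction m generalizing n with
  | nil => cases n <;> simp_all [encodeName]
  | cons b m ih =>
    cases n with
    | nil => simp [encodeName] at h
    | cons c n =>
      have h1 : b = c ∧ encodeName m ++ s = encodeName n ++ t := by simpa [encodeName] using h
      obtain ⟨rfl, h2⟩ := h1
      obtain ⟨rfl, rfl⟩ := ih h2
      exact ⟨rfl, rfl⟩

theorem Role.encode_prefix {R S : Role} {s t : List Token}
    (h : R.encode ++ s = S.encode ++ t) : R = S ∧ s = t := by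
  cases R <;> cases S <;> simp only [Role.encode, List.cons_append, List.cons.injEq, reduceCtorEq,
    false_and, true_and] at h
  all_goals
    obtain ⟨rfl, rfl⟩ := encodeName_prefix h
    exact ⟨rfl, rfl⟩

theorem Concept.encode_prefix {C D : Concept} {s t : List Token}
    (h : C.encode ++ s = D.encode ++ t) : C = D ∧ s = t := by
  induction C generalizing D s t with
  | top => cases D <;> simp_all [Concept.encode]
  | atom A =>
    cases D <;> simp only [Concept.encode, List.cons_append, List.cons.injEq, reduceCtorEq,
      false_and, true_and] at h
    obtain ⟨rfl, rfl⟩ := encodeName_prefix h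
    exact ⟨rfl, rfl⟩
  | nominal A =>
    cases D <;> simp only [Concept.encode, List.cons_append, List.cons.injEq, reduceCtorEq,
      false_and, true_and] at h
    obtain ⟨rfl, rfl⟩ := encodeName_prefix h
    exact ⟨rfl, rfl⟩
  | inter C₁ C₂ ih₁ ih₂ =>
    cases D <;> simp only [Concept.encode, List.cons_append, List.cons.injEq, reduceCtorEq,
      false_and, true_and, List.append_assoc] at h
    obtain ⟨rfl, h₂⟩ := ih₁ h
    obtain ⟨rfl, rfl⟩ := ih₂ h₂
    exact ⟨rfl, rfl⟩
  | ex R C ih =>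
    cases D <;> simp only [Concept.encode, List.cons_append, List.cons.injEq, reduceCtorEq,
      false_and, true_and, List.append_assoc] at h
    obtain ⟨rfl, h₂⟩ := Role.encode_prefix h
    obtain ⟨rfl, rfl⟩ := ih h₂
    exact ⟨rfl, rfl⟩

theorem abox_encode_prefix {A B : List Assertion} {s t : List Token}
    (h : A.flatMap Assertion.encode ++ .goal :: s = B.flatMap Assertion.encode ++ .goal :: t) :
    A = B ∧ s = t := by
  induction A generalizing B with
  | nil =>
    cases B with
    | nil => simpa using h
    | cons b B => cases b <;> simp [Assertion.encode] at h
  | cons a A ih =>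
    cases B with
    | nil => cases a <;> simp [Assertion.encode] at h
    | cons b B =>
      cases a <;> cases b <;> simp only [Assertion.encode, List.flatMap_cons, List.cons_append,
        List.cons.injEq, reduceCtorEq, false_and, true_and, List.append_assoc] at h
      · obtain ⟨rfl, h₂⟩ := encodeName_prefix h
        obtain ⟨rfl, h₃⟩ := encodeName_prefix h₂
        obtain ⟨rfl, rfl⟩ := ih h₃
        exact ⟨rfl, rfl⟩
      · obtain ⟨rfl, h₂⟩ := Role.encode_prefix h
        obtain ⟨rfl, h₃⟩ := encodeName_prefix h₂
        obtain ⟨rfl, h₄⟩ := encodeName_prefix h₃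
        obtain ⟨rfl, rfl⟩ := ih h₄
        exact ⟨rfl, rfl⟩

/-- Every instance can be read off its encoding. -/
theorem encodeInstance_injective {K K' : KB} {C C' : Concept}
    (h : encodeInstance K C = encodeInstance K' C') : K = K' ∧ C = C' := by
  obtain ⟨T, A⟩ := K
  obtain ⟨T', A'⟩ := K'
  simp only [encodeInstance] at h
  induction T generalizing T' with
  | nil =>
    cases T' with
    | nil =>
      obtain ⟨rfl, h⟩ := abox_encode_prefix (by simpa using h)
      obtain ⟨rfl, -⟩ := Concept.encode_prefix (s := []) (t := []) (by simpa using h)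
      exact ⟨rfl, rfl⟩
    | cons i T' =>
      cases A with
      | nil => simp [Inclusion.encode] at h
      | cons a A => cases a <;> simp [Inclusion.encode, Assertion.encode] at h
  | cons i T ih =>
    cases T' with
    | nil =>
      cases A' with
      | nil => simp [Inclusion.encode] at h
      | cons a A' => cases a <;> simp [Inclusion.encode, Assertion.encode] at h
    | cons j T' =>
      obtain ⟨i₁, i₂⟩ := i
      obtain ⟨j₁, j₂⟩ := j
      simp only [Inclusion.encode, List.flatMap_cons, List.cons_append, List.cons.injEq, true_and,
        List.append_assoc] at h
      obtain ⟨rfl, h₂⟩ := Concept.encode_prefix h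
      obtain ⟨rfl, h₃⟩ := Concept.encode_prefix h₂
      obtain ⟨h₁, rfl⟩ := ih T' h₃
      simp only [KB.mk.injEq] at h₁
      obtain ⟨rfl, rfl⟩ := h₁
      exact ⟨rfl, rfl⟩

/-- MinModSat in ELIO without the unique name assumption, as a formal language. -/
def minModSatELIO : Language Token :=
  {w | ∃ K C, w = encodeInstance K C ∧ SatInMinimalModel.{u} K C}

/-- MinModSat in EL without the unique name assumption, as a formal language. -/
def minModSatEL : Language Token :=
  {w | ∃ K C, K.IsEL ∧ C.IsEL ∧ w = encodeInstance K C ∧ SatInMinimalModel.{u} K C}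

/-! ## Turing machines with a read-only input tape, work tapes and a write-only output tape -/

/-- The content of a cell of the input tape: the input word between two end markers. -/
inductive InSymbol (α : Type) : Type
  | leftEnd
  | letter (a : α)
  | rightEnd

inductive Move : Type
  | left
  | stay
  | right

/-- What a machine does in one step. The word `emit` is appended to the output; as the transition
table is finite, its length is bounded by a constant of the machine. -/
structure Action (Q Γ ι β : Type) : Type where
  next : Q
  inMove : Move
  write : ι → Γ
  move : ι → Move
  emit : List β

/-- Deterministic Turing machines with input alphabet `α`, output alphabet `β`, finitely many states
`Q`, and finitely many work tapes (indexed by `ι`) with finite alphabet `Γ`. The machine halts where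
`δ` is `none`. -/
structure Machine (α β : Type) : Type 1 where
  Q : Type
  Γ : Type
  ι : Type
  finQ : Finite Q
  finΓ : Finite Γ
  finι : Finite ι
  start : Q
  blank : Γ
  δ : Q → InSymbol α → (ι → Γ) → Option (Action Q Γ ι β)

/-- Configurations. All tapes are infinite to the right only; `work i j` is the `j`-th cell of work
tape `i`. -/
structure Machine.Cfg {α β : Type} (M : Machine α β) : Type where
  state : M.Q
  inPos : ℕ
  work : M.ι → ℕ → M.Γ
  head : M.ι → ℕ
  out : List β

/-- Cell `0` of the input tape is the left end marker, cell `j + 1` holds the `j`-th letter, and cell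
`w.length + 1` is the right end marker. -/
def readInput {α : Type} (w : List α) : ℕ → InSymbol α
  | 0 => .leftEnd
  | j + 1 => match w[j]? with
    | some a => .letter a
    | none => .rightEnd

/-- Moving a head; a move to the left in cell `0` has no effect. -/
def Move.apply : Move → ℕ → ℕ
  | .left, n => n - 1
  | .stay, n => n
  | .right, n => n + 1

namespace Machine

variable {α β : Type} (M : Machine α β)

/-- The initial configuration: the input head on the left end marker, the work tapes blank. -/
def initial : M.Cfg where
  state := M.start
  inPos := 0
  work _ _ := M.blank
  head _ := 0
  out := []

/-- One step on input `w`, or `none` if the machine halts. The input head cannot move beyond the end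
markers. -/
def step (w : List α) (c : M.Cfg) : Option M.Cfg :=
  (M.δ c.state (readInput w c.inPos) fun i => c.work i (c.head i)).map fun a =>
    { state := a.next
      inPos := min (a.inMove.apply c.inPos) (w.length + 1)
      work := fun i => Function.update (c.work i) (c.head i) (a.write i)
      head := fun i => (a.move i).apply (c.head i)
      out := c.out ++ a.emit }

/-- The configuration after `t` steps on input `w`; a halted machine stays where it is. -/
def cfgAt (w : List α) (t : ℕ) : M.Cfg :=
  (fun c => (M.step w c).getD c)^[t] M.initial

/-- On input `w` the machine has halted after at most `t` steps with output `v`. -/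
def OutputsIn (w : List α) (v : List β) (t : ℕ) : Prop :=
  M.step w (M.cfgAt w t) = none ∧ (M.cfgAt w t).out = v

/-- On input `w` every work tape head only ever visits the first `s` cells of its tape. -/
def UsesSpace (w : List α) (s : ℕ) : Prop :=
  ∀ t i, (M.cfgAt w t).head i < s

end Machine

/-! ## Complexity -/

/-- The class P: some machine computes the characteristic function of `L` in polynomial time. -/
def InP {α : Type} [Finite α] (L : Language α) : Prop :=
  ∃ (M : Machine α Bool) (p : Polynomial ℕ), ∀ w : List α,
    ∃ b : Bool, M.OutputsIn w [b] (p.eval w.length) ∧ (b = true ↔ w ∈ L)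

/-- `f` is computed by a machine that always halts and uses `O(log n)` cells of its work tapes on
inputs of length `n`. -/
def LogSpaceComputable {α β : Type} [Finite α] [Finite β] (f : List α → List β) : Prop :=
  ∃ (M : Machine α β) (c : ℕ), ∀ w : List α,
    (∃ t, M.OutputsIn w (f w) t) ∧ M.UsesSpace w (c * (Nat.log 2 w.length + 1))

/-- Logarithmic-space many-one reducibility. -/
def LogSpaceReducible {α β : Type} [Finite α] [Finite β] (L : Language α) (L' : Language β) : Prop :=
  ∃ f : List α → List β, LogSpaceComputable f ∧ ∀ w, w ∈ L ↔ f w ∈ L'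

/-- P-hardness under logarithmic-space many-one reductions. -/
def PHard {β : Type} [Finite β] (L' : Language β) : Prop :=
  ∀ (α : Type) [Finite α] (L : Language α), InP L → LogSpaceReducible L L'

/-- P-completeness. -/
def PComplete {β : Type} [Finite β] (L : Language β) : Prop := InP L ∧ PHard L

end MinMod

namespace MinMod

/-! ## Predicates occurring in a knowledge base -/

/-! Without the unique name assumption all individuals may be collapsed to one element. On a
one-element domain nominals and the top concept always hold, and an existential restriction along a
role or its inverse asks only that the role name be non-empty and that the filler hold. A concept is
therefore satisfied exactly when all its concept and role names (`Concept.keys`) are non-empty, and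
a knowledge base becomes a propositional Horn theory whose models are the sets described by
`KB.Closed`. The fixpoint iteration computes the least closed set, and every round before
stabilization enables a new inclusion (`KB.fire_eq_or_lt`), so one round per inclusion suffices.

Larger domains give nothing new. If all predicates outside a closed set are emptied in an arbitrary
model, the result is again a model (`IsModel.restrict`). So in a minimal model every non-empty
predicate lies in the least closed set (`IsMinimalModel.keys_subset`), and a concept is satisfiable
in a minimal model exactly when its predicates lie in that set (`satInMinimalModel_iff_keys`).

Membership in P is then Horn closure. One left-to-right pass over the encoding parses it, fires the
inclusions and checks the goal (`pass_encodeInstance`); as many passes as the input has letters,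
plus one, decide the problem (`mem_minModSatELIO_iff`). The passes are carried out by a program over
stacks (`Decider.runs_main`), and programs are compiled to Turing machines by `Prog.toMachine`.

For hardness, the run of a polynomial-time machine is described by Horn rules about the content of
each position at each step. The rules derive only true atoms (`Simulation.respects_truth`), and they
derive all that is needed within a large enough range (`Simulation.derived_of_respects`). Rules are
inclusions between conjunctions of concept names, hence EL. The knowledge base is printed with two
counters of `Nat.log 2 n + 1` digits for input length `n`; a large constant base makes their range
exceed any given polynomial (`Simulation.exists_base`), while the work tapes stay logarithmic
(`Simulation.logSpaceComputable_printer`). -/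

/-- A predicate: `(false, A)` is the concept name `A`, `(true, r)` the role name `r`. -/
abbrev Key : Type := Bool × Name

/-- The predicates occurring in a concept, in the order of its encoding. -/
def Concept.keys : Concept → List Key
  | .top => []
  | .atom A => [(false, A)]
  | .nominal _ => []
  | .inter C D => C.keys ++ D.keys
  | .ex R C => (true, R.roleName) :: C.keys

/-- The predicate of an assertion. -/
def Assertion.key : Assertion → Key
  | .concept A _ => (false, A)
  | .role R _ _ => (true, R.roleName)

theorem Concept.mem_conceptNames {C : Concept} {A : Name} :
    A ∈ C.conceptNames ↔ (false, A) ∈ C.keys := by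
  induction C <;> simp_all [Concept.conceptNames, Concept.keys]

theorem Concept.mem_roleNames {C : Concept} {r : Name} :
    r ∈ C.roleNames ↔ (true, r) ∈ C.keys := by
  induction C <;> simp_all [Concept.roleNames, Concept.keys]

/-- The predicates with non-empty extension. -/
def Interp.keys {Δ : Type u} (I : Interp Δ) : Set Key :=
  {k | if k.1 then (I.rol k.2).Nonempty else (I.con k.2).Nonempty}

section
variable {Δ : Type u}

theorem Interp.mem_keys_con {I : Interp Δ} {A : Name} :
    (false, A) ∈ I.keys ↔ (I.con A).Nonempty := by simp [Interp.keys]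

theorem Interp.mem_keys_rol {I : Interp Δ} {r : Name} :
    (true, r) ∈ I.keys ↔ (I.rol r).Nonempty := by simp [Interp.keys]

theorem Role.ext_nonempty {I : Interp Δ} {R : Role} {p : Δ × Δ} (h : p ∈ R.ext I) :
    (I.rol R.roleName).Nonempty := by
  cases R with
  | name r => exact ⟨_, h⟩
  | inv r => exact ⟨_, h⟩

/-- A witness for a concept touches every predicate in it. This half needs no restriction on the
domain and is what is used for arbitrary minimal models. -/
theorem Concept.keys_subset_of_mem_ext {I : Interp Δ} {C : Concept} {d : Δ} (h : d ∈ C.ext I) :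
    ∀ k ∈ C.keys, k ∈ I.keys := by
  induction C generalizing d with
  | top => simp [Concept.keys]
  | atom A => simpa [Concept.keys] using ⟨d, h⟩
  | nominal a => simp [Concept.keys]
  | inter C D ihC ihD =>
    intro k hk
    rcases List.mem_append.1 hk with hk | hk
    · exact ihC h.1 k hk
    · exact ihD h.2 k hk
  | ex R C ih =>
    obtain ⟨e, he, heC⟩ := h
    intro k hk
    rcases List.mem_cons.1 hk with rfl | hk
    · exact Interp.mem_keys_rol.2 (Role.ext_nonempty he)
    · exact ih heC k hk

/-- The single element is the value of every nominal and the only possible witness of every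
existential, so non-emptiness is all that a predicate can contribute. -/
theorem Concept.mem_ext_of_keys_subset [Subsingleton Δ] {I : Interp Δ} {C : Concept} (d : Δ)
    (h : ∀ k ∈ C.keys, k ∈ I.keys) : d ∈ C.ext I := by
  induction C with
  | top => trivial
  | atom A =>
    obtain ⟨e, he⟩ := Interp.mem_keys_con.1 (h (false, A) (by simp [Concept.keys]))
    rwa [Subsingleton.elim d e]
  | nominal a => exact Subsingleton.elim _ _
  | inter C D ihC ihD =>
    exact ⟨ihC fun k hk => h k (List.mem_append_left _ hk),
      ihD fun k hk => h k (List.mem_append_right _ hk)⟩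
  | ex R C ih =>
    refine ⟨d, ?_, ih fun k hk => h k (List.mem_cons_of_mem _ hk)⟩
    obtain ⟨e, he⟩ := Interp.mem_keys_rol.1 (h _ List.mem_cons_self)
    cases R with
    | name r => rwa [show ((d, d) : Δ × Δ) = e from Subsingleton.elim _ _]
    | inv r =>
      change (d, d) ∈ I.rol r
      rwa [show ((d, d) : Δ × Δ) = e from Subsingleton.elim _ _]

theorem Concept.mem_ext_iff [Subsingleton Δ] {I : Interp Δ} {C : Concept} {d : Δ} :
    d ∈ C.ext I ↔ ∀ k ∈ C.keys, k ∈ I.keys :=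
  ⟨Concept.keys_subset_of_mem_ext, Concept.mem_ext_of_keys_subset d⟩

end

/-- A set of predicates that contains those of the ABox and is closed under the inclusions of the
TBox read as propositional implications. -/
def KB.Closed (K : KB) (S : Set Key) : Prop :=
  (∀ s ∈ K.abox, s.key ∈ S) ∧
    ∀ i ∈ K.tbox, (∀ k ∈ i.lhs.keys, k ∈ S) → ∀ k ∈ i.rhs.keys, k ∈ S

theorem isModel_iff_closed {Δ : Type u} [Subsingleton Δ] {I : Interp Δ} {K : KB} :
    IsModel I K ↔ K.Closed I.keys := by
  refine and_congr (forall₂_congr fun s _ => ?_) (forall₂_congr fun s _ => ?_) |>.trans and_comm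
  · simp only [Inclusion.Holds, Set.subset_def, Concept.mem_ext_iff]
    -- The value of the name `[]` serves as the element: individual names make the domain non-empty.
    exact ⟨fun h hl => h (I.ind []) hl, fun h _ hl => h hl⟩
  · cases s with
    | concept A a =>
      simp only [Assertion.Holds, Assertion.key, Interp.mem_keys_con]
      refine ⟨fun h => ⟨_, h⟩, fun ⟨e, he⟩ => ?_⟩
      rwa [Subsingleton.elim (I.ind a) e]
    | role R a b =>
      simp only [Assertion.Holds, Assertion.key, Interp.mem_keys_rol]
      refine ⟨Role.ext_nonempty, fun ⟨e, he⟩ => ?_⟩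
      cases R with
      | name r => rwa [Subsingleton.elim (I.ind a, I.ind b) e]
      | inv r =>
        change (I.ind b, I.ind a) ∈ I.rol r
        rwa [Subsingleton.elim (I.ind b, I.ind a) e]

/-! ## The fixpoint iteration -/

theorem Interp.unit_mem_keys_con {I : Interp Unit} {A : Name} :
    (false, A) ∈ I.keys ↔ () ∈ I.con A := by
  rw [Interp.mem_keys_con]
  exact ⟨fun ⟨_, h⟩ => h, fun h => ⟨_, h⟩⟩

theorem Interp.unit_mem_keys_rol {I : Interp Unit} {r : Name} :
    (true, r) ∈ I.keys ↔ ((), ()) ∈ I.rol r := by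
  rw [Interp.mem_keys_rol]
  exact ⟨fun ⟨_, h⟩ => h, fun h => ⟨_, h⟩⟩

theorem Interp.unit_ext {I J : Interp Unit} (h : I.keys = J.keys) : I = J := by
  obtain ⟨c, r, i⟩ := I
  obtain ⟨c', r', i'⟩ := J
  have h1 : c = c' := by
    funext A; ext ⟨⟩
    simpa only [Interp.unit_mem_keys_con] using Set.ext_iff.1 h (false, A)
  have h2 : r = r' := by
    funext A; ext ⟨⟨⟩, ⟨⟩⟩
    simpa only [Interp.unit_mem_keys_rol] using Set.ext_iff.1 h (true, A)
  obtain rfl : i = i' := funext fun _ => rfl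
  rw [h1, h2]

theorem KB.mem_keys_start {K : KB} {k : Key} :
    k ∈ K.start.keys ↔ ∃ s ∈ K.abox, s.key = k := by
  obtain ⟨_ | _, A⟩ := k
  · simp only [Interp.unit_mem_keys_con, KB.start, Set.mem_ofPred_eq]
    constructor
    · rintro ⟨a, h⟩
      exact ⟨_, h, rfl⟩
    · rintro ⟨s, hs, h⟩
      cases s with
      | concept B a =>
        simp only [Assertion.key, Prod.mk.injEq, true_and] at h
        subst h
        exact ⟨a, hs⟩
      | role R a b => simp [Assertion.key] at h
  · simp only [Interp.unit_mem_keys_rol, KB.start, Set.mem_ofPred_eq]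
    constructor
    · rintro ⟨R, a, b, h, rfl⟩
      exact ⟨_, h, rfl⟩
    · rintro ⟨s, hs, h⟩
      cases s with
      | concept B a => simp [Assertion.key] at h
      | role R a b =>
        simp only [Assertion.key, Prod.mk.injEq, true_and] at h
        exact ⟨R, a, b, hs, h⟩

theorem KB.mem_keys_fire {K : KB} {I : Interp Unit} {k : Key} :
    k ∈ (K.fire I).keys ↔
      k ∈ I.keys ∨ ∃ i ∈ K.tbox, (∀ l ∈ i.lhs.keys, l ∈ I.keys) ∧ k ∈ i.rhs.keys := by
  obtain ⟨_ | _, A⟩ := k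
  · simp only [Interp.unit_mem_keys_con, KB.fire, Concept.mem_ext_iff, Concept.mem_conceptNames,
      Set.mem_ofPred_eq]
  · simp only [Interp.unit_mem_keys_rol, KB.fire, Concept.mem_ext_iff, Concept.mem_roleNames,
      Set.mem_ofPred_eq]

theorem KB.keys_subset_fire (K : KB) (I : Interp Unit) : I.keys ⊆ (K.fire I).keys :=
  fun _ h => KB.mem_keys_fire.2 (.inl h)

-- The number of inclusions with satisfied left side measures progress. If a round enables no
-- further inclusion, the next round has nothing new to fire; so before the fixpoint the number
-- grows with every round.
open Classical in
theorem KB.fire_eq_or_lt (K : KB) (r : ℕ) :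
    K.fire (K.fire^[r] K.start) = K.fire^[r] K.start ∨
      r + 1 ≤ K.tbox.countP fun i => ∀ l ∈ i.lhs.keys, l ∈ (K.fire^[r] K.start).keys := by
  induction r with
  | zero =>
    by_cases h : 0 < K.tbox.countP fun i => ∀ l ∈ i.lhs.keys, l ∈ (K.fire^[0] K.start).keys
    · exact .inr h
    · left
      rw [List.countP_pos_iff] at h
      push Not at h
      refine Interp.unit_ext (Set.Subset.antisymm (fun k hk => ?_) (K.keys_subset_fire _))
      rcases KB.mem_keys_fire.1 hk with hk | ⟨i, hi, hl, -⟩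
      · exact hk
      · exact absurd (decide_eq_true hl) (h i hi)
  | succ r ih =>
    rw [Function.iterate_succ_apply']
    set I := K.fire^[r] K.start
    rcases ih with h | h
    · left
      rw [h, h]
    by_cases h2 : ∃ i ∈ K.tbox, (∀ l ∈ i.lhs.keys, l ∈ (K.fire I).keys) ∧
        ¬ ∀ l ∈ i.lhs.keys, l ∈ I.keys
    · right
      obtain ⟨i, hi, h3, h4⟩ := h2
      obtain ⟨s, t, hst⟩ := List.append_of_mem hi
      refine lt_of_le_of_lt h ?_
      have mono : ∀ L : List Inclusion,
          (L.countP fun i => ∀ l ∈ i.lhs.keys, l ∈ I.keys) ≤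
            L.countP fun i => ∀ l ∈ i.lhs.keys, l ∈ (K.fire I).keys := fun L =>
        List.countP_mono_left fun j _ hj => by
          simp only [decide_eq_true_eq] at hj ⊢
          exact fun l hl => K.keys_subset_fire I (hj l hl)
      rw [hst, List.countP_append, List.countP_append, List.countP_cons_of_neg (by simpa using h4),
        List.countP_cons_of_pos (by simpa using h3)]
      have := mono s
      have := mono t
      omega
    -- No left side became true in the last round, so whatever fires now had already fired on `I`.
    · left
      push Not at h2
      refine Interp.unit_ext (Set.Subset.antisymm (fun k hk => ?_) (K.keys_subset_fire _))
      rcases KB.mem_keys_fire.1 hk with hk | ⟨i, hi, hl, hr⟩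
      · exact hk
      · exact KB.mem_keys_fire.2 (.inr ⟨i, hi, h2 i hi hl, hr⟩)

/-- Otherwise more inclusions would be enabled than the TBox has. -/
theorem KB.fire_representative (K : KB) : K.fire K.representative = K.representative := by
  classical
  refine (K.fire_eq_or_lt K.tbox.length).resolve_right fun h => ?_
  have := List.countP_le_length
    (p := fun i : Inclusion => decide (∀ l ∈ i.lhs.keys, l ∈ (K.fire^[K.tbox.length] K.start).keys))
    (l := K.tbox)
  omega

theorem KB.start_subset_iterate (K : KB) (r : ℕ) : K.start.keys ⊆ (K.fire^[r] K.start).keys := by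
  induction r with
  | zero => exact Set.Subset.rfl
  | succ r ih =>
    rw [Function.iterate_succ_apply']
    exact ih.trans (K.keys_subset_fire _)

theorem KB.closed_representative (K : KB) : K.Closed K.representative.keys := by
  refine ⟨fun s hs => K.start_subset_iterate _ (KB.mem_keys_start.2 ⟨s, hs, rfl⟩),
    fun i hi hl k hk => ?_⟩
  rw [← K.fire_representative]
  exact KB.mem_keys_fire.2 (.inr ⟨i, hi, hl, hk⟩)

theorem KB.Closed.iterate_subset {K : KB} {S : Set Key} (h : K.Closed S) (r : ℕ) :
    (K.fire^[r] K.start).keys ⊆ S := by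
  induction r with
  | zero =>
    intro k hk
    obtain ⟨s, hs, rfl⟩ := KB.mem_keys_start.1 hk
    exact h.1 s hs
  | succ r ih =>
    rw [Function.iterate_succ_apply']
    intro k hk
    rcases KB.mem_keys_fire.1 hk with hk | ⟨i, hi, hl, hr⟩
    · exact ih hk
    · exact h.2 i hi (fun l hl' => ih (hl l hl')) k hr

/-- With `KB.closed_representative` this identifies the result of the iteration as the least closed
set. -/
theorem KB.Closed.representative_subset {K : KB} {S : Set Key} (h : K.Closed S) :
    K.representative.keys ⊆ S :=
  h.iterate_subset _

/-! ## Minimal models -/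

section
variable {Δ : Type u}

/-- The predicates of a smaller model form a closed set, hence contain the least one. On one element
a non-empty predicate has no proper non-empty subset, so nothing can have become smaller. -/
theorem isMinimalModel_of_keys_eq [Subsingleton Δ] {I : Interp Δ} {K : KB}
    (h : I.keys = K.representative.keys) : IsMinimalModel I K := by
  refine ⟨isModel_iff_closed.2 (h ▸ K.closed_representative), ?_⟩
  rintro ⟨J, ⟨-, hJ⟩, hm⟩
  have hsub : I.keys ⊆ J.keys := h ▸ (isModel_iff_closed.1 hm).representative_subset
  rcases hJ with ⟨A, -, hA⟩ | ⟨r, -, hr⟩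
  · refine hA fun d hd => ?_
    obtain ⟨e, he⟩ := Interp.mem_keys_con.1 (hsub (Interp.mem_keys_con.2 ⟨d, hd⟩))
    rwa [Subsingleton.elim d e]
  · refine hr fun d hd => ?_
    obtain ⟨e, he⟩ := Interp.mem_keys_rol.1 (hsub (Interp.mem_keys_rol.2 ⟨d, hd⟩))
    rwa [Subsingleton.elim d e]

/-- The interpretation in which the predicates outside `S` are emptied. -/
def Interp.restrict (I : Interp Δ) (S : Set Key) : Interp Δ where
  con A := {d | d ∈ I.con A ∧ (false, A) ∈ S}
  rol r := {p | p ∈ I.rol r ∧ (true, r) ∈ S}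
  ind := I.ind

theorem Role.mem_ext_restrict {I : Interp Δ} {S : Set Key} {R : Role} {p : Δ × Δ} :
    p ∈ R.ext (I.restrict S) ↔ p ∈ R.ext I ∧ (true, R.roleName) ∈ S := by
  cases R <;> rfl

/-- A predicate is either kept as it is or emptied, so a witness survives unchanged precisely when
every predicate it relies on is kept. -/
theorem Concept.mem_ext_restrict {I : Interp Δ} {S : Set Key} {C : Concept} {d : Δ} :
    d ∈ C.ext (I.restrict S) ↔ d ∈ C.ext I ∧ ∀ k ∈ C.keys, k ∈ S := by
  induction C generalizing d with
  | top => simp [Concept.ext, Concept.keys]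
  | atom A => simp [Concept.ext, Concept.keys, Interp.restrict]
  | nominal a => simp [Concept.ext, Concept.keys, Interp.restrict]
  | inter C D ihC ihD =>
    simp only [Concept.ext, Concept.keys, Set.mem_inter_iff, ihC, ihD, List.mem_append, or_imp,
      forall_and]
    tauto
  | ex R C ih =>
    simp only [Concept.ext, Concept.keys, Set.mem_ofPred_eq, ih, Role.mem_ext_restrict,
      List.mem_cons, or_imp, forall_and, forall_eq]
    constructor
    · rintro ⟨e, ⟨h1, h2⟩, h3, h4⟩
      exact ⟨⟨e, h1, h3⟩, h2, h4⟩
    · rintro ⟨⟨e, h1, h3⟩, h2, h4⟩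
      exact ⟨e, ⟨h1, h2⟩, h3, h4⟩

/-- If a left side still holds after the emptying, it held before and its predicates are in `S`;
closure puts those of the right side in `S`, so the old witnesses for the right side survive. -/
theorem IsModel.restrict {I : Interp Δ} {K : KB} {S : Set Key} (h : IsModel I K)
    (hS : K.Closed S) : IsModel (I.restrict S) K := by
  refine ⟨fun i hi d hd => ?_, fun s hs => ?_⟩
  · rw [Concept.mem_ext_restrict] at hd ⊢
    exact ⟨h.1 i hi hd.1, hS.2 i hi hd.2⟩
  · have h1 := h.2 s hs
    have h2 := hS.1 s hs
    cases s with
    | concept A a => exact ⟨h1, h2⟩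
    | role R a b => exact Role.mem_ext_restrict.2 ⟨h1, h2⟩

/-- A non-empty predicate outside `S` would make the restriction to `S` a strictly smaller model. -/
theorem IsMinimalModel.keys_subset {I : Interp Δ} {K : KB} {S : Set Key} (h : IsMinimalModel I K)
    (hS : K.Closed S) : I.keys ⊆ S := by
  intro k hk
  by_contra hkS
  refine h.2 ⟨I.restrict S, ⟨⟨fun _ => rfl, fun A d hd => hd.1, fun r p hp => hp.1⟩, ?_⟩,
    h.1.restrict hS⟩
  obtain ⟨_ | _, A⟩ := k
  · obtain ⟨d, hd⟩ := Interp.mem_keys_con.1 hk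
    exact .inl ⟨A, fun d hd => hd.1, fun hsub => hkS (hsub hd).2⟩
  · obtain ⟨d, hd⟩ := Interp.mem_keys_rol.1 hk
    exact .inr ⟨A, fun d hd => hd.1, fun hsub => hkS (hsub hd).2⟩

end

theorem satInMinimalModel_iff_keys {K : KB} {C : Concept} :
    SatInMinimalModel.{u} K C ↔ ∀ k ∈ C.keys, k ∈ K.representative.keys := by
  constructor
  · rintro ⟨Δ, I, hI, d, hd⟩ k hk
    exact hI.keys_subset K.closed_representative (Concept.keys_subset_of_mem_ext hd k hk)
  · intro h
    -- A copy of the representative model in the universe in which domains are sought.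
    let I : Interp PUnit.{u + 1} :=
      { con := fun A => {_d | (false, A) ∈ K.representative.keys}
        rol := fun r => {_p | (true, r) ∈ K.representative.keys}
        ind := fun _ => PUnit.unit }
    have hI : I.keys = K.representative.keys := by
      ext ⟨_ | _, A⟩
      · rw [Interp.mem_keys_con]
        exact ⟨fun ⟨_, h⟩ => h, fun h => ⟨PUnit.unit, h⟩⟩
      · rw [Interp.mem_keys_rol]
        exact ⟨fun ⟨_, h⟩ => h, fun h => ⟨(PUnit.unit, PUnit.unit), h⟩⟩
    exact ⟨_, I, isMinimalModel_of_keys_eq hI, PUnit.unit,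
      Concept.mem_ext_of_keys_subset _ (hI.symm ▸ h)⟩

theorem satInMinimalModel_iff {K : KB} {C : Concept} :
    SatInMinimalModel.{u} K C ↔ (C.ext K.representative).Nonempty := by
  rw [satInMinimalModel_iff_keys]
  exact ⟨fun h => ⟨(), Concept.mem_ext_of_keys_subset _ h⟩,
    fun ⟨_, h⟩ => Concept.keys_subset_of_mem_ext h⟩

end MinMod

namespace MinMod

/-! ## Structured programs over stacks -/

/-- What a program does with one of its stacks in one step. -/
inductive StkOp (Γ : Type) : Type
  | keep
  | pop
  | push (x : Γ)

namespace StkOp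
variable {Γ : Type}

def apply : StkOp Γ → List Γ → List Γ
  | keep, l => l
  | pop, l => l.tail
  | push x, l => x :: l

/-- The head movement on a tape that holds the stack with its top under the head. -/
def headMove : StkOp Γ → Move
  | keep => .stay
  | pop => .left
  | push _ => .right

/-- The symbol to be written once the head has moved. -/
def pending : StkOp Γ → Option Γ
  | push x => some x
  | _ => none

end StkOp

/-- One step of a program. -/
structure Op (ι Γ β : Type) : Type where
  inMove : Move
  stk : ι → StkOp Γ
  emit : List β

/-- The memory of a program: the position on the input, the stacks, and the output so far. -/
@[ext] structure Mem (ι Γ β : Type) : Type where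
  pos : ℕ
  stk : ι → List Γ
  out : List β

/-- Executing one step on an input of length `n`. -/
def Op.apply {ι Γ β : Type} (n : ℕ) (o : Op ι Γ β) (m : Mem ι Γ β) : Mem ι Γ β where
  pos := min (o.inMove.apply m.pos) (n + 1)
  stk i := (o.stk i).apply (m.stk i)
  out := m.out ++ o.emit

/-- All stacks have an admissible height. -/
def Mem.Fits {ι Γ β : Type} (Ok : ℕ → Prop) (m : Mem ι Γ β) : Prop :=
  ∀ i, Ok (m.stk i).length

/-- Programs with an input tape, stacks indexed by `ι`, an output tape and a result in `E`. In each
step they see the current input letter and the tops of all stacks. -/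
structure Prog (α β ι Γ E : Type) : Type 1 where
  Q : Type
  fin : Finite Q
  start : Q
  δ : Q → InSymbol α → (ι → Option Γ) → Op ι Γ β × (Q ⊕ E)

namespace Prog
variable {α β ι Γ E E' S : Type}

/-- The operation and the successor in state `q` with memory `m`. -/
def look (P : Prog α β ι Γ E) (w : List α) (q : P.Q) (m : Mem ι Γ β) : Op ι Γ β × (P.Q ⊕ E) :=
  P.δ q (readInput w m.pos) fun i => (m.stk i).head?

/-- From state `q` the program stops after exactly `t` steps, with all stack heights on the way
admissible. -/
inductive Steps (P : Prog α β ι Γ E) (w : List α) (Ok : ℕ → Prop) :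
    P.Q → Mem ι Γ β → E → Mem ι Γ β → ℕ → Prop
  | done {q m o e} (h : P.look w q m = (o, .inr e)) (hf : (o.apply w.length m).Fits Ok) :
      Steps P w Ok q m e (o.apply w.length m) 1
  | next {q m o q' e m' t} (h : P.look w q m = (o, .inl q')) (hf : (o.apply w.length m).Fits Ok)
      (hs : Steps P w Ok q' (o.apply w.length m) e m' t) : Steps P w Ok q m e m' (t + 1)

/-- The program stops after at most `t` steps with result `e` and memory `m'`. -/
def Runs (P : Prog α β ι Γ E) (w : List α) (Ok : ℕ → Prop) (m : Mem ι Γ β) (e : E)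
    (m' : Mem ι Γ β) (t : ℕ) : Prop :=
  ∃ t' ≤ t, P.Steps w Ok P.start m e m' t'

theorem Runs.mono {P : Prog α β ι Γ E} {w : List α} {Ok : ℕ → Prop} {m m' : Mem ι Γ β} {e : E}
    {t t' : ℕ} (h : P.Runs w Ok m e m' t) (ht : t ≤ t') : P.Runs w Ok m e m' t' := by
  obtain ⟨s, hs, h⟩ := h
  exact ⟨s, hs.trans ht, h⟩

/-- The program that performs one step. -/
def act (f : InSymbol α → (ι → Option Γ) → Op ι Γ β × E) : Prog α β ι Γ E where
  Q := Unit
  fin := inferInstance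
  start := ()
  δ _ s t := ((f s t).1, .inr (f s t).2)

/-- Sequential composition. -/
def bind [Finite E] (P : Prog α β ι Γ E) (k : E → Prog α β ι Γ E') : Prog α β ι Γ E' where
  Q := P.Q ⊕ Σ e, (k e).Q
  fin := by
    have := P.fin
    have := fun e => (k e).fin
    infer_instance
  start := .inl P.start
  δ q s t := match q with
    | .inl q => match P.δ q s t with
      | (o, .inl q') => (o, .inl (.inl q'))
      | (o, .inr e) => (o, .inl (.inr ⟨e, (k e).start⟩))
    | .inr ⟨e, q⟩ => match (k e).δ q s t with
      | (o, .inl q') => (o, .inl (.inr ⟨e, q'⟩))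
      | (o, .inr e') => (o, .inr e')

/-- Iteration of a program with a state `s : S`, until it returns a result in `E`. -/
def loop [Finite S] (body : S → Prog α β ι Γ (S ⊕ E)) (s : S) : Prog α β ι Γ E where
  Q := Σ s, (body s).Q
  fin := by
    have := fun s => (body s).fin
    infer_instance
  start := ⟨s, (body s).start⟩
  δ q c t := match (body q.1).δ q.2 c t with
    | (o, .inl q') => (o, .inl ⟨q.1, q'⟩)
    | (o, .inr (.inl s')) => (o, .inl ⟨s', (body s').start⟩)
    | (o, .inr (.inr e)) => (o, .inr e)

variable {w : List α} {Ok : ℕ → Prop} {m m₁ m' : Mem ι Γ β} {t₁ t₂ : ℕ}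

theorem runs_act {f : InSymbol α → (ι → Option Γ) → Op ι Γ β × E} {o : Op ι Γ β} {e : E}
    (h : f (readInput w m.pos) (fun i => (m.stk i).head?) = (o, e))
    (hm : o.apply w.length m = m') (hf : m'.Fits Ok) : (act f).Runs w Ok m e m' 1 := by
  subst hm
  refine ⟨1, le_rfl, .done ?_ hf⟩
  simp only [look, act, h]

theorem Steps.bind_right [Finite E] {P : Prog α β ι Γ E} {k : E → Prog α β ι Γ E'} {e : E}
    {q : (k e).Q} {e' : E'} {t : ℕ} (h : (k e).Steps w Ok q m e' m' t) :
    (bind P k).Steps w Ok (.inr ⟨e, q⟩) m e' m' t := by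
  induction h with
  | done h hf => exact .done (by simp only [look] at h; simp only [look, bind, h]) hf
  | next h hf _ ih =>
    exact .next (q' := (Sum.inr ⟨e, _⟩ : P.Q ⊕ Σ e, (k e).Q)) (by simp only [look] at h; simp only
        [look, bind, h]) hf ih

/-- The last step of the first program already enters the start state of the second, so running
times add without overhead. -/
theorem Steps.bind [Finite E] {P : Prog α β ι Γ E} {k : E → Prog α β ι Γ E'} {e : E} {q : P.Q}
    {e' : E'} (h : P.Steps w Ok q m e m₁ t₁)
    (h' : (k e).Steps w Ok (k e).start m₁ e' m' t₂) :
    (P.bind k).Steps w Ok (.inl q) m e' m' (t₁ + t₂) := by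
  induction h with
  | @done q m o e h hf =>
    rw [add_comm]
    refine .next (q' := (Sum.inr ⟨e, (k e).start⟩ : P.Q ⊕ Σ e, (k e).Q)) (o := o) ?_ hf
        h'.bind_right
    simp only [look] at h
    simp only [look, Prog.bind, h]
  | @next q m o q₁ e m₂ t h hf _ ih =>
    rw [add_right_comm]
    refine .next (q' := (Sum.inl q₁ : P.Q ⊕ Σ e, (k e).Q)) (o := o) ?_ hf (ih h')
    simp only [look] at h
    simp only [look, Prog.bind, h]

theorem Runs.bind [Finite E] {P : Prog α β ι Γ E} {k : E → Prog α β ι Γ E'} {e : E} {e' : E'}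
    (h : P.Runs w Ok m e m₁ t₁) (h' : (k e).Runs w Ok m₁ e' m' t₂) :
    (P.bind k).Runs w Ok m e' m' (t₁ + t₂) := by
  obtain ⟨s₁, hs₁, h⟩ := h
  obtain ⟨s₂, hs₂, h'⟩ := h'
  exact ⟨s₁ + s₂, add_le_add hs₁ hs₂, h.bind h'⟩

theorem Runs.loop_exit [Finite S] {body : S → Prog α β ι Γ (S ⊕ E)} {s : S} {e : E} {t : ℕ}
    (h : (body s).Runs w Ok m (.inr e) m' t) : (loop body s).Runs w Ok m e m' t := by
  obtain ⟨t', ht', h⟩ := h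
  refine ⟨t', ht', ?_⟩
  -- The result is made a variable constrained by an equation so that the induction over the run
  -- applies.
  have key : ∀ q r, (body s).Steps w Ok q m r m' t' → r = .inr e →
      (loop body s).Steps w Ok ⟨s, q⟩ m e m' t' := by
    clear h ht'
    intro q r h hr
    induction h with
    | done h hf =>
      subst hr
      exact .done (by simp only [look] at h; simp only [look, loop, h]) hf
    | @next q m o q₁ e m₂ t h hf _ ih =>
      exact .next (q' := (⟨s, q₁⟩ : Σ s, (body s).Q)) (by simp only [look] at h; simp only [look,
          loop, h]) hf
        (ih hr)
  exact key _ _ h rfl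

/-- The parameter of a loop determines only its start state; the states and transitions are common
to all parameters. -/
theorem Steps.loop_start [Finite S] {body : S → Prog α β ι Γ (S ⊕ E)} {s s' : S} {e : E} {t : ℕ}
    {q : Σ s, (body s).Q} (h : (loop body s').Steps w Ok q m e m' t) :
    (loop body s).Steps w Ok q m e m' t := by
  change (loop body s').Q at q
  induction h with
  | done h hf => exact .done h hf
  | next h hf _ ih => exact .next h hf ih

theorem Runs.loop_next [Finite S] {body : S → Prog α β ι Γ (S ⊕ E)} {s s' : S} {e : E}
    (h : (body s).Runs w Ok m (.inl s') m₁ t₁) (h' : (loop body s').Runs w Ok m₁ e m' t₂) :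
    (loop body s).Runs w Ok m e m' (t₁ + t₂) := by
  obtain ⟨u₁, hu₁, h⟩ := h
  obtain ⟨u₂, hu₂, h'⟩ := h'
  refine ⟨u₁ + u₂, add_le_add hu₁ hu₂, ?_⟩
  have key : ∀ q r, (body s).Steps w Ok q m r m₁ u₁ → r = .inl s' →
      (loop body s).Steps w Ok ⟨s, q⟩ m e m' (u₁ + u₂) := by
    clear h hu₁
    intro q r h hr
    induction h with
    | @done q m o r h hf =>
      subst hr
      rw [add_comm]
      exact .next (o := o) (q' := (⟨s', (body s').start⟩ : Σ s, (body s).Q))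
        (by simp only [look] at h; simp only [look, loop, h]) hf h'.loop_start
    | @next q m o q₁ e m₂ t h hf _ ih =>
      rw [add_right_comm]
      exact .next (o := o) (q' := (⟨s, q₁⟩ : Σ s, (body s).Q))
        (by simp only [look] at h; simp only [look, loop, h]) hf (ih h' hr)
  exact key _ _ h rfl

/-! ### Compilation to Turing machines -/

/-- A stack is kept on a tape whose cell `0` is blank, with its top under the head. A step of the
program takes two steps of the machine: the heads move, then the pushed symbols are written. -/
def toMachine [Finite E] [Finite ι] [Finite Γ] (P : Prog α β ι Γ E) : Machine α β where
  Q := (P.Q ⊕ E) × Option (ι → Option Γ)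
  Γ := Option Γ
  ι := ι
  finQ := by
    have := P.fin
    infer_instance
  finΓ := inferInstance
  finι := inferInstance
  start := (.inl P.start, none)
  blank := none
  δ q s t := match q with
    | (.inl q, none) => some
      { next := ((P.δ q s t).2, some fun i => ((P.δ q s t).1.stk i).pending)
        inMove := (P.δ q s t).1.inMove
        -- The cell that is left keeps its symbol: a pushed symbol belongs in the cell to which the
        -- head is about to move.
        write := t
        move := fun i => ((P.δ q s t).1.stk i).headMove
        emit := (P.δ q s t).1.emit }
    | (r, some p) => some
      { next := (r, none)
        inMove := .stay
        -- Without a push the cell is unchanged. Popped symbols remain on the tape above the head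
        -- and are overwritten by later pushes.
        write := fun i => (p i).or (t i)
        move := fun _ => .stay
        emit := [] }
    | (.inr _, none) => none

end Prog

/-- The cells `0, …, l.length` of a tape hold the stack `l`. -/
def HoldsStack {Γ : Type} (f : ℕ → Option Γ) : List Γ → Prop
  | [] => f 0 = none
  | x :: l => f (l.length + 1) = some x ∧ HoldsStack f l

namespace HoldsStack
variable {Γ : Type} {f : ℕ → Option Γ} {l : List Γ}

theorem top (h : HoldsStack f l) : f l.length = l.head? := by
  cases l with
  | nil => exact h
  | cons x l => exact h.1

theorem tail (h : HoldsStack f l) : HoldsStack f l.tail := by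
  cases l with
  | nil => exact h
  | cons x l => exact h.2

theorem update (h : HoldsStack f l) {k : ℕ} (hk : l.length < k) (x : Option Γ) :
    HoldsStack (Function.update f k x) l := by
  induction l with
  | nil => exact (Function.update_of_ne (Nat.ne_of_lt hk) _ _).trans h
  | cons y l ih =>
    exact ⟨(Function.update_of_ne (Nat.ne_of_lt hk) _ _).trans h.1,
      ih h.2 ((Nat.lt_succ_self _).trans hk)⟩

/-- Only a push changes a cell, and that cell lies just above those that hold the old stack. -/
theorem apply (h : HoldsStack f l) (o : StkOp Γ) :
    HoldsStack (Function.update f (o.apply l).length (o.pending.or (f (o.apply l).length)))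
      (o.apply l) := by
  cases o with
  | keep => simpa [StkOp.apply, StkOp.pending] using h
  | pop => simpa [StkOp.apply, StkOp.pending] using h.tail
  | push x =>
    refine ⟨?_, h.update (Nat.lt_succ_self _) _⟩
    simp [StkOp.apply, StkOp.pending]

end HoldsStack

/-- The head position is the height of the stack. A pop on an empty stack and a left move in cell
`0` are both without effect. -/
theorem StkOp.headMove_apply {Γ : Type} (o : StkOp Γ) (l : List Γ) :
    o.headMove.apply l.length = (o.apply l).length := by
  cases o <;> simp [StkOp.headMove, Move.apply, StkOp.apply]

namespace Machine
variable {α β : Type} (M : Machine α β)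

/-- One step, where a halted machine stays where it is. -/
def stepStay (w : List α) (c : M.Cfg) : M.Cfg := (M.step w c).getD c

theorem cfgAt_eq (w : List α) (t : ℕ) : M.cfgAt w t = (M.stepStay w)^[t] M.initial := rfl

variable {M}

theorem cfgAt_succ (w : List α) (t : ℕ) :
    M.cfgAt w (t + 1) = (M.step w (M.cfgAt w t)).getD (M.cfgAt w t) :=
  Function.iterate_succ_apply' _ _ _

theorem iterate_stepStay_of_halted {w : List α} {c : M.Cfg} (h : M.step w c = none) (t : ℕ) :
    (M.stepStay w)^[t] c = c :=
  Function.iterate_fixed (by simp [stepStay, h]) t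

theorem cfgAt_of_le {w : List α} {s t : ℕ} (h : M.step w (M.cfgAt w s) = none) (hst : s ≤ t) :
    M.cfgAt w t = M.cfgAt w s := by
  obtain ⟨k, rfl⟩ := Nat.exists_eq_add_of_le hst
  rw [cfgAt_eq, add_comm, Function.iterate_add_apply, ← cfgAt_eq, iterate_stepStay_of_halted h]

theorem OutputsIn.mono {w : List α} {v : List β} {s t : ℕ} (h : M.OutputsIn w v s) (hst : s ≤ t) :
    M.OutputsIn w v t := by
  unfold OutputsIn
  rwa [cfgAt_of_le h.1 hst]

end Machine

/-! ### Correctness of the compilation to Turing machines -/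

namespace Prog
variable {α β ι Γ E : Type} [Finite E] [Finite ι] [Finite Γ]

/-- The machine configuration `c` represents the control state `r` with memory `m`. -/
structure Represents (P : Prog α β ι Γ E) (c : P.toMachine.Cfg) (r : P.Q ⊕ E) (m : Mem ι Γ β) :
    Prop where
  state : c.state = (r, none)
  inPos : c.inPos = m.pos
  out : c.out = m.out
  head : ∀ i, c.head i = (m.stk i).length
  work : ∀ i, HoldsStack (c.work i) (m.stk i)

variable {P : Prog α β ι Γ E} {w : List α} {Ok : ℕ → Prop}

theorem toMachine_step_move {q : P.Q} {m : Mem ι Γ β} {o : Op ι Γ β} {r : P.Q ⊕ E}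
    (h : P.look w q m = (o, r)) {f : ι → ℕ → Option Γ} (hf : ∀ i, HoldsStack (f i) (m.stk i)) :
    P.toMachine.step w (Machine.Cfg.mk (M := P.toMachine) (.inl q, none) m.pos f
        (fun i => (m.stk i).length) m.out) =
      some (Machine.Cfg.mk (M := P.toMachine) (r, some fun i => (o.stk i).pending)
        (o.apply w.length m).pos f (fun i => ((o.apply w.length m).stk i).length)
        (o.apply w.length m).out) := by
  have h' : P.δ q (readInput w m.pos) (fun i => f i (m.stk i).length) = (o, r) := by
    rw [← h, look]
    exact congrArg _ (funext fun i => (hf i).top)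
  -- The new configuration as a function of the value of the transition function, so that this value
  -- can be replaced by `(o, r)` throughout.
  let g (x : Op ι Γ β × (P.Q ⊕ E)) (f : ι → ℕ → Option Γ) (hd : ι → ℕ) : P.toMachine.Cfg :=
    ⟨(x.2, some fun i => (x.1.stk i).pending), min (x.1.inMove.apply m.pos) (w.length + 1), f, hd,
      m.out ++ x.1.emit⟩
  have h1 : P.toMachine.step w (Machine.Cfg.mk (M := P.toMachine) (.inl q, none) m.pos f
      (fun i => (m.stk i).length) m.out) =
      some (g (P.δ q (readInput w m.pos) fun i => f i (m.stk i).length)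
        (fun i => Function.update (f i) (m.stk i).length (f i (m.stk i).length))
        fun i => ((P.δ q (readInput w m.pos) fun i => f i (m.stk i).length).1.stk i).headMove.apply
          (m.stk i).length) := rfl
  rw [h1, h', show (fun i => Function.update (f i) (m.stk i).length (f i (m.stk i).length)) = f from
    funext fun i => Function.update_eq_self _ _,
    show (fun i => (o.stk i).headMove.apply (m.stk i).length) =
      fun i => ((o.stk i).apply (m.stk i)).length from funext fun i => StkOp.headMove_apply _ _]
  rfl

theorem toMachine_step_write {r : P.Q ⊕ E} {p : ι → Option Γ} {pos : ℕ} {f : ι → ℕ → Option Γ}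
    {hd : ι → ℕ} {out : List β} (hpos : pos ≤ w.length + 1) :
    P.toMachine.step w (Machine.Cfg.mk (M := P.toMachine) (r, some p) pos f hd out) =
      some (Machine.Cfg.mk (M := P.toMachine) (r, none) pos
        (fun i => Function.update (f i) (hd i) ((p i).or (f i (hd i)))) hd out) := by
  have h1 : P.toMachine.step w (Machine.Cfg.mk (M := P.toMachine) (r, some p) pos f hd out) =
      some (Machine.Cfg.mk (M := P.toMachine) (r, none) (min pos (w.length + 1))
        (fun i => Function.update (f i) (hd i) ((p i).or (f i (hd i)))) hd (out ++ [])) := by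
    cases r <;> rfl
  rw [h1, min_eq_left hpos, List.append_nil]

/-- The heads rest during the second of the two machine steps, so the intermediate configuration
needs no space beyond that of the final one. -/
theorem Represents.step {c : P.toMachine.Cfg} {q : P.Q} {m : Mem ι Γ β} {o : Op ι Γ β}
    {r : P.Q ⊕ E} (hc : P.Represents c (.inl q) m) (h : P.look w q m = (o, r)) :
    ∃ c₁ c₂, P.toMachine.step w c = some c₁ ∧ P.toMachine.step w c₁ = some c₂ ∧
      P.Represents c₂ r (o.apply w.length m) ∧ c₁.head = c₂.head := by
  obtain ⟨state, inPos, f, head, out⟩ := c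
  obtain ⟨h1, h2, h3, h4, h5⟩ := hc
  dsimp only at h1 h2 h3 h4 h5
  obtain rfl : head = fun i => (m.stk i).length := funext h4
  subst h1 h2 h3
  exact ⟨_, _, toMachine_step_move h h5, toMachine_step_write (min_le_right _ _),
    ⟨rfl, rfl, rfl, fun i => rfl, fun i => (h5 i).apply _⟩, rfl⟩

theorem Represents.iterate {c : P.toMachine.Cfg} {q : P.Q} {m m' : Mem ι Γ β} {e : E} {t : ℕ}
    (hc : P.Represents c (.inl q) m) (hm : m.Fits Ok) (h : P.Steps w Ok q m e m' t) :
    P.Represents ((P.toMachine.stepStay w)^[2 * t] c) (.inr e) m' ∧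
      ∀ s i, s < 2 * t + 1 → Ok (((P.toMachine.stepStay w)^[s] c).head i) := by
  induction h generalizing c with
  | @done q m o e h hf =>
    obtain ⟨c₁, c₂, h1, h2, h3, h4⟩ := hc.step h
    have e1 : P.toMachine.stepStay w c = c₁ := by simp [Machine.stepStay, h1]
    have e2 : P.toMachine.stepStay w c₁ = c₂ := by simp [Machine.stepStay, h2]
    refine ⟨by simpa [e1, e2] using h3, fun s i hs => ?_⟩
    match s with
    | 0 => simpa [hc.head] using hm i
    | 1 => simpa [e1, h4, h3.head] using hf i
    | 2 => simpa [e1, e2, h3.head] using hf i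
    | s + 3 => omega
  | @next q m o q₁ e m₂ t h hf _ ih =>
    obtain ⟨c₁, c₂, h1, h2, h3, h4⟩ := hc.step h
    have e1 : P.toMachine.stepStay w c = c₁ := by simp [Machine.stepStay, h1]
    have e2 : P.toMachine.stepStay w c₁ = c₂ := by simp [Machine.stepStay, h2]
    obtain ⟨ih1, ih2⟩ := ih h3 hf
    have e3 : ∀ s, (P.toMachine.stepStay w)^[s + 2] c = (P.toMachine.stepStay w)^[s] c₂ := by
      intro s
      rw [Function.iterate_add_apply]
      simp [e1, e2]
    refine ⟨by rw [mul_add, mul_one, e3]; exact ih1, fun s i hs => ?_⟩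
    match s with
    | 0 => simpa [hc.head] using hm i
    | 1 => simpa [e1, h4, h3.head] using hf i
    | s + 2 =>
      rw [e3]
      exact ih2 s i (by omega)

/-- The initial memory. -/
def initialMem : Mem ι Γ β where
  pos := 0
  stk _ := []
  out := []

theorem represents_initial : P.Represents P.toMachine.initial (.inl P.start) initialMem :=
  ⟨rfl, rfl, rfl, fun _ => rfl, fun _ => rfl⟩

theorem Represents.halted {c : P.toMachine.Cfg} {e : E} {m : Mem ι Γ β}
    (hc : P.Represents c (.inr e) m) : P.toMachine.step w c = none := by
  simp [Machine.step, toMachine, hc.state]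

theorem Runs.outputsIn {e : E} {m : Mem ι Γ β} {t : ℕ} (h0 : Ok 0)
    (h : P.Runs w Ok initialMem e m t) : P.toMachine.OutputsIn w m.out (2 * t) := by
  obtain ⟨t', ht', h⟩ := h
  obtain ⟨h1, -⟩ := represents_initial.iterate (fun _ => h0) h
  refine Machine.OutputsIn.mono (s := 2 * t') ⟨h1.halted, h1.out⟩ (by omega)

/-- The run bounds the heads until the machine halts; from then on they no longer move. -/
theorem Runs.head_ok {e : E} {m : Mem ι Γ β} {t : ℕ} (h0 : Ok 0)
    (h : P.Runs w Ok initialMem e m t) (s : ℕ) (i : ι) : Ok ((P.toMachine.cfgAt w s).head i) := by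
  obtain ⟨t', ht', h⟩ := h
  obtain ⟨h1, h2⟩ := represents_initial.iterate (fun _ => h0) h
  rcases lt_or_ge s (2 * t' + 1) with hs | hs
  · exact h2 s i hs
  · rw [Machine.cfgAt_of_le h1.halted (by omega : 2 * t' ≤ s)]
    exact h2 (2 * t') i (by omega)

end Prog
end MinMod

/-! ### Elementary programs and their running times -/

namespace MinMod

instance {α : Type} [Finite α] : Finite (InSymbol α) :=
  Finite.of_injective
    (fun s : InSymbol α => match s with
      | .leftEnd => none
      | .letter a => some (some a)
      | .rightEnd => some none)
    fun s t h => by cases s <;> cases t <;> simp_all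

theorem readInput_eq_leftEnd {α : Type} {w : List α} {j : ℕ} :
    readInput w j = .leftEnd ↔ j = 0 := by
  cases j with
  | zero => simp [readInput]
  | succ j =>
    simp only [readInput, Nat.add_eq_zero_iff, one_ne_zero, and_false, iff_false]
    split <;> simp

/-- The content of a cell of the input tape that is beyond the left end. -/
def InSymbol.ofOption {α : Type} : Option α → InSymbol α
  | some a => .letter a
  | none => .rightEnd

/-- The offset `1` accounts for the left end marker in cell `0`. -/
theorem readInput_append {α : Type} (u v : List α) :
    readInput (u ++ v) (u.length + 1) = .ofOption v.head? := by
  cases v <;> simp [readInput, InSymbol.ofOption]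

namespace Prog
variable {α β ι Γ E : Type}

/-- The step that changes nothing. -/
def nop : Op ι Γ β where
  inMove := .stay
  stk _ := .keep
  emit := []

/-- The step that performs the given operations on the stacks. -/
def onStk (f : ι → StkOp Γ) : Op ι Γ β where
  inMove := .stay
  stk := f
  emit := []

/-- The step that moves the input head. -/
def onInput (mv : Move) : Op ι Γ β where
  inMove := mv
  stk _ := .keep
  emit := []

theorem nop_apply {n : ℕ} {m : Mem ι Γ β} (h : m.pos ≤ n + 1) : nop.apply n m = m := by
  simp [nop, Op.apply, Move.apply, StkOp.apply, h]

/-- Stop with result `e`. -/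
def ret (e : E) : Prog α β ι Γ E := act fun _ _ => (nop, e)

/-- Append `v` to the output. -/
def emit (v : List β) : Prog α β ι Γ Unit := act fun _ _ => (⟨.stay, fun _ => .keep, v⟩, ())

section
variable [DecidableEq ι]

/-- Put the symbols of `l` on top of stack `i`. -/
def pushes (i : ι) : List Γ → Prog α β ι Γ Unit
  | [] => ret ()
  | x :: l => (pushes i l).bind fun _ =>
    act fun _ _ => (onStk (fun k => if k = i then .push x else .keep), ())

/-- Move the content of stack `i` to stack `j`. -/
def pour (i j : ι) : Prog α β ι Γ Unit :=
  loop (S := Unit) (fun _ => act fun _ t => match t i with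
    | some x =>
      (onStk (fun k => if k = i then .pop else if k = j then .push x else .keep),
        .inl ())
    | none => (nop, .inr ())) ()

/-- Empty stack `i`. -/
def clear (i : ι) : Prog α β ι Γ Unit :=
  loop (S := Unit) (fun _ => act fun _ t => match t i with
    | some _ => (onStk (fun k => if k = i then .pop else .keep), .inl ())
    | none => (nop, .inr ())) ()

end

/-- Move the input head to the first letter. -/
def rewind : Prog α β ι Γ Unit :=
  loop (S := Unit) (fun _ => act fun s _ => match s with
    | .leftEnd => (onInput .right, .inr ())
    | _ => (onInput .left, .inl ())) ()

variable {w : List α} {Ok : ℕ → Prop} {m m' : Mem ι Γ β}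

theorem runs_ret {e : E} (hpos : m.pos ≤ w.length + 1) (hm : m.Fits Ok) :
    (ret e).Runs w Ok m e m 1 :=
  runs_act rfl (nop_apply hpos) hm

theorem runs_emit {v : List β} (hpos : m.pos ≤ w.length + 1) (hm : m.Fits Ok) :
    (emit v).Runs w Ok m () { m with out := m.out ++ v } 1 := by
  refine runs_act rfl ?_ hm
  simp [Op.apply, Move.apply, StkOp.apply, hpos]

theorem runs_rewind (hpos : m.pos ≤ w.length + 1) (hm : m.Fits Ok) :
    (rewind).Runs w Ok m () { m with pos := 1 } (m.pos + 1) := by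
  obtain ⟨pos, stk, out⟩ := m
  dsimp only at hpos
  induction pos with
  | zero =>
    refine Runs.loop_exit (runs_act rfl ?_ hm)
    simp [onInput, Op.apply, Move.apply, StkOp.apply]
  | succ j ih =>
    rw [add_comm (j + 1) 1]
    refine Runs.loop_next (m₁ := ⟨j, stk, out⟩) (runs_act (o := onInput .left) (e := Sum.inl ())
      ?_ ?_ hm) (ih (by omega) hm)
    · have h : readInput w (j + 1) ≠ .leftEnd := by simp [readInput_eq_leftEnd]
      dsimp only
      split
      · contradiction
      · rfl
    · simp [onInput, Op.apply, Move.apply, StkOp.apply]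
      omega

variable [DecidableEq ι]

/-- The resulting memory is given by its components rather than by a formula, so that in
applications each stack can be compared separately. Every height up to the final one occurs on the
way, hence the form of `hOk`. -/
theorem runs_pushes {i : ι} {l : List Γ} (hpos : m.pos ≤ w.length + 1) (hm : m.Fits Ok)
    (hOk : ∀ k ≤ l.length + (m.stk i).length, Ok k) (hpos' : m'.pos = m.pos)
    (hout : m'.out = m.out) (hi : m'.stk i = l ++ m.stk i) (hk : ∀ k, k ≠ i → m'.stk k = m.stk k) :
    (pushes i l).Runs w Ok m () m' (l.length + 1) := by
  induction l generalizing m' with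
  | nil =>
    have : m' = m := by
      refine Mem.ext hpos' (funext fun k => ?_) hout
      by_cases h : k = i
      · rw [h]; exact hi
      · exact hk k h
    rw [this]
    exact runs_ret hpos hm
  | cons x l ih =>
    let m₁ : Mem ι Γ β := ⟨m.pos, fun k => if k = i then l ++ m.stk i else m.stk k, m.out⟩
    refine Runs.bind (m₁ := m₁) (ih (fun k h => hOk k (h.trans (by simp))) rfl rfl
      (by simp [m₁]) (fun k h => by simp [m₁, h])) (runs_act rfl ?_ ?_)
    · refine Mem.ext ?_ (funext fun k => ?_) ?_
      · simp [onStk, Op.apply, Move.apply, m₁, hpos', hpos]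
      · by_cases h : k = i
        · subst h
          simp [onStk, Op.apply, StkOp.apply, m₁, hi]
        · simp [onStk, Op.apply, StkOp.apply, m₁, h, hk]
      · simp [onStk, Op.apply, m₁, hout]
    · intro k
      by_cases h : k = i
      · subst h
        rw [hi]
        exact hOk _ (by simp)
      · rw [hk k h]
        exact hm k

theorem runs_pour {i j : ι} (hij : i ≠ j) (hpos : m.pos ≤ w.length + 1) (hm : m.Fits Ok)
    (hOk : ∀ k ≤ (m.stk i).length + (m.stk j).length, Ok k) (hpos' : m'.pos = m.pos)
    (hout : m'.out = m.out) (hi : m'.stk i = []) (hj : m'.stk j = (m.stk i).reverse ++ m.stk j)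
    (hk : ∀ k, k ≠ i → k ≠ j → m'.stk k = m.stk k) :
    (pour i j).Runs w Ok m () m' ((m.stk i).length + 1) := by
  induction hl : m.stk i generalizing m with
  | nil =>
    have : m' = m := by
      refine Mem.ext hpos' (funext fun k => ?_) hout
      by_cases h : k = i
      · rw [h, hi, hl]
      · by_cases h' : k = j
        · rw [h', hj, hl]; rfl
        · exact hk k h h'
    rw [this]
    refine Runs.loop_exit (runs_act (o := nop) (e := Sum.inr ()) ?_ (nop_apply hpos) hm)
    simp [hl]
  | cons x l ih =>
    let m₁ : Mem ι Γ β :=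
      ⟨m.pos, fun k => if k = i then l else if k = j then x :: m.stk j else m.stk k, m.out⟩
    rw [List.length_cons, add_comm (l.length + 1)]
    refine Runs.loop_next (m₁ := m₁) (runs_act
      (o := onStk fun k => if k = i then .pop else if k = j then .push x else .keep)
      ?_ ?_ ?_) (ih (m := m₁) hpos ?_ ?_ hpos' hout ?_ ?_ ?_)
    · simp [hl]
    · refine Mem.ext ?_ (funext fun k => ?_) ?_
      · simp [onStk, Op.apply, Move.apply, m₁, hpos]
      · by_cases h : k = i
        · subst h
          simp [onStk, Op.apply, StkOp.apply, m₁, hl]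
        · by_cases h' : k = j
          · subst h'
            simp [onStk, Op.apply, StkOp.apply, m₁, h]
          · simp [onStk, Op.apply, StkOp.apply, m₁, h, h']
      · simp [onStk, Op.apply, m₁]
    · intro k
      simp only [m₁]
      split_ifs with h h'
      · exact hOk _ (by simp [hl]; omega)
      · exact hOk _ (by simp [hl])
      · exact hm k
    · intro k
      simp only [m₁]
      split_ifs with h h'
      · exact hOk _ (by simp [hl]; omega)
      · exact hOk _ (by simp [hl])
      · exact hm k
    · intro k h
      refine hOk k (h.trans ?_)
      simp [m₁, hij.symm, hl]
      omega
    · simp [m₁, hj, hij.symm, hl]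
    · intro k h h'
      simp [m₁, h, h', hk]
    · simp [m₁]

theorem runs_clear {i : ι} (hpos : m.pos ≤ w.length + 1) (hm : m.Fits Ok)
    (hOk : ∀ k ≤ (m.stk i).length, Ok k) (hpos' : m'.pos = m.pos)
    (hout : m'.out = m.out) (hi : m'.stk i = []) (hk : ∀ k, k ≠ i → m'.stk k = m.stk k) :
    (clear i).Runs w Ok m () m' ((m.stk i).length + 1) := by
  induction hl : m.stk i generalizing m with
  | nil =>
    have : m' = m := by
      refine Mem.ext hpos' (funext fun k => ?_) hout
      by_cases h : k = i
      · rw [h, hi, hl]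
      · exact hk k h
    rw [this]
    refine Runs.loop_exit (runs_act (o := nop) (e := Sum.inr ()) ?_ (nop_apply hpos) hm)
    simp [hl]
  | cons x l ih =>
    let m₁ : Mem ι Γ β := ⟨m.pos, fun k => if k = i then l else m.stk k, m.out⟩
    have hm₁ : m₁.Fits Ok := by
      intro k
      simp only [m₁]
      split_ifs with h
      · exact hOk _ (by simp [hl])
      · exact hm k
    rw [List.length_cons, add_comm (l.length + 1)]
    refine Runs.loop_next (m₁ := m₁) (runs_act
      (o := onStk fun k => if k = i then .pop else .keep)
      ?_ ?_ hm₁) (ih (m := m₁) hpos hm₁ ?_ hpos' hout ?_ ?_)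
    · simp [hl]
    · refine Mem.ext ?_ (funext fun k => ?_) ?_
      · simp [onStk, Op.apply, Move.apply, m₁, hpos]
      · by_cases h : k = i
        · subst h
          simp [onStk, Op.apply, StkOp.apply, m₁, hl]
        · simp [onStk, Op.apply, StkOp.apply, m₁, h]
      · simp [onStk, Op.apply, m₁]
    · intro k h
      exact hOk k (h.trans (by simp [m₁, hl]))
    · intro k h
      simp [m₁, h, hk]
    · simp [m₁]

end Prog
end MinMod

namespace MinMod

/-! ## One pass over an instance: parsing and firing at the same time -/

/-- What may be pending while an instance is parsed. The flag `head` tells right sides of inclusions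
and assertions, whose predicates are to be derived, from left sides and the goal, whose predicates
are to be checked; `sort` is the first component of a `Key`. -/
inductive Pending : Type
  | items (inclusions : Bool)
  | con (head : Bool)
  | role (head : Bool)
  | key (head sort : Bool)
  | ind
  deriving DecidableEq, Fintype

/-- The predicate `k` is in the list `K`. -/
def isKnown (K : List Key) (k : Key) : Bool := decide (k ∈ K)

theorem all_isKnown {K L : List Key} : L.all (isKnown K) = true ↔ L ⊆ K := by
  simp only [List.all_eq_true, isKnown, decide_eq_true_eq]
  exact Iff.rfl

namespace Pending

/-- Parsing the next token. The first component of the result tells that a new item begins, the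
second one holds the letters of the name of a predicate. -/
def expand : Pending → Token → Option (Bool × List Bool × List Pending)
  | .items true, .incl => some (true, [], [.con false, .con true, .items true])
  | .items _, .conceptAssertion => some (true, [], [.key true false, .ind, .items false])
  | .items _, .roleAssertion => some (true, [], [.role true, .ind, .ind, .items false])
  | .items _, .goal => some (true, [], [.con false])
  | .con _, .top => some (false, [], [])
  | .con h, .atom => some (false, [], [.key h false])
  | .con _, .nominal => some (false, [], [.ind])
  | .con h, .inter => some (false, [], [.con h, .con h])
  | .con h, .ex => some (false, [], [.role h, .con h])
  | .role h, .name => some (false, [], [.key h true])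
  | .role h, .inv => some (false, [], [.key h true])
  | .key h s, .bit b => some (false, [b], [.key h s])
  | .ind, .bit _ => some (false, [], [.ind])
  | .ind, .endName => some (false, [], [])
  | _, _ => none

/-- The words that may be read for a pending item. -/
def Gen : Pending → List Token → Prop
  | .items true, w => ∃ K C, w = encodeInstance K C
  | .items false, w => ∃ (A : List Assertion) (C : Concept),
      w = A.flatMap Assertion.encode ++ .goal :: C.encode
  | .con _, w => ∃ C : Concept, w = C.encode
  | .role _, w => ∃ R : Role, w = R.encode
  | .key _ _, w => ∃ n, w = encodeName n
  | .ind, w => ∃ n, w = encodeName n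

/-- The words that may be read for a list of pending items. -/
def GenList : List Pending → List Token → Prop
  | [], w => w = []
  | x :: P, w => ∃ u v, w = u ++ v ∧ x.Gen u ∧ GenList P v

theorem genList_append {l P : List Pending} {w : List Token} :
    GenList (l ++ P) w ↔ ∃ u v, w = u ++ v ∧ GenList l u ∧ GenList P v := by
  induction l generalizing w with
  | nil => simp [GenList]
  | cons x l ih =>
    simp only [List.cons_append, GenList, ih]
    constructor
    · rintro ⟨u, _, rfl, hu, v, v', rfl, hv, hv'⟩
      exact ⟨u ++ v, v', by simp, ⟨u, v, rfl, hu, hv⟩, hv'⟩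
    · rintro ⟨_, v', rfl, ⟨u, v, rfl, hu, hv⟩, hv'⟩
      exact ⟨u, v ++ v', by simp, hu, v, v', rfl, hv, hv'⟩

/-- The clauses of `expand` are productions of the grammar of encodings. This is what makes a
successful pass a proof that the word encodes an instance. -/
theorem gen_of_expand {x : Pending} {t : Token} {r : Bool} {b : List Bool} {l : List Pending}
    {u : List Token} (h : x.expand t = some (r, b, l)) (hu : GenList l u) : x.Gen (t :: u) := by
  unfold expand at h
  split at h <;> simp only [Option.some.injEq, Prod.mk.injEq, reduceCtorEq] at h <;>
    obtain ⟨-, -, rfl⟩ := h <;> simp only [GenList, Gen] at hu ⊢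
  · obtain ⟨_, _, rfl, ⟨C, rfl⟩, _, _, rfl, ⟨D, rfl⟩, _, _, rfl, ⟨K, E, rfl⟩, rfl⟩ := hu
    exact ⟨⟨⟨C, D⟩ :: K.tbox, K.abox⟩, E, by simp [encodeInstance, Inclusion.encode]⟩
  · rename_i i
    obtain ⟨_, _, rfl, ⟨A, rfl⟩, _, _, rfl, ⟨a, rfl⟩, _, _, rfl, ⟨L, E, rfl⟩, rfl⟩ := hu
    cases i
    · exact ⟨.concept A a :: L, E, by simp [Assertion.encode]⟩
    · exact ⟨⟨[], .concept A a :: L⟩, E, by simp [encodeInstance, Assertion.encode]⟩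
  · rename_i i
    obtain ⟨_, _, rfl, ⟨R, rfl⟩, _, _, rfl, ⟨a, rfl⟩, _, _, rfl, ⟨b, rfl⟩, _, _, rfl,
      ⟨L, E, rfl⟩, rfl⟩ := hu
    cases i
    · exact ⟨.role R a b :: L, E, by simp [Assertion.encode]⟩
    · exact ⟨⟨[], .role R a b :: L⟩, E, by simp [encodeInstance, Assertion.encode]⟩
  · rename_i i
    obtain ⟨_, _, rfl, ⟨C, rfl⟩, rfl⟩ := hu
    cases i
    · exact ⟨[], C, by simp⟩
    · exact ⟨⟨[], []⟩, C, by simp [encodeInstance]⟩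
  · exact ⟨.top, by simp [Concept.encode, hu]⟩
  · obtain ⟨_, _, rfl, ⟨A, rfl⟩, rfl⟩ := hu
    exact ⟨.atom A, by simp [Concept.encode]⟩
  · obtain ⟨_, _, rfl, ⟨A, rfl⟩, rfl⟩ := hu
    exact ⟨.nominal A, by simp [Concept.encode]⟩
  · obtain ⟨_, _, rfl, ⟨C, rfl⟩, _, _, rfl, ⟨D, rfl⟩, rfl⟩ := hu
    exact ⟨.inter C D, by simp [Concept.encode]⟩
  · obtain ⟨_, _, rfl, ⟨R, rfl⟩, _, _, rfl, ⟨D, rfl⟩, rfl⟩ := hu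
    exact ⟨.ex R D, by simp [Concept.encode]⟩
  · obtain ⟨_, _, rfl, ⟨A, rfl⟩, rfl⟩ := hu
    exact ⟨.name A, by simp [Role.encode]⟩
  · obtain ⟨_, _, rfl, ⟨A, rfl⟩, rfl⟩ := hu
    exact ⟨.inv A, by simp [Role.encode]⟩
  · rename_i b
    obtain ⟨_, _, rfl, ⟨A, rfl⟩, rfl⟩ := hu
    exact ⟨b :: A, by simp [encodeName]⟩
  · rename_i b
    obtain ⟨_, _, rfl, ⟨A, rfl⟩, rfl⟩ := hu
    exact ⟨b :: A, by simp [encodeName]⟩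
  · exact ⟨[], by simp [encodeName, hu]⟩

/-- Read the tokens with the items `P` pending. `f` is the truth value of the part of the current
left side read so far, `n` the reversed part of the current name read so far, and `K` the list of
predicates derived so far. -/
def pass : Bool → List Pending → List Bool → List Key → List Token → Option (Bool × List Key)
  | f, [], [], K, [] => some (f, K)
  | f, .key true s :: P, n, K, .endName :: w =>
    pass f P [] (if f then (s, n.reverse) :: K else K) w
  | f, .key false s :: P, n, K, .endName :: w => pass (f && isKnown K (s, n.reverse)) P [] K w
  | f, x :: P, n, K, t :: w =>
    match x.expand t with
    -- A new item resets the truth value to `true`. Assertions are thus derived unconditionally, and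
    -- each left side, like the goal, is checked from scratch.
    | some (r, b, l) => pass (f || r) (l ++ P) (b ++ n) K w
    | none => none
  | _, _, _, _, _ => none

/-- The two clauses of `pass` for the end of a key cannot apply here, because `expand` rejects that
combination. -/
theorem pass_expand {f : Bool} {x : Pending} {P : List Pending} {n : List Bool} {K : List Key}
    {t : Token} {w : List Token} {r : Bool} {b : List Bool} {l : List Pending}
    (h : x.expand t = some (r, b, l)) :
    pass f (x :: P) n K (t :: w) = pass (f || r) (l ++ P) (b ++ n) K w := by
  rw [pass]
  · rw [h]
  all_goals
    rintro s rfl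
    rintro rfl
    simp [expand] at h

theorem genList_of_pass {f : Bool} {P : List Pending} {n : List Bool} {K : List Key}
    {w : List Token} {r : Bool × List Key} (h : pass f P n K w = some r) : GenList P w := by
  induction w generalizing f P n K with
  | nil =>
    unfold pass at h
    split at h <;> simp_all [GenList]
  | cons t w ih =>
    unfold pass at h
    split at h
    · simp_all
    · rename_i h1
      -- What remains of a partly read name is itself a name encoding; at its end it is that of the
      -- empty name.
      obtain ⟨rfl, rfl⟩ := List.cons.inj h1
      exact ⟨encodeName [], w, rfl, ⟨[], rfl⟩, ih h⟩
    · rename_i h1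
      obtain ⟨rfl, rfl⟩ := List.cons.inj h1
      exact ⟨encodeName [], w, rfl, ⟨[], rfl⟩, ih h⟩
    · rename_i h1
      obtain ⟨rfl, rfl⟩ := List.cons.inj h1
      split at h
      · rename_i hx
        obtain ⟨u, v, rfl, hu, hv⟩ := genList_append.1 (ih h)
        exact ⟨t :: u, v, rfl, gen_of_expand hx hu, hv⟩
      · simp at h
    · simp at h

section
variable {f : Bool} {P : List Pending} {n : List Bool} {K : List Key} {w : List Token}

theorem pass_key_true {s : Bool} {m : Name} :
    pass f (.key true s :: P) n K (encodeName m ++ w) =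
      pass f P [] (if f then (s, n.reverse ++ m) :: K else K) w := by
  induction m generalizing n with
  | nil => simp [encodeName, pass]
  | cons b m ih =>
    have h : encodeName (b :: m) ++ w = .bit b :: (encodeName m ++ w) := rfl
    rw [h, pass_expand (r := false) (b := [b]) (l := [.key true s]) rfl]
    simp only [List.cons_append, List.nil_append, Bool.or_false, ih]
    simp

theorem pass_key_false {s : Bool} {m : Name} :
    pass f (.key false s :: P) n K (encodeName m ++ w) =
      pass (f && isKnown K (s, n.reverse ++ m)) P [] K w := by
  induction m generalizing n with
  | nil => simp [encodeName, pass]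
  | cons b m ih =>
    have h : encodeName (b :: m) ++ w = .bit b :: (encodeName m ++ w) := rfl
    rw [h, pass_expand (r := false) (b := [b]) (l := [.key false s]) rfl]
    simp only [List.cons_append, List.nil_append, Bool.or_false, ih]
    simp

theorem pass_ind {m : Name} : pass f (.ind :: P) n K (encodeName m ++ w) = pass f P n K w := by
  induction m with
  | nil =>
    have h : encodeName [] ++ w = .endName :: w := rfl
    rw [h, pass_expand (r := false) (b := []) (l := []) rfl]
    simp
  | cons b m ih =>
    have h : encodeName (b :: m) ++ w = .bit b :: (encodeName m ++ w) := rfl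
    rw [h, pass_expand (r := false) (b := []) (l := [.ind]) rfl]
    simpa using ih

theorem pass_role {h : Bool} {R : Role} :
    pass f (.role h :: P) n K (R.encode ++ w) =
      pass f (.key h true :: P) n K (encodeName R.roleName ++ w) := by
  cases R <;> rw [Role.encode, List.cons_append,
    pass_expand (r := false) (b := []) (l := [.key h true]) rfl] <;> simp [Role.roleName]

/-- `Concept.keys` lists the predicates in reading order, so the checks made along the way are the
conjunction over that list. -/
theorem pass_con_false {C : Concept} :
    pass f (.con false :: P) [] K (C.encode ++ w) =
      pass (f && C.keys.all (isKnown K)) P [] K w := by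
  induction C generalizing f P w with
  | top =>
    rw [Concept.encode, List.cons_append, pass_expand (r := false) (b := []) (l := []) rfl]
    simp [Concept.keys]
  | atom A =>
    rw [Concept.encode, List.cons_append,
      pass_expand (r := false) (b := []) (l := [.key false false]) rfl]
    simp [Concept.keys, pass_key_false]
  | nominal a =>
    rw [Concept.encode, List.cons_append, pass_expand (r := false) (b := []) (l := [.ind]) rfl]
    simp [Concept.keys, pass_ind]
  | inter C D ihC ihD =>
    rw [Concept.encode, List.cons_append,
      pass_expand (r := false) (b := []) (l := [.con false, .con false]) rfl]
    simp [Concept.keys, ihC, ihD, Bool.and_assoc]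
  | ex R C ih =>
    rw [Concept.encode, List.cons_append,
      pass_expand (r := false) (b := []) (l := [.role false, .con false]) rfl]
    simp [Concept.keys, ih, pass_role, pass_key_false, Bool.and_assoc]

/-- Predicates are put in front of the list as they are read, which reverses their order; if the
left side failed, they are skipped. -/
theorem pass_con_true {C : Concept} :
    pass f (.con true :: P) [] K (C.encode ++ w) =
      pass f P [] (if f then C.keys.reverse ++ K else K) w := by
  induction C generalizing K P w with
  | top =>
    rw [Concept.encode, List.cons_append, pass_expand (r := false) (b := []) (l := []) rfl]
    simp [Concept.keys]
  | atom A =>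
    rw [Concept.encode, List.cons_append,
      pass_expand (r := false) (b := []) (l := [.key true false]) rfl]
    simp [Concept.keys, pass_key_true]
  | nominal a =>
    rw [Concept.encode, List.cons_append, pass_expand (r := false) (b := []) (l := [.ind]) rfl]
    simp [Concept.keys, pass_ind]
  | inter C D ihC ihD =>
    rw [Concept.encode, List.cons_append,
      pass_expand (r := false) (b := []) (l := [.con true, .con true]) rfl]
    cases f <;> simp [Concept.keys, ihC, ihD]
  | ex R C ih =>
    rw [Concept.encode, List.cons_append,
      pass_expand (r := false) (b := []) (l := [.role true, .con true]) rfl]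
    cases f <;> simp [Concept.keys, ih, pass_role, pass_key_true]

end

end Pending

/-- Fire an inclusion on a list of derived predicates. -/
def Inclusion.fire (K : List Key) (i : Inclusion) : List Key :=
  if i.lhs.keys.all (isKnown K) then i.rhs.keys.reverse ++ K else K

/-- Fire all inclusions and assertions in turn. -/
def KB.round (kb : KB) (K : List Key) : List Key :=
  kb.abox.foldl (fun K s => s.key :: K) (kb.tbox.foldl Inclusion.fire K)

-- The goal comes last, so it is checked against the list to which all assertions have been added;
-- the initial flag is irrelevant because each item resets it.
open Pending in
theorem pass_abox {f : Bool} {i : Bool} {K : List Key} {A : List Assertion} {C : Concept} :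
    pass f [.items i] [] K (A.flatMap Assertion.encode ++ .goal :: C.encode) =
      some (C.keys.all (isKnown (A.foldl (fun K s => s.key :: K) K)),
        A.foldl (fun K s => s.key :: K) K) := by
  induction A generalizing f i K with
  | nil =>
    rw [List.flatMap_nil, List.nil_append,
      pass_expand (r := true) (b := []) (l := [.con false]) (by cases i <;> rfl)]
    have := pass_con_false (f := f || true) (P := []) (K := K) (w := []) (C := C)
    simp only [List.append_nil] at this ⊢
    rw [this]
    simp [Pending.pass]
  | cons s A ih =>
    cases s with
    | concept B a =>
      rw [List.flatMap_cons, Assertion.encode, List.cons_append, List.cons_append,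
        pass_expand (r := true) (b := []) (l := [.key true false, .ind, .items false])
          (by cases i <;> rfl)]
      simp [pass_key_true, pass_ind, ih, Assertion.key]
    | role R a b =>
      rw [List.flatMap_cons, Assertion.encode, List.cons_append, List.cons_append,
        pass_expand (r := true) (b := []) (l := [.role true, .ind, .ind, .items false])
          (by cases i <;> rfl)]
      simp [pass_key_true, pass_ind, pass_role, ih, Assertion.key]

open Pending in
theorem pass_encodeInstance {f : Bool} {K : List Key} {kb : KB} {C : Concept} :
    pass f [.items true] [] K (encodeInstance kb C) =
      some (C.keys.all (isKnown (kb.round K)), kb.round K) := by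
  obtain ⟨T, A⟩ := kb
  simp only [encodeInstance, KB.round]
  induction T generalizing f K with
  | nil => simp [pass_abox]
  | cons i T ih =>
    rw [List.flatMap_cons, Inclusion.encode, List.cons_append, List.cons_append,
      pass_expand (r := true) (b := []) (l := [.con false, .con true, .items true]) rfl]
    simp only [Bool.or_true, List.cons_append, List.nil_append, List.append_assoc, pass_con_false,
      Bool.true_and, pass_con_true, ih, List.foldl_cons, Inclusion.fire]

/-! ### Iterated passes -/

theorem Inclusion.subset_fire (i : Inclusion) (K : List Key) : K ⊆ Inclusion.fire K i := by
  unfold Inclusion.fire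
  split_ifs
  · exact List.subset_append_right _ _
  · exact List.Subset.refl _

theorem subset_foldl_fire (T : List Inclusion) (K : List Key) : K ⊆ T.foldl Inclusion.fire K := by
  induction T generalizing K with
  | nil => exact List.Subset.refl _
  | cons i T ih => exact List.Subset.trans (i.subset_fire K) (ih _)

theorem mem_foldl_key {A : List Assertion} {K : List Key} {k : Key} :
    k ∈ A.foldl (fun K s => s.key :: K) K ↔ k ∈ K ∨ ∃ s ∈ A, s.key = k := by
  induction A generalizing K with
  | nil => simp
  | cons s A ih =>
    simp only [List.foldl_cons, ih, List.mem_cons, exists_eq_or_imp]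
    tauto

theorem rhs_subset_foldl_fire {T : List Inclusion} {K : List Key} {i : Inclusion} (hi : i ∈ T)
    (h : i.lhs.keys ⊆ K) : i.rhs.keys ⊆ T.foldl Inclusion.fire K := by
  induction T generalizing K with
  | nil => simp at hi
  | cons j T ih =>
    rcases List.mem_cons.1 hi with rfl | hi
    · refine List.Subset.trans ?_ (subset_foldl_fire T _)
      simp only [Inclusion.fire, all_isKnown.2 h, if_true]
      intro k hk
      simp [hk]
    · exact ih hi (List.Subset.trans h (j.subset_fire K))

namespace KB

/-- Firing in sequence on a growing list derives at least what simultaneous firing derives. -/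
theorem fire_subset_round {kb : KB} {I : Interp Unit} {K : List Key} (h : ∀ k ∈ I.keys, k ∈ K) :
    ∀ k ∈ (kb.fire I).keys, k ∈ kb.round K := by
  intro k hk
  refine mem_foldl_key.2 (.inl ?_)
  rcases mem_keys_fire.1 hk with hk | ⟨i, hi, hl, hr⟩
  · exact subset_foldl_fire _ _ (h k hk)
  · exact rhs_subset_foldl_fire hi (fun l hl' => h l (hl l hl')) hr

/-- The extra round is due to the order of the encoding: the TBox precedes the ABox, so the
assertions are available only at the end of the first round. -/
theorem iterate_fire_subset_round (kb : KB) (r : ℕ) (K : List Key) :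
    ∀ k ∈ (kb.fire^[r] kb.start).keys, k ∈ kb.round^[r + 1] K := by
  induction r with
  | zero =>
    intro k hk
    exact mem_foldl_key.2 (.inr (mem_keys_start.1 hk))
  | succ r ih =>
    rw [Function.iterate_succ_apply', Function.iterate_succ_apply' _ (r + 1)]
    exact fire_subset_round ih

/-- Sequential firing may be faster than the fixpoint iteration, but it cannot leave a closed set.
Applied to the least one, this is the soundness of the passes. -/
theorem Closed.round_subset {kb : KB} {S : Set Key} (hS : kb.Closed S) {K : List Key}
    (h : ∀ k ∈ K, k ∈ S) : ∀ k ∈ kb.round K, k ∈ S := by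
  have key : ∀ T : List Inclusion, T ⊆ kb.tbox → ∀ K : List Key, (∀ k ∈ K, k ∈ S) →
      ∀ k ∈ T.foldl Inclusion.fire K, k ∈ S := by
    intro T
    induction T with
    | nil => exact fun _ K h => h
    | cons i T ih =>
      intro hT K h
      refine ih (fun j hj => hT (List.mem_cons_of_mem _ hj)) _ ?_
      unfold Inclusion.fire
      split_ifs with hi
      · intro k hk
        rcases List.mem_append.1 hk with hk | hk
        · exact hS.2 i (hT List.mem_cons_self) (fun l hl => h l (all_isKnown.1 hi hl)) k
            (List.mem_reverse.1 hk)
        · exact h k hk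
      · exact h
  intro k hk
  rcases mem_foldl_key.1 hk with hk | ⟨s, hs, rfl⟩
  · exact key _ (List.Subset.refl _) K h k hk
  · exact hS.1 s hs

theorem Closed.iterate_round_subset {kb : KB} {S : Set Key} (hS : kb.Closed S) (r : ℕ) :
    ∀ k ∈ kb.round^[r] [], k ∈ S := by
  induction r with
  | zero => simp
  | succ r ih =>
    rw [Function.iterate_succ_apply']
    exact hS.round_subset ih

end KB

/-- The result of the last of `r + 1` passes. -/
def passes (w : List Token) : ℕ → List Key → Option Bool
  | 0, K => (Pending.pass true [.items true] [] K w).map (·.1)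
  | r + 1, K => (Pending.pass true [.items true] [] K w).bind fun p => passes w r p.2

theorem passes_encodeInstance {kb : KB} {C : Concept} {r : ℕ} {K : List Key} :
    passes (encodeInstance kb C) r K =
      some (C.keys.all (isKnown (kb.round^[r + 1] K))) := by
  induction r generalizing K with
  | zero => simp [passes, pass_encodeInstance]
  | succ r ih =>
    rw [passes, pass_encodeInstance]
    exact ih

/-- Already the first pass fails, by `Pending.genList_of_pass`. -/
theorem passes_eq_none {w : List Token} (h : ¬ ∃ kb C, w = encodeInstance kb C) (r : ℕ)
    (K : List Key) : passes w r K = none := by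
  have h' : Pending.pass true [.items true] [] K w = none := by
    by_contra hne
    obtain ⟨p, hp⟩ := Option.ne_none_iff_exists'.1 hne
    obtain ⟨u, v, rfl, ⟨kb, C, rfl⟩, rfl⟩ := Pending.genList_of_pass hp
    exact h ⟨kb, C, by simp⟩
  cases r <;> simp [passes, h']

theorem tbox_length_le_encodeInstance (kb : KB) (C : Concept) :
    kb.tbox.length ≤ (encodeInstance kb C).length := by
  have : ∀ T : List Inclusion, T.length ≤ (T.flatMap Inclusion.encode).length := by
    intro T
    induction T with
    | nil => simp
    | cons i T ih =>
      simp only [List.length_cons, List.flatMap_cons, List.length_append, Inclusion.encode]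
      omega
  have := this kb.tbox
  simp only [encodeInstance, List.length_append]
  omega

theorem KB.iterate_start_of_le (kb : KB) {r : ℕ} (h : kb.tbox.length ≤ r) :
    kb.fire^[r] kb.start = kb.representative := by
  obtain ⟨k, rfl⟩ := Nat.exists_eq_add_of_le h
  rw [add_comm, Function.iterate_add_apply]
  exact Function.iterate_fixed kb.fire_representative k

/-- The derived list is squeezed between an iterate of `KB.fire` that is already stable, as the
input is at least as long as the TBox, and the least closed set. Unique readability lets the
instance be recovered from the word. -/
theorem mem_minModSatELIO_iff {w : List Token} :
    w ∈ minModSatELIO.{u} ↔ passes w w.length [] = some true := by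
  by_cases h : ∃ kb C, w = encodeInstance kb C
  · obtain ⟨kb, C, rfl⟩ := h
    have h1 : encodeInstance kb C ∈ minModSatELIO.{u} ↔ SatInMinimalModel.{u} kb C := by
      constructor
      · rintro ⟨kb', C', h, hs⟩
        obtain ⟨rfl, rfl⟩ := encodeInstance_injective h
        exact hs
      · exact fun h => ⟨kb, C, rfl, h⟩
    rw [h1, satInMinimalModel_iff_keys, passes_encodeInstance]
    rw [Option.some.injEq, all_isKnown]
    refine forall₂_congr fun k _ => ⟨fun hk => ?_, kb.closed_representative.iterate_round_subset _
        k⟩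
    rw [← kb.iterate_start_of_le (tbox_length_le_encodeInstance kb C)] at hk
    exact kb.iterate_fire_subset_round _ _ k hk
  · rw [passes_eq_none h]
    simp only [reduceCtorEq, iff_false]
    rintro ⟨kb, C, rfl, -⟩
    exact h ⟨kb, C, rfl⟩

end MinMod

namespace MinMod

/-! ## The decision procedure as a program -/

namespace Decider

inductive Symbol : Type
  | pending (x : Pending)
  | bit (b : Bool)
  | sort (b : Bool)
  | sep
  | tick
  deriving DecidableEq, Fintype

inductive Stack : Type
  | pend | key | aux | known | knownAux | rounds
  deriving DecidableEq

instance : Finite Stack :=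
  Finite.of_injective (fun s : Stack => match s with
    | .pend => 0
    | .key => 1
    | .aux => 2
    | .known => 3
    | .knownAux => 4
    | .rounds => (5 : Fin 6)) fun s t h => by cases s <;> cases t <;> simp_all

abbrev DProg (E : Type) := Prog Token Bool Stack Symbol E

abbrev DMem := Mem Stack Symbol Bool

/-- The memory with the given input position and stacks, before any output. -/
def mem (pos : ℕ) (p n x k y r : List Symbol) : DMem where
  pos := pos
  stk := fun
    | .pend => p
    | .key => n
    | .aux => x
    | .known => k
    | .knownAux => y
    | .rounds => r
  out := []

open Prog

/-- Compare the key on `aux` with the topmost entry on `known`, which is moved to `knownAux`; the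
part of the key that was looked at is moved to `key`. The result is `none` if `known` is empty. -/
def compareEntry : DProg (Option Bool) :=
  loop (fun ok : Bool => act fun _ t => match t .known with
    | none => (nop, .inr none)
    | some .sep =>
      (onStk fun | .known => .pop | .knownAux => .push .sep | _ => .keep,
        -- The entry is finished; it equals the key only if the key is finished too.
        .inr (some (ok && (t .aux).isNone)))
    | some x => match t .aux with
      -- The key is shorter than the entry: they differ, but the rest of the entry still has to be
      -- moved out of the way.
      | none => (onStk fun | .known => .pop | .knownAux => .push x | _ => .keep, .inl false)
      | some y =>
        (onStk fun
          | .known => .pop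
          | .knownAux => .push x
          | .aux => .pop
          | .key => .push y
          | _ => .keep, .inl (ok && decide (x = y)))) true

/-- Is the key on `aux` one of the entries on `known`? -/
def member : DProg Bool :=
  (loop (fun found : Bool => compareEntry.bind fun
    | none => ret (.inr found)
    -- The part of the key used up by the comparison is put back for the next entry.
    | some ok => (pour .key .aux).bind fun _ => ret (.inl (found || ok))) false).bind fun b =>
  (pour .knownAux .known).bind fun _ => ret b

/-- Process a predicate whose name, reversed, is on the stack `key`. -/
def processKey (f h s : Bool) : DProg (Bool ⊕ Option Bool) :=
  if h then
    if f then
      -- Pouring reverses: the name, stored backwards, comes out in reading order with the sort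
      -- after it, on top of the separator pushed beforehand.
      (pushes .key [.sort s]).bind fun _ => (pushes .known [.sep]).bind fun _ =>
      (pour .key .known).bind fun _ => ret (.inl f)
    else (clear .key).bind fun _ => ret (.inl f)
  else
    (pushes .key [.sort s]).bind fun _ => (pour .key .aux).bind fun _ =>
    member.bind fun b => (clear .aux).bind fun _ => ret (.inl (f && b))

/-- What to do with the input token, the pending item and the top of the stack `key`. -/
def dispatch (f : Bool) :
    InSymbol Token × Option Symbol × Option Symbol → DProg (Bool ⊕ Option Bool)
  | (.rightEnd, none, none) => ret (.inr (some f))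
  | (.letter .endName, some (.pending (.key h s)), _) => processKey f h s
  | (.letter t, some (.pending x), _) => match x.expand t with
    | some (r, b, l) => (pushes .key (b.map .bit)).bind fun _ =>
      (pushes .pend (l.map .pending)).bind fun _ => ret (.inl (f || r))
    | none => ret (.inr none)
  | _ => ret (.inr none)

/-- Take the next input token and the next pending item. -/
def fetch : DProg (InSymbol Token × Option Symbol × Option Symbol) :=
  act fun s t => (⟨.right, fun | .pend => .pop | _ => .keep, []⟩, (s, t .pend, t .key))

/-- One pass over the input; the result is `none` if the input is found not to be an instance. -/
def pass (f : Bool) : DProg (Option Bool) := loop (fun f : Bool => fetch.bind (dispatch f)) f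

/-- Put a tick on `rounds` for every letter of the input. -/
def count : DProg Unit :=
  loop (S := Unit) (fun _ => act fun s _ => match s with
    | .leftEnd => (onInput .right, .inl ())
    | .letter _ => (⟨.right, fun | .rounds => .push .tick | _ => .keep, []⟩, .inl ())
    | .rightEnd => (nop, .inr ())) ()

/-- After a pass, stop if it failed or if there is no tick left on `rounds`. -/
def finishRound : Option Bool → DProg (Unit ⊕ Bool)
  | none => ret (.inr false)
  | some b => act fun _ t => match t .rounds with
    | none => (nop, .inr b)
    | some _ => (onStk fun | .rounds => .pop | _ => .keep, .inl ())

def round : DProg (Unit ⊕ Bool) :=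
  (pushes .pend [.pending (.items true)]).bind fun _ => rewind.bind fun _ =>
    (pass true).bind finishRound

/-- Run one more pass than there are ticks on `rounds`. -/
def rounds : DProg Bool := loop (S := Unit) (fun _ => round) ()

def main : DProg Unit := count.bind fun _ => rounds.bind fun b => emit [b]

/-- Runs without a bound on the space. -/
abbrev TRuns {E : Type} (P : DProg E) (w : List Token) (m : DMem) (e : E) (m' : DMem) (t : ℕ) :
    Prop := P.Runs w (fun _ => True) m e m' t

variable {w : List Token} {pos : ℕ}

theorem fits (m : DMem) : m.Fits fun _ => True := fun _ => trivial

/-! ### Membership in the list of derived predicates -/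

def word (k : Key) : List Symbol := k.2.map .bit ++ [.sort k.1]

theorem sep_not_mem_word (k : Key) : Symbol.sep ∉ word k := by simp [word]

theorem word_injective : Function.Injective word := by
  rintro ⟨s, n⟩ ⟨s', n'⟩ h
  have hinj : Function.Injective Symbol.bit := fun a b h => by simpa using h
  simp only [word] at h
  obtain ⟨h1, h2⟩ := List.append_inj' h rfl
  obtain rfl := List.map_injective_iff.2 hinj h1
  simp_all

/-- How a list of predicates is stored. -/
def store (K : List Key) : List Symbol := K.flatMap fun k => word k ++ [.sep]

theorem length_store_cons (k : Key) (K : List Key) :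
    (store (k :: K)).length = (store K).length + k.2.length + 2 := by
  simp only [store, word, List.flatMap_cons, List.length_append, List.length_map,
    List.length_singleton]
  omega

/-- Stated for a comparison in progress, with `ok` the verdict so far. The entry `u` is consumed
entirely whatever `v` is, hence a time that depends on `u` alone, and `take` and `drop`, which also
cover a shorter `v`. -/
theorem runs_compareEntry {p n v u k y r : List Symbol} {ok : Bool} (hpos : pos ≤ w.length + 1)
    (hu : Symbol.sep ∉ u) :
    TRuns (loop (fun ok : Bool => act fun _ t => match t .known with
    | none => (nop, .inr none)
    | some .sep =>
      (onStk fun | .known => .pop | .knownAux => .push .sep | _ => .keep,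
        .inr (some (ok && (t .aux).isNone)))
    | some x => match t .aux with
      | none => (onStk fun | .known => .pop | .knownAux => .push x | _ => .keep, .inl false)
      | some y =>
        (onStk fun
          | .known => .pop
          | .knownAux => .push x
          | .aux => .pop
          | .key => .push y
          | _ => .keep, .inl (ok && decide (x = y)))) ok : DProg (Option Bool)) w
      (mem pos p n v (u ++ .sep :: k) y r)
      (some (ok && decide (u = v)))
      (mem pos p ((v.take u.length).reverse ++ n) (v.drop u.length) k (.sep :: u.reverse ++ y) r)
      (u.length + 1) := by
  induction u generalizing n v y ok with
  | nil =>
    refine Runs.loop_exit (runs_act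
      (o := onStk fun | .known => .pop | .knownAux => .push .sep | _ => .keep) ?_ ?_ (fits _))
    · cases v <;> simp [mem]
    · refine Mem.ext ?_ (funext fun i => ?_) rfl
      · simp [onStk, Op.apply, Move.apply, mem, hpos]
      · cases i <;> simp [onStk, Op.apply, StkOp.apply, mem]
  | cons x u ih =>
    have hx : x ≠ .sep := fun h => hu (by simp [h])
    have hu' : Symbol.sep ∉ u := fun h => hu (by simp [h])
    rw [List.length_cons, add_comm (u.length + 1)]
    cases v with
    | nil =>
      have := ih (n := n) (v := []) (y := x :: y) (ok := false) hu'
      simp only [Bool.false_and] at this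
      refine Runs.loop_next (m₁ := mem pos p n [] (u ++ .sep :: k) (x :: y) r) (runs_act
        (o := onStk fun | .known => .pop | .knownAux => .push x | _ => .keep)
        (e := Sum.inl false) ?_ ?_ (fits _)) ?_
      · cases x <;> simp_all [mem]
      · refine Mem.ext ?_ (funext fun i => ?_) rfl
        · simp [onStk, Op.apply, Move.apply, mem, hpos]
        · cases i <;> simp [onStk, Op.apply, StkOp.apply, mem]
      · simpa using this
    | cons z v =>
      have := ih (n := z :: n) (v := v) (y := x :: y) (ok := ok && decide (x = z)) hu'
      refine Runs.loop_next (m₁ := mem pos p (z :: n) v (u ++ .sep :: k) (x :: y) r) (runs_act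
        (o := onStk fun
          | .known => .pop
          | .knownAux => .push x
          | .aux => .pop
          | .key => .push z
          | _ => .keep)
        (e := Sum.inl (ok && decide (x = z))) ?_ ?_ (fits _)) ?_
      · cases x <;> simp_all [mem]
      · refine Mem.ext ?_ (funext fun i => ?_) rfl
        · simp [onStk, Op.apply, Move.apply, mem, hpos]
        · cases i <;> simp [onStk, Op.apply, StkOp.apply, mem]
      · simpa [Bool.and_assoc, Bool.decide_and] using this

/-- An entry with a word of length `a` costs `2 * a + 3` steps (comparing, restoring the key,
returning), which is less than four per stored symbol, separator included. The list itself ends up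
reversed on the other stack. -/
theorem runs_member_loop {p y r : List Symbol} {k : Key} {K : List Key} {found : Bool}
    (hpos : pos ≤ w.length + 1) :
    TRuns (loop (fun found : Bool => compareEntry.bind fun
    | none => ret (.inr found)
    | some ok => (pour .key .aux).bind fun _ => ret (.inl (found || ok))) found : DProg Bool) w
      (mem pos p [] (word k) (store K) y r) (found || isKnown K k)
      (mem pos p [] (word k) [] ((store K).reverse ++ y) r) (4 * (store K).length + 2) := by
  induction K generalizing found y with
  | nil =>
    refine Runs.loop_exit ?_
    refine (Runs.bind (t₁ := 1) (t₂ := 1) (e := none)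
      (m₁ := mem pos p [] (word k) [] y r) ?_ ?_).mono (by simp [store])
    · exact Runs.loop_exit (runs_act (o := nop) (by simp [mem, store]) (nop_apply hpos) (fits _))
    · convert runs_ret (e := Sum.inr found) (m := mem pos p [] (word k) [] y r) hpos (fits _)
        using 1
      · simp [isKnown]
      · simp [store]
  | cons l K ih =>
    have h1 := runs_compareEntry (w := w) (pos := pos) (p := p) (n := []) (v := word k)
      (k := store K) (y := y) (r := r) (ok := true) hpos (sep_not_mem_word l)
    rw [Bool.true_and, List.append_nil] at h1
    have hl : store (l :: K) = word l ++ .sep :: store K := by simp [store]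
    have hk : isKnown (l :: K) k = (decide (word l = word k) || isKnown K k) := by
      simp only [isKnown, List.mem_cons, Bool.decide_or, word_injective.eq_iff]
      congr 2
      exact propext eq_comm
    have h2 : TRuns (pour .key .aux) w
        (mem pos p ((word k).take (word l).length).reverse ((word k).drop (word l).length) (store K)
          (.sep :: (word l).reverse ++ y) r) ()
        (mem pos p [] (word k) (store K) (.sep :: (word l).reverse ++ y) r)
        ((word l).length + 1) := by
      refine Runs.mono (runs_pour (by decide) hpos (fits _) (fun _ _ => trivial) rfl rfl rfl ?_ ?_)
        ?_
      · simp [mem]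
      · intro i
        cases i <;> simp [mem]
      · simp [mem]
    have h3 := ih (y := .sep :: (word l).reverse ++ y) (found := found || decide (word l = word k))
    have h4 : (store (l :: K)).reverse ++ y =
        (store K).reverse ++ (.sep :: (word l).reverse ++ y) := by simp [hl]
    rw [hk, ← Bool.or_assoc, h4]
    refine Runs.mono (Runs.loop_next
      (hl ▸ Runs.bind h1 (Runs.bind
        (k := fun _ => ret (Sum.inl (found || decide (word l = word k)))) h2
        (runs_ret hpos (fits _)))) h3) ?_
    have : 1 ≤ (word l).length := by simp [word]
    rw [hl]
    simp only [List.length_append, List.length_cons]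
    omega

theorem runs_member {p r : List Symbol} {k : Key} {K : List Key} (hpos : pos ≤ w.length + 1) :
    TRuns member w (mem pos p [] (word k) (store K) [] r) (isKnown K k)
      (mem pos p [] (word k) (store K) [] r) (5 * (store K).length + 4) := by
  have h1 := runs_member_loop (w := w) (p := p) (y := []) (r := r) (k := k) (K := K)
    (found := false) hpos
  rw [Bool.false_or, List.append_nil] at h1
  have h2 : TRuns (pour .knownAux .known) w (mem pos p [] (word k) [] (store K).reverse r) ()
      (mem pos p [] (word k) (store K) [] r) ((store K).length + 1) := by
    refine Runs.mono (runs_pour (by decide) hpos (fits _) (fun _ _ => trivial) rfl rfl rfl ?_ ?_) ?_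
    · simp [mem]
    · intro i
      cases i <;> simp [mem]
    · simp [mem]
  refine Runs.mono (Runs.bind h1 (Runs.bind h2 (runs_ret hpos (fits _)))) ?_
  omega

theorem runs_push_sort {p k r : List Symbol} {n : List Bool} {s : Bool}
    (hpos : pos ≤ w.length + 1) :
    TRuns (pushes .key [.sort s]) w (mem pos p (n.map .bit) [] k [] r) ()
      (mem pos p (.sort s :: n.map .bit) [] k [] r) 2 := by
  refine runs_pushes hpos (fits _) (fun _ _ => trivial) rfl rfl rfl ?_
  intro i
  cases i <;> simp [mem]

theorem runs_processKey_false {f s : Bool} {p r : List Symbol} {n : List Bool} {K : List Key}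
    (hpos : pos ≤ w.length + 1) :
    TRuns (processKey f false s) w (mem pos p (n.map .bit) [] (store K) [] r)
      (.inl (f && isKnown K (s, n.reverse))) (mem pos p [] [] (store K) [] r)
      (5 * (store K).length + 2 * n.length + 11) := by
  have h1 := runs_push_sort (w := w) (p := p) (r := r) (n := n) (k := store K) (s := s) hpos
  have h2 : TRuns (pour .key .aux) w (mem pos p (.sort s :: n.map .bit) [] (store K) [] r) ()
      (mem pos p [] (word (s, n.reverse)) (store K) [] r) (n.length + 2) := by
    refine Runs.mono (runs_pour (by decide) hpos (fits _) (fun _ _ => trivial) rfl rfl rfl ?_ ?_) ?_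
    · simp [mem, word]
    · intro i
      cases i <;> simp [mem]
    · simp [mem]
  have h3 := runs_member (w := w) (p := p) (r := r) (k := (s, n.reverse)) (K := K) hpos
  have h4 : TRuns (clear .aux) w (mem pos p [] (word (s, n.reverse)) (store K) [] r) ()
      (mem pos p [] [] (store K) [] r) (n.length + 2) := by
    refine Runs.mono (runs_clear hpos (fits _) (fun _ _ => trivial) rfl rfl rfl ?_) ?_
    · intro i
      cases i <;> simp [mem]
    · simp [mem, word]
  refine Runs.mono (Runs.bind h1 (Runs.bind h2 (Runs.bind h3 (Runs.bind h4
    (runs_ret hpos (fits _)))))) ?_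
  omega

theorem runs_processKey_true {f s : Bool} {p r : List Symbol} {n : List Bool} {K : List Key}
    (hpos : pos ≤ w.length + 1) :
    TRuns (processKey f true s) w (mem pos p (n.map .bit) [] (store K) [] r)
      (.inl f) (mem pos p [] [] (store (if f then (s, n.reverse) :: K else K)) [] r)
      (n.length + 7) := by
  cases f with
  | false =>
    have h1 : TRuns (clear .key) w (mem pos p (n.map .bit) [] (store K) [] r) ()
        (mem pos p [] [] (store K) [] r) (n.length + 1) := by
      refine Runs.mono (runs_clear hpos (fits _) (fun _ _ => trivial) rfl rfl rfl ?_) ?_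
      · intro i
        cases i <;> simp [mem]
      · simp [mem]
    exact Runs.mono (Runs.bind h1 (runs_ret hpos (fits _))) (by omega)
  | true =>
    have h1 := runs_push_sort (w := w) (p := p) (r := r) (n := n) (k := store K) (s := s) hpos
    have h2 : TRuns (pushes .known [.sep]) w (mem pos p (.sort s :: n.map .bit) [] (store K) [] r)
        () (mem pos p (.sort s :: n.map .bit) [] (.sep :: store K) [] r) 2 := by
      refine runs_pushes hpos (fits _) (fun _ _ => trivial) rfl rfl rfl ?_
      intro i
      cases i <;> simp [mem]
    have h3 : TRuns (pour .key .known) w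
        (mem pos p (.sort s :: n.map .bit) [] (.sep :: store K) [] r)
        () (mem pos p [] [] (store ((s, n.reverse) :: K)) [] r) (n.length + 2) := by
      refine Runs.mono (runs_pour (by decide) hpos (fits _) (fun _ _ => trivial) rfl rfl rfl ?_ ?_)
          ?_
      · simp [mem, store, word]
      · intro i
        cases i <;> simp [mem]
      · simp [mem]
    refine Runs.mono (Runs.bind h1 (Runs.bind h2 (Runs.bind h3
      (runs_ret hpos (fits _))))) ?_
    omega

/-! ### One pass -/

/-- A bound on the space a pass needs, in terms of the current predicate, the list of predicates
and the number of letters that remain to be read. -/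
def potential (n : List Bool) (K : List Key) (l : ℕ) : ℕ := (store K).length + n.length + 2 * l

theorem runs_fetch {p n x k y r : List Symbol} :
    TRuns fetch w (mem pos p n x k y r) (readInput w pos, p.head?, n.head?)
      (mem (min (pos + 1) (w.length + 1)) p.tail n x k y r) 1 := by
  refine runs_act rfl (Mem.ext rfl (funext fun i => ?_) rfl) (fits _)
  cases i <;> rfl

theorem dispatch_of_ne {f : Bool} {t : Token} {x : Pending} {z : Option Symbol}
    (h : ∀ h s, x = .key h s → t ≠ .endName) :
    dispatch f (.letter t, some (.pending x), z) = match x.expand t with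
      | some (r, b, l) => (pushes .key (b.map .bit)).bind fun _ =>
        (pushes .pend (l.map .pending)).bind fun _ => ret (.inl (f || r))
      | none => ret (.inr none) := by
  cases x <;> cases t <;> simp_all [dispatch]

theorem pass_eq_none {f : Bool} {x : Pending} {P : List Pending} {n : List Bool} {K : List Key}
    {t : Token} {v : List Token} (hx : ∀ h s, x = .key h s → t ≠ .endName)
    (h : x.expand t = none) : Pending.pass f (x :: P) n K (t :: v) = none := by
  rw [Pending.pass]
  · rw [h]
  · rintro s rfl
    exact hx _ _ rfl
  · rintro s rfl
    exact hx _ _ rfl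

theorem expand_length {x : Pending} {t : Token} {r : Bool} {b : List Bool} {l : List Pending}
    (h : x.expand t = some (r, b, l)) : b.length ≤ 1 ∧ l.length ≤ 4 := by
  unfold Pending.expand at h
  split at h <;> simp only [Option.some.injEq, Prod.mk.injEq, reduceCtorEq] at h <;>
    obtain ⟨-, rfl, rfl⟩ := h <;> simp

theorem runs_pass_stop {f : Bool} {p n k r : List Symbol} {s : InSymbol Token} {o : Option Bool}
    (hs : readInput w pos = s) (ho : dispatch f (s, p.head?, n.head?) = ret (.inr o)) :
    TRuns (pass f) w (mem pos p n [] k [] r) o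
      (mem (min (pos + 1) (w.length + 1)) p.tail n [] k [] r) 2 := by
  subst hs
  exact Runs.loop_exit (Runs.bind runs_fetch (ho ▸ runs_ret (min_le_right _ _) (fits _)))

theorem runs_pass_step {f f' : Bool} {p p' n n' k k' r : List Symbol} {s : InSymbol Token}
    {m' : DMem} {o : Option Bool} {t₁ t₂ : ℕ} (hs : readInput w pos = s) (hpos : pos ≤ w.length)
    (h : TRuns (dispatch f (s, p.head?, n.head?)) w (mem (pos + 1) p.tail n [] k [] r) (.inl f')
      (mem (pos + 1) p' n' [] k' [] r) t₁)
    (h' : TRuns (pass f') w (mem (pos + 1) p' n' [] k' [] r) o m' t₂) :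
    TRuns (pass f) w (mem pos p n [] k [] r) o m' (1 + t₁ + t₂) := by
  subst hs
  refine Runs.loop_next (Runs.bind runs_fetch ?_) h'
  rwa [min_eq_left (by omega)]

/-- The program follows `Pending.pass` letter by letter, and `potential` never increases, so `B`
bounds the stored predicates and the current name throughout. After a failed parse the stacks do not
matter, only that nothing was printed and the head is in range. -/
theorem runs_pass {u v : List Token} {f : Bool} {P : List Pending} {n : List Bool}
    {K : List Key} {r : List Symbol} {B : ℕ} (hw : w = u ++ v)
    (hB : potential n K v.length ≤ B) :
    ∃ m' : DMem, TRuns (pass f) w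
        (mem (u.length + 1) (P.map .pending) (n.map .bit) [] (store K) [] r)
        ((Pending.pass f P n K v).map (·.1)) m' ((5 * B + 12) * (v.length + 1)) ∧
      (m'.out = [] ∧ m'.pos ≤ w.length + 1) ∧
      ∀ q ∈ Pending.pass f P n K v, m' = mem (w.length + 1) [] [] [] (store q.2) [] r ∧
        (store q.2).length ≤ B := by
  induction v generalizing u f P n K with
  | nil =>
    have hread : readInput w (u.length + 1) = .rightEnd := hw ▸ readInput_append u []
    have ht : 2 ≤ (5 * B + 12) * (([] : List Token).length + 1) := by simp
    match P, n with
    | [], [] =>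
      refine ⟨_, Runs.mono (runs_pass_stop (o := some f) hread rfl) ht, ⟨rfl, min_le_right _ _⟩, ?_⟩
      simp only [Pending.pass, Option.mem_def, Option.some.injEq]
      rintro q rfl
      refine ⟨?_, ?_⟩
      · simp [hw]
      · simp only [potential] at hB ⊢
        omega
    | [], b :: n =>
      have h : Pending.pass f [] (b :: n) K [] = none := by simp [Pending.pass]
      rw [h]
      exact ⟨_, Runs.mono (runs_pass_stop (o := none) hread rfl) ht, ⟨rfl, min_le_right _ _⟩, by
          simp⟩
    | x :: P, n =>
      have h : Pending.pass f (x :: P) n K [] = none := by cases x <;> simp [Pending.pass]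
      rw [h]
      exact ⟨_, Runs.mono (runs_pass_stop (o := none) hread rfl) ht, ⟨rfl, min_le_right _ _⟩, by
          simp⟩
  | cons t v ih =>
    have hw' : w = (u ++ [t]) ++ v := by simp [hw]
    have hpos : u.length + 1 ≤ w.length := by simp [hw]
    have hlen : u.length + 1 + 1 = (u ++ [t]).length + 1 := by simp
    have hread : readInput w (u.length + 1) = .letter t := hw ▸ readInput_append u (t :: v)
    have ht : 2 ≤ (5 * B + 12) * ((t :: v).length + 1) := by
      rw [List.length_cons]
      nlinarith
    have hv : (t :: v).length = v.length + 1 := rfl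
    rw [potential, hv] at hB
    cases P with
    | nil =>
      have h : Pending.pass f [] n K (t :: v) = none := by simp [Pending.pass]
      rw [h]
      exact ⟨_, Runs.mono (runs_pass_stop (o := none) hread (by cases t <;> rfl)) ht,
        ⟨rfl, min_le_right _ _⟩, by simp⟩
    | cons x P =>
      by_cases hx : ∃ h s, x = .key h s ∧ t = .endName
      · obtain ⟨h, s, rfl, rfl⟩ := hx
        cases h with
        | true =>
          have h1 := runs_processKey_true (w := w) (pos := u.length + 1 + 1) (f := f) (s := s)
            (p := P.map .pending) (r := r) (n := n) (K := K) (by omega)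
          -- Storing a name moves its letters from one stack to the other and adds a sort and a
          -- separator; these two symbols are paid for by the weight `2` of the letter just read.
          obtain ⟨m', h2, h3⟩ := ih (f := f) (P := P) (n := [])
            (K := if f then (s, n.reverse) :: K else K) hw' (by
              simp only [potential]
              split_ifs
              · simp only [length_store_cons, List.length_reverse, List.length_nil]
                omega
              · simp only [List.length_nil]
                omega)
          refine ⟨m', Runs.mono (runs_pass_step hread hpos h1 (hlen ▸ h2)) ?_, h3⟩
          rw [hv]
          nlinarith
        | false =>
          -- The membership test is the most expensive case; with the fetch it accounts for the `5 *
          -- B + 12` per letter.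
          have h1 := runs_processKey_false (w := w) (pos := u.length + 1 + 1) (f := f) (s := s)
            (p := P.map .pending) (r := r) (n := n) (K := K) (by omega)
          obtain ⟨m', h2, h3⟩ := ih (f := f && isKnown K (s, n.reverse)) (P := P) (n := [])
            (K := K) hw' (by simp only [potential, List.length_nil]; omega)
          refine ⟨m', Runs.mono (runs_pass_step hread hpos h1 (hlen ▸ h2)) ?_, h3⟩
          rw [hv]
          nlinarith
      · have hx' : ∀ h s, x = .key h s → t ≠ .endName := fun h s h1 h2 => hx ⟨h, s, h1, h2⟩
        have hd := dispatch_of_ne (f := f) (z := (n.map Symbol.bit).head?) hx'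
        cases he : x.expand t with
        | none =>
          rw [he] at hd
          rw [pass_eq_none hx' he]
          exact ⟨_, Runs.mono (runs_pass_stop (o := none) hread hd) ht,
            ⟨rfl, min_le_right _ _⟩, by simp⟩
        | some e =>
          obtain ⟨a, b, l⟩ := e
          rw [he] at hd
          rw [Pending.pass_expand he]
          obtain ⟨hb, hl⟩ := expand_length he
          obtain ⟨m', h2, h3⟩ := ih (f := f || a) (P := l ++ P) (n := b ++ n) (K := K) hw' (by
            simp only [potential, List.length_append]
            omega)
          -- At most one bit and four pending items are pushed, which takes at most `2 + 5` steps,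
          -- followed by one to return.
          have h1 : TRuns (dispatch f (.letter t, some (.pending x), (n.map Symbol.bit).head?)) w
              (mem (u.length + 1 + 1) (P.map .pending) (n.map .bit) [] (store K) [] r)
              (.inl (f || a)) (mem (u.length + 1 + 1) ((l ++ P).map .pending) ((b ++ n).map .bit)
                [] (store K) [] r) 8 := by
            rw [hd]
            have h4 : TRuns (pushes .key (b.map .bit)) w
                (mem (u.length + 1 + 1) (P.map .pending) (n.map .bit) [] (store K) [] r) ()
                (mem (u.length + 1 + 1) (P.map .pending) ((b ++ n).map .bit) [] (store K) [] r)
                2 := by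
              refine Runs.mono (runs_pushes (by simp only [mem]; omega) (fits _)
                (fun _ _ => trivial) rfl rfl ?_ ?_) (by simpa using hb)
              · simp [mem]
              · intro i
                cases i <;> simp [mem]
            have h5 : TRuns (pushes .pend (l.map .pending)) w
                (mem (u.length + 1 + 1) (P.map .pending) ((b ++ n).map .bit) [] (store K) [] r) ()
                (mem (u.length + 1 + 1) ((l ++ P).map .pending) ((b ++ n).map .bit) [] (store K)
                  [] r) 5 := by
              refine Runs.mono (runs_pushes (by simp only [mem]; omega) (fits _)
                (fun _ _ => trivial) rfl rfl ?_ ?_) (by simp; omega)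
              · simp [mem]
              · intro i
                cases i <;> simp [mem]
            have h6 := runs_ret (α := Token) (w := w) (Ok := fun _ => True)
              (e := (.inl (f || a) : Bool ⊕ Option Bool))
              (m := mem (u.length + 1 + 1) ((l ++ P).map .pending) ((b ++ n).map .bit) [] (store K)
                [] r) (by simp only [mem]; omega) (fits _)
            exact Runs.bind (k := fun _ => (pushes .pend (l.map .pending)).bind fun _ =>
              ret (Sum.inl (f || a))) h4 (Runs.bind h5 h6)
          refine ⟨m', Runs.mono (runs_pass_step hread hpos h1 (hlen ▸ h2)) ?_, h3⟩
          rw [hv]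
          nlinarith

/-! ### All passes -/

theorem runs_count_aux {u v : List Token} {l : List Symbol} (hw : w = u ++ v) :
    TRuns (loop (S := Unit) (fun _ => act fun s _ => match s with
      | .leftEnd => (onInput .right, .inl ())
      | .letter _ => (⟨.right, fun | .rounds => .push .tick | _ => .keep, []⟩, .inl ())
      | .rightEnd => (nop, .inr ())) () : DProg Unit) w (mem (u.length + 1) [] [] [] [] [] l) ()
      (mem (w.length + 1) [] [] [] [] [] (List.replicate v.length .tick ++ l)) (v.length + 1) := by
  induction v generalizing u l with
  | nil =>
    have hread : readInput w (u.length + 1) = .rightEnd := hw ▸ readInput_append u []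
    have : w.length = u.length := by simp [hw]
    rw [this]
    exact Runs.loop_exit (runs_act (o := nop) (by simp [mem, hread])
      (nop_apply (by simp [mem, hw])) (fits _))
  | cons t v ih =>
    have hread : readInput w (u.length + 1) = .letter t := hw ▸ readInput_append u (t :: v)
    have h1 := ih (u := u ++ [t]) (l := .tick :: l) (by simp [hw])
    have h2 : List.replicate v.length Symbol.tick ++ .tick :: l =
        List.replicate (t :: v).length .tick ++ l := by
      rw [List.length_cons, List.replicate_succ']
      simp
    rw [h2] at h1
    rw [List.length_cons, add_comm (v.length + 1)]
    refine Runs.loop_next (runs_act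
      (o := ⟨.right, fun | .rounds => .push .tick | _ => .keep, []⟩) (e := Sum.inl ()) ?_ ?_
      (fits _)) h1
    · simp [mem, hread]
    · refine Mem.ext ?_ (funext fun i => ?_) rfl
      · simp [Op.apply, Move.apply, mem, hw]
      · cases i <;> simp [Op.apply, StkOp.apply, mem]

theorem runs_count : TRuns count w initialMem () (mem (w.length + 1) [] [] [] [] []
    (List.replicate w.length .tick)) (w.length + 2) := by
  have h := runs_count_aux (w := w) (u := []) (v := w) (l := []) rfl
  rw [List.append_nil] at h
  refine Runs.mono (Runs.loop_next (runs_act (o := onInput .right) (e := Sum.inl ()) rfl ?_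
    (fits _)) h) (by omega)
  refine Mem.ext ?_ (funext fun i => ?_) rfl
  · simp [onInput, Op.apply, Move.apply, mem, initialMem]
  · cases i <;> rfl

/-- What follows a pass depends on the remaining ticks, so the closing step `finishRound` is left as
a hypothesis, to be supplied for either outcome. -/
theorem runs_round {K : List Key} {l : List Symbol} {B : ℕ} (hpos : pos ≤ w.length + 1)
    (hB : (store K).length + 2 * w.length ≤ B) :
    ∃ m' : DMem, (m'.out = [] ∧ m'.pos ≤ w.length + 1) ∧
      (∀ q ∈ Pending.pass true [.items true] [] K w,
        m' = mem (w.length + 1) [] [] [] (store q.2) [] l ∧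
          (store q.2).length ≤ (store K).length + 2 * w.length) ∧
      ∀ e m'', TRuns (finishRound ((Pending.pass true [.items true] [] K w).map (·.1))) w m' e m''
        1 → TRuns round w (mem pos [] [] [] (store K) [] l) e m''
          ((5 * B + 17) * (w.length + 1)) := by
  obtain ⟨m', h2, hm', h3⟩ := runs_pass (w := w) (u := []) (v := w) (f := true)
    (P := [.items true]) (n := []) (K := K) (r := l)
    (B := (store K).length + 2 * w.length) rfl
    (le_of_eq (by simp only [potential, List.length_nil, add_zero]))
  refine ⟨m', hm', h3, fun e m'' h => ?_⟩
  have h4 : TRuns (pushes .pend [.pending (.items true)]) w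
      (mem pos [] [] [] (store K) [] l) ()
      (mem pos [.pending (.items true)] [] [] (store K) [] l) 2 := by
    refine runs_pushes hpos (fits _) (fun _ _ => trivial) rfl rfl rfl ?_
    intro i
    cases i <;> simp [mem]
  -- Preparing, rewinding and finishing cost at most `5 * (w.length + 1)` steps, which raises `12`
  -- to `17`.
  refine Runs.mono (Runs.bind h4 (Runs.bind (runs_rewind hpos (fits _)) (Runs.bind h2 h))) ?_
  simp only [mem]
  nlinarith

/-- A pass adds at most `2 * w.length` symbols to the store, so `B` bounds its size during all
remaining passes. -/
theorem runs_rounds {r : ℕ} {K : List Key} {B : ℕ} (hpos : pos ≤ w.length + 1)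
    (hB : (store K).length + 2 * w.length * (r + 1) ≤ B) :
    ∃ m' : DMem, TRuns rounds w (mem pos [] [] [] (store K) [] (List.replicate r .tick))
      (passes w r K == some true) m' ((r + 1) * ((5 * B + 17) * (w.length + 1))) ∧
      m'.out = [] ∧ m'.pos ≤ w.length + 1 := by
  induction r generalizing pos K with
  | zero =>
    obtain ⟨m', ⟨hout, hpos'⟩, h1, h2⟩ := runs_round (w := w) (K := K)
      (l := List.replicate 0 .tick) (B := B) hpos (by omega)
    refine ⟨m', Runs.mono (Runs.loop_exit (h2 _ _ ?_)) (by omega), hout, hpos'⟩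
    cases hp : Pending.pass true [.items true] [] K w with
    | none =>
      simp only [passes, hp]
      exact runs_ret hpos' (fits _)
    | some q =>
      obtain ⟨rfl, -⟩ := h1 q hp
      have : (passes w 0 K == some true) = q.1 := by
        simp only [passes, hp]
        cases h : q.1 <;> simp [h]
      rw [this]
      exact runs_act (o := nop) (by simp [mem]) (nop_apply le_rfl) (fits _)
  | succ r ih =>
    obtain ⟨m', ⟨hout, hpos'⟩, h1, h2⟩ := runs_round (w := w) (K := K)
      (l := List.replicate (r + 1) .tick) (B := B) hpos (by nlinarith)
    cases hp : Pending.pass true [.items true] [] K w with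
    | none =>
      rw [hp] at h2
      refine ⟨m', Runs.mono (Runs.loop_exit (h2 _ _ ?_)) ?_, hout, hpos'⟩
      · simp only [passes, hp]
        exact runs_ret hpos' (fits _)
      · exact Nat.le_mul_of_pos_left _ (by omega)
    | some q =>
      obtain ⟨rfl, hq⟩ := h1 q hp
      rw [hp] at h2
      obtain ⟨m'', h3, h4⟩ := ih (pos := w.length + 1) (K := q.2) le_rfl (by nlinarith)
      refine ⟨m'', ?_, h4⟩
      have : passes w (r + 1) K = passes w r q.2 := by simp only [passes, hp, Option.bind_some]
      rw [this]
      refine Runs.mono (Runs.loop_next (h2 (.inl ()) _ ?_) h3) (le_of_eq (by ring))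
      refine runs_act (o := onStk fun | .rounds => .pop | _ => .keep) ?_ ?_ (fits _)
      · simp [mem, List.replicate_succ]
      · refine Mem.ext ?_ (funext fun i => ?_) rfl
        · simp [onStk, Op.apply, Move.apply, mem]
        · cases i <;> simp [onStk, Op.apply, StkOp.apply, mem]

theorem runs_main (w : List Token) :
    ∃ m' : DMem, TRuns main w initialMem () m' (40 * (w.length + 1) ^ 4) ∧
      m'.out = [passes w w.length [] == some true] := by
  obtain ⟨m', h, hout, hpos⟩ := runs_rounds (w := w) (pos := w.length + 1) (r := w.length)
    (K := []) (B := 2 * w.length * (w.length + 1)) le_rfl (by simp [store])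
  refine ⟨_, Runs.mono (Runs.bind runs_count (Runs.bind h (runs_emit hpos (fits _)))) ?_, ?_⟩
  · generalize w.length = n
    have h1 : n + 2 + ((n + 1) * ((5 * (2 * n * (n + 1)) + 17) * (n + 1)) + 1) =
        10 * n * (n + 1) ^ 3 + 17 * (n + 1) ^ 2 + (n + 1) + 2 := by ring
    have h2 : 10 * n * (n + 1) ^ 3 ≤ 10 * (n + 1) ^ 4 := by
      rw [pow_succ _ 3, mul_assoc, mul_comm n]
      gcongr
      exact Nat.le_succ n
    have h3 : (n + 1) ^ 2 ≤ (n + 1) ^ 4 := Nat.pow_le_pow_right (by omega) (by omega)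
    have h4 : (n + 1) ^ 1 ≤ (n + 1) ^ 4 := Nat.pow_le_pow_right (by omega) (by omega)
    have h5 : (n + 1) ^ 0 ≤ (n + 1) ^ 4 := Nat.pow_le_pow_right (by omega) (by omega)
    rw [pow_one] at h4
    rw [pow_zero] at h5
    omega
  · simp [hout]

end Decider

theorem inP_minModSatELIO : InP minModSatELIO.{u} := by
  -- Twice the bound of `Decider.runs_main`, because the machine takes two steps for each step of
  -- the program.
  refine ⟨Decider.main.toMachine, .C 80 * (.X + 1) ^ 4, fun w =>
    ⟨passes w w.length [] == some true, ?_, ?_⟩⟩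
  · obtain ⟨m', h, hout⟩ := Decider.runs_main w
    rw [← hout]
    convert Prog.Runs.outputsIn trivial h using 1
    simp
    ring
  · rw [mem_minModSatELIO_iff]
    simp

end MinMod

namespace MinMod

/-! ## Describing the run of a machine by propositional Horn rules -/

/-- The elements of a finite type in some order. -/
noncomputable def univList (X : Type) [Finite X] : List X :=
  (Set.finite_univ (α := X)).toFinset.toList

@[simp] theorem mem_univList {X : Type} [Finite X] (x : X) : x ∈ univList X := by
  simp [univList]

def InSymbol.isLeftEnd {α : Type} : InSymbol α → Bool
  | .leftEnd => true
  | _ => false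

theorem isLeftEnd_readInput {α : Type} (w : List α) (j : ℕ) :
    (readInput w j).isLeftEnd = decide (j = 0) := by
  rw [Bool.eq_iff_iff, decide_eq_true_iff, ← readInput_eq_leftEnd (w := w)]
  cases readInput w j <;> simp [InSymbol.isLeftEnd]

theorem readInput_eq_rightEnd {α : Type} {w : List α} {j : ℕ} :
    readInput w j = .rightEnd ↔ w.length + 1 ≤ j := by
  cases j with
  | zero => simp [readInput]
  | succ j =>
    simp only [readInput]
    split
    · rename_i a h
      obtain ⟨h, -⟩ := List.getElem?_eq_some_iff.1 h
      simp
      omega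
    · rename_i h
      rw [List.getElem?_eq_none_iff] at h
      simp
      omega

theorem readInput_min {α : Type} (w : List α) (k : ℕ) :
    readInput w (min k (w.length + 1)) = readInput w k := by
  rcases le_total k (w.length + 1) with h | h
  · rw [min_eq_left h]
  · rw [min_eq_right h, readInput_eq_rightEnd.2 h, readInput_eq_rightEnd.2 le_rfl]

/-- The move of the input head, which stays on the right end marker. -/
def Move.onInput {α : Type} : Move → InSymbol α → Move
  | .right, .rightEnd => .stay
  | mv, _ => mv

/-- The bound on the head position refers to the length of the input; here it is expressed by the
scanned symbol alone, so that a step becomes local. -/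
theorem Move.onInput_apply {α : Type} (mv : Move) {w : List α} {j : ℕ} (h : j ≤ w.length + 1) :
    (mv.onInput (readInput w j)).apply j = min (mv.apply j) (w.length + 1) := by
  by_cases hj : readInput w j = .rightEnd
  · have := readInput_eq_rightEnd.1 hj
    rw [hj]
    cases mv <;> simp [Move.onInput, Move.apply] <;> omega
  · have : mv.onInput (readInput w j) = mv := by
      unfold Move.onInput
      split
      · rename_i h1
        exact absurd h1 hj
      · rfl
    have h' : j < w.length + 1 := by
      rw [readInput_eq_rightEnd] at hj
      omega
    rw [this]
    cases mv <;> simp [Move.apply] <;> omega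

/-- Whether the head is on a cell after a move, given whether it was on the left neighbour, on the
cell, or on the right neighbour; `wall` tells that the cell is the leftmost one. -/
def Move.flag (wall l m r : Bool) : Move → Bool
  | .left => r || (wall && m)
  | .stay => m
  | .right => l

theorem Move.flag_zero (mv : Move) (h : ℕ) :
    mv.flag true false (decide (h = 0)) (decide (h = 1)) = decide (mv.apply h = 0) := by
  rw [Bool.eq_iff_iff, decide_eq_true_iff]
  cases mv with
  | left => simp [Move.flag, Move.apply]; omega
  | stay => simp [Move.flag, Move.apply]
  | right => simp [Move.flag, Move.apply]

theorem Move.flag_succ (mv : Move) (h j : ℕ) :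
    mv.flag false (decide (h = j)) (decide (h = j + 1)) (decide (h = j + 2)) =
      decide (mv.apply h = j + 1) := by
  rw [Bool.eq_iff_iff, decide_eq_true_iff]
  cases mv with
  | left => simp [Move.flag, Move.apply]
  | stay => simp [Move.flag, Move.apply]
  | right => simp [Move.flag, Move.apply]

/-- A propositional Horn rule: a list of premises and a conclusion. -/
abbrev Rule (X : Type) : Type := List X × X

def Rule.Respects {X : Type} (S : Set X) (r : Rule X) : Prop := (∀ a ∈ r.1, a ∈ S) → r.2 ∈ S

/-! ### One machine step as a local change of the tape contents -/

namespace Simulation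
variable {α : Type} (M : Machine α Bool)

/-- The symbols on all tapes at the same position, with flags for the presence of the heads. -/
abbrev Content : Type := (InSymbol α × Bool) × (M.ι → M.Γ × Bool)

/-- What the machine sees in one step. -/
abbrev Situation : Type := M.Q × InSymbol α × (M.ι → M.Γ)

variable {M}

def situation (w : List α) (c : M.Cfg) : Situation M :=
  (c.state, readInput w c.inPos, fun i => c.work i (c.head i))

/-- Position `0` is a wall, position `j + 1` holds the `j`-th cells of the tapes. -/
def content (w : List α) (c : M.Cfg) : ℕ → Option (Content M)
  | 0 => none
  | j + 1 => some ((readInput w j, decide (c.inPos = j)),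
      fun i => (c.work i j, decide (c.head i = j)))

def transition (x : Situation M) : Option (Action M.Q M.Γ M.ι Bool) := M.δ x.1 x.2.1 x.2.2

/-- The content of a position after a step in terms of the contents of its neighbourhood. -/
def nextContent (s : InSymbol α) (a : Action M.Q M.Γ M.ι Bool) (l : Option (Content M))
    (m r : Content M) : Content M :=
  ((m.1.1, (a.inMove.onInput s).flag l.isNone (l.any fun c => c.1.2) m.1.2 r.1.2),
    fun i => (if (m.2 i).2 then a.write i else (m.2 i).1,
      (a.move i).flag l.isNone (l.any fun c => (c.2 i).2) (m.2 i).2 (r.2 i).2))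

theorem step_eq_some {w : List α} {c : M.Cfg} {a : Action M.Q M.Γ M.ι Bool}
    (h : transition (situation w c) = some a) : M.step w c = some
      { state := a.next
        inPos := min (a.inMove.apply c.inPos) (w.length + 1)
        work := fun i => Function.update (c.work i) (c.head i) (a.write i)
        head := fun i => (a.move i).apply (c.head i)
        out := c.out ++ a.emit } := by
  simp only [transition, situation] at h
  simp [Machine.step, h]

theorem step_eq_none {w : List α} {c : M.Cfg} :
    M.step w c = none ↔ transition (situation w c) = none := by
  simp [Machine.step, transition, situation]

/-- Heads move by at most one cell and write only where they are, so three neighbouring positions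
and the action determine the new content. The wall at position `0` tells the leftmost cell from the
others. -/
theorem content_step {w : List α} {c c' : M.Cfg} {a : Action M.Q M.Γ M.ι Bool}
    (h : transition (situation w c) = some a) (hc : M.step w c = some c')
    (hpos : c.inPos ≤ w.length + 1) {j : ℕ} {m r : Content M} (hm : content w c (j + 1) = some m)
    (hr : content w c (j + 2) = some r) :
    content w c' (j + 1) =
      some (nextContent (readInput w c.inPos) a (content w c j) m r) := by
  rw [step_eq_some h, Option.some.injEq] at hc
  subst hc
  simp only [content, Option.some.injEq] at hm hr
  subst hm hr
  have key : ∀ i, (if decide (c.head i = j) = true then a.write i else c.work i j) =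
      Function.update (c.work i) (c.head i) (a.write i) j := by
    intro i
    rw [Function.update_apply]
    simp [eq_comm]
  cases j with
  | zero =>
    simp only [content, nextContent, Option.isNone_none, Option.any_none, Move.flag_zero,
      zero_add, ← Move.onInput_apply _ hpos, key]
  | succ j =>
    simp only [content, nextContent, Option.isNone_some, Option.any_some, Move.flag_succ,
      ← Move.onInput_apply _ hpos, key]

theorem inPos_cfgAt_le (w : List α) (t : ℕ) : (M.cfgAt w t).inPos ≤ w.length + 1 := by
  induction t with
  | zero => exact Nat.zero_le _
  | succ t ih =>
    rw [Machine.cfgAt_succ]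
    cases h : transition (situation w (M.cfgAt w t)) with
    | none => simpa [step_eq_none.2 h] using ih
    | some a => simp [step_eq_some h]

theorem Move.apply_le (mv : Move) (h : ℕ) : mv.apply h ≤ h + 1 := by
  cases mv <;> simp [Move.apply]
  omega

theorem head_cfgAt_le (w : List α) (t : ℕ) :
    (M.cfgAt w t).inPos ≤ t ∧ ∀ i, (M.cfgAt w t).head i ≤ t := by
  induction t with
  | zero => exact ⟨le_rfl, fun i => le_rfl⟩
  | succ t ih =>
    rw [Machine.cfgAt_succ]
    cases h : transition (situation w (M.cfgAt w t)) with
    | none =>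
      simp only [step_eq_none.2 h, Option.getD_none]
      exact ⟨ih.1.trans (Nat.le_succ t), fun i => (ih.2 i).trans (Nat.le_succ t)⟩
    | some a =>
      simp only [step_eq_some h, Option.getD_some]
      exact ⟨(min_le_left _ _).trans ((Move.apply_le _ _).trans (Nat.succ_le_succ ih.1)),
        fun i => (Move.apply_le _ _).trans (Nat.succ_le_succ (ih.2 i))⟩

theorem mem_out_cfgAt {w : List α} {b : Bool} {t : ℕ} : b ∈ (M.cfgAt w t).out ↔
    ∃ s < t, ∃ a, transition (situation w (M.cfgAt w s)) = some a ∧ b ∈ a.emit := by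
  induction t with
  | zero => simp [Machine.cfgAt, Machine.initial]
  | succ t ih =>
    rw [Machine.cfgAt_succ]
    simp only [Nat.lt_succ_iff_lt_or_eq, or_and_right, exists_or, exists_eq_left, ← ih]
    cases h : transition (situation w (M.cfgAt w t)) with
    | none => simp [step_eq_none.2 h]
    | some a => simp [step_eq_some h]

/-! ### The rules -/

variable (M) in
/-- Predicates for a step, and, in the case of `cell`, a position on the tapes. -/
inductive Tag : Type
  | state (q : M.Q)
  | cell (c : Option (Content M))
  | readIn (s : InSymbol α)
  | readWork (i : M.ι) (x : M.Γ)
  | sit (x : Situation M)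
  | goal

variable (M) in
abbrev Atom : Type := Tag M × List ℕ

/-- In a rule schema, `(false, c)` stands for step number `t + c` and `(true, c)` for position
`k + c`, for variables `t` and `k`. -/
abbrev Term : Type := Bool × Fin 3

def Term.val (t k : ℕ) (x : Term) : ℕ := (if x.1 then k else t) + x.2

variable (M) in
abbrev AtomSchema : Type := Tag M × List Term

def AtomSchema.inst (t k : ℕ) (a : AtomSchema M) : Atom M := (a.1, a.2.map (Term.val t k))

variable (M) in
abbrev Schema : Type := Rule (AtomSchema M)

def Schema.inst (t k : ℕ) (r : Schema M) : Rule (Atom M) :=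
  (r.1.map (AtomSchema.inst t k), AtomSchema.inst t k r.2)

section
open Tag

variable (M) in
def startSchemas : List (Schema M) := [([], (state M.start, [(false, 0)]))]

-- Cell `k` is at position `k + 1`. All heads start in cell `0`, so the test for the left end marker
-- also serves as the initial head flag.
variable (M) in
def inputSchemas (s : InSymbol α) : List (Schema M) :=
  [([], (cell (some ((s, s.isLeftEnd), fun _ => (M.blank, s.isLeftEnd))), [(false, 0), (true, 1)]))]

variable (M) in
def wallSchemas : List (Schema M) := [([], (cell none, [(false, 0), (true, 0)]))]

/-- The atoms that are true in the run on `w`. -/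
def truth (w : List α) : Set (Atom M) := {a | match a with
  | (state q, [t]) => (M.cfgAt w t).state = q
  | (cell c, [t, j]) => content w (M.cfgAt w t) j = c
  | (readIn s, [t]) => readInput w (M.cfgAt w t).inPos = s
  | (readWork i x, [t]) => (M.cfgAt w t).work i ((M.cfgAt w t).head i) = x
  | (sit x, [t]) => situation w (M.cfgAt w t) = x
  | (goal, []) => ∃ t a, transition (situation w (M.cfgAt w t)) = some a ∧ true ∈ a.emit
  | _ => False}

/-- The output is a single bit, so acceptance is the event that some step emits `true`; no
transition is available after halting. -/
theorem goal_mem_truth_iff {w : List α} {b : Bool} {T : ℕ} (h : M.OutputsIn w [b] T) :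
    ((goal, []) : Atom M) ∈ truth w ↔ b = true := by
  have h1 : b = true ↔ true ∈ (M.cfgAt w T).out := by
    rw [h.2]
    simp [eq_comm]
  rw [h1, mem_out_cfgAt]
  constructor
  · rintro ⟨t, a, ha, he⟩
    refine ⟨t, ?_, a, ha, he⟩
    by_contra hle
    have h2 := h.1
    rw [← Machine.cfgAt_of_le h.1 (not_lt.1 hle), step_eq_none, ha] at h2
    exact absurd h2 (by simp)
  · rintro ⟨t, -, a, ha, he⟩
    exact ⟨t, a, ha, he⟩

variable [Finite α]

instance : Finite M.Q := M.finQ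
instance : Finite M.Γ := M.finΓ
instance : Finite M.ι := M.finι

variable (M) in
noncomputable def readSchemas : List (Schema M) :=
  (univList (Content M)).flatMap fun c =>
    (if c.1.2 then [([(cell (some c), [(false, 0), (true, 0)])], (readIn c.1.1, [(false, 0)]))]
      else []) ++
    (univList M.ι).flatMap fun i =>
      if (c.2 i).2 then
        [([(cell (some c), [(false, 0), (true, 0)])], (readWork i (c.2 i).1, [(false, 0)]))]
      else []

variable (M) in
noncomputable def sitSchemas : List (Schema M) :=
  (univList (Situation M)).map fun x =>
    ((state x.1, [(false, 0)]) :: (readIn x.2.1, [(false, 0)]) ::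
      (univList M.ι).map fun i => (readWork i (x.2.2 i), [(false, 0)]), (sit x, [(false, 0)]))

-- The last group has a rule for every conceivable neighbourhood; only those that occur in the run
-- will fire.
open Classical in
noncomputable def actionSchemas (x : Situation M) (a : Action M.Q M.Γ M.ι Bool) :
    List (Schema M) :=
  ([(sit x, [(false, 0)])], (state a.next, [(false, 1)])) ::
  ((if true ∈ a.emit then [([(sit x, [(false, 0)])], (goal, []))] else []) ++
  (univList (Option (Content M) × Content M × Content M)).map fun p =>
    ([(sit x, [(false, 0)]), (cell p.1, [(false, 0), (true, 0)]),
      (cell (some p.2.1), [(false, 0), (true, 1)]), (cell (some p.2.2), [(false, 0), (true, 2)])],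
      (cell (some (nextContent x.2.1 a p.1 p.2.1 p.2.2)), [(false, 1), (true, 1)])))

variable (M) in
noncomputable def transitionSchemas : List (Schema M) :=
  (univList (Situation M)).flatMap fun x => match transition x with
    | some a => actionSchemas x a
    | none => []

-- These schemas depend on the machine only, so they can be built into a fixed program; the input
-- enters through `inputSchemas` alone.
variable (M) in
noncomputable def runSchemas : List (Schema M) :=
  readSchemas M ++ (sitSchemas M ++ transitionSchemas M)

variable (M) in
/-- The rules that describe the run on `w` for steps and positions up to `N`. -/
noncomputable def rules (w : List α) (N : ℕ) : List (Rule (Atom M)) :=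
  (startSchemas M).map (Schema.inst 0 0) ++
  ((List.range N).flatMap (fun k => (inputSchemas M (readInput w k)).map (Schema.inst 0 k)) ++
  (List.range N).flatMap fun t => (wallSchemas M).map (Schema.inst t 0) ++
    (List.range N).flatMap fun k => (runSchemas M).map (Schema.inst t k))

/-- This is soundness: the atoms true in the run satisfy all rules, so no false atom is derivable.
-/
theorem respects_truth {w : List α} {N : ℕ} {r : Rule (Atom M)} (hr : r ∈ rules M w N) :
    r.Respects (truth w) := by
  simp only [rules, List.mem_append, List.mem_flatMap, List.mem_map] at hr
  rcases hr with ⟨r, hr, rfl⟩ | ⟨k, -, r, hr, rfl⟩ | ⟨t, -, ⟨r, hr, rfl⟩ | ⟨k, -, r, hr, rfl⟩⟩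
  · simp only [startSchemas, List.mem_singleton] at hr
    subst hr
    intro _
    rfl
  · simp only [inputSchemas, List.mem_singleton] at hr
    subst hr
    intro _
    change content w (M.cfgAt w 0) (k + 1) = _
    rw [isLeftEnd_readInput]
    simp [content, Machine.cfgAt, Machine.initial, eq_comm]
  · simp only [wallSchemas, List.mem_singleton] at hr
    subst hr
    intro _
    rfl
  · simp only [runSchemas, List.mem_append] at hr
    rcases hr with hr | hr | hr
    · simp only [readSchemas, List.mem_flatMap, List.mem_append] at hr
      obtain ⟨c, -, hr | ⟨i, -, hr⟩⟩ := hr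
      · split_ifs at hr with hc
        · rw [List.mem_singleton] at hr
          subst hr
          intro h
          have h1 : content w (M.cfgAt w t) k = some c := h _ List.mem_cons_self
          change readInput w (M.cfgAt w t).inPos = c.1.1
          cases k with
          | zero => simp [content] at h1
          | succ k =>
            simp only [content, Option.some.injEq] at h1
            subst h1
            simp only [decide_eq_true_eq] at hc
            rw [hc]
        · simp at hr
      · split_ifs at hr with hc
        · rw [List.mem_singleton] at hr
          subst hr
          intro h
          have h1 : content w (M.cfgAt w t) k = some c := h _ List.mem_cons_self
          change (M.cfgAt w t).work i ((M.cfgAt w t).head i) = (c.2 i).1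
          cases k with
          | zero => simp [content] at h1
          | succ k =>
            simp only [content, Option.some.injEq] at h1
            subst h1
            simp only [decide_eq_true_eq] at hc
            rw [hc]
        · simp at hr
    · simp only [sitSchemas, List.mem_map] at hr
      obtain ⟨x, -, rfl⟩ := hr
      intro h
      have h1 : (M.cfgAt w t).state = x.1 := h _ List.mem_cons_self
      have h2 : readInput w (M.cfgAt w t).inPos = x.2.1 :=
        h _ (List.mem_cons_of_mem _ List.mem_cons_self)
      have h3 : ∀ i, (M.cfgAt w t).work i ((M.cfgAt w t).head i) = x.2.2 i := fun i =>
        h (readWork i (x.2.2 i), [t]) (List.mem_cons_of_mem _ (List.mem_cons_of_mem _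
          (List.mem_map_of_mem (List.mem_map_of_mem (mem_univList i)))))
      exact Prod.ext h1 (Prod.ext h2 (funext h3))
    · simp only [transitionSchemas, List.mem_flatMap] at hr
      obtain ⟨x, -, hr⟩ := hr
      split at hr
      · rename_i a ha
        simp only [actionSchemas, List.mem_cons, List.mem_append, List.mem_map] at hr
        rcases hr with rfl | hr | ⟨p, -, rfl⟩
        · intro h
          have h1 : situation w (M.cfgAt w t) = x := h _ List.mem_cons_self
          subst h1
          change (M.cfgAt w (t + 1)).state = a.next
          rw [Machine.cfgAt_succ, step_eq_some ha]
          rfl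
        · split_ifs at hr with he
          · rw [List.mem_singleton] at hr
            subst hr
            intro h
            have h1 : situation w (M.cfgAt w t) = x := h _ List.mem_cons_self
            subst h1
            exact ⟨t, a, ha, he⟩
          · simp at hr
        · intro h
          have h1 : situation w (M.cfgAt w t) = x := h _ List.mem_cons_self
          have h2 : content w (M.cfgAt w t) k = p.1 :=
            h _ (List.mem_cons_of_mem _ List.mem_cons_self)
          have h3 : content w (M.cfgAt w t) (k + 1) = some p.2.1 :=
            h _ (List.mem_cons_of_mem _ (List.mem_cons_of_mem _ List.mem_cons_self))
          have h4 : content w (M.cfgAt w t) (k + 2) = some p.2.2 := h _ (List.mem_cons_of_mem _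
            (List.mem_cons_of_mem _ (List.mem_cons_of_mem _ List.mem_cons_self)))
          subst h1
          change content w (M.cfgAt w (t + 1)) (k + 1) = _
          rw [Machine.cfgAt_succ, ← h2]
          have hs := step_eq_some ha
          rw [content_step ha (by rw [hs]; rfl) (inPos_cfgAt_le w t) h3 h4]
          rfl
      · simp at hr

theorem readIn_mem_readSchemas (c : Content M) (hc : c.1.2 = true) :
    (([(cell (some c), [(false, 0), (true, 0)])], (readIn c.1.1, [(false, 0)])) : Schema M) ∈
      readSchemas M := by
  refine List.mem_flatMap.2 ⟨c, mem_univList _, List.mem_append_left _ ?_⟩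
  rw [if_pos hc]
  exact List.mem_singleton_self _

theorem readWork_mem_readSchemas (c : Content M) (i : M.ι) (hc : (c.2 i).2 = true) :
    (([(cell (some c), [(false, 0), (true, 0)])], (readWork i (c.2 i).1, [(false, 0)])) :
      Schema M) ∈ readSchemas M := by
  refine List.mem_flatMap.2 ⟨c, mem_univList _, List.mem_append_right _
    (List.mem_flatMap.2 ⟨i, mem_univList _, ?_⟩)⟩
  rw [if_pos hc]
  exact List.mem_singleton_self _

/-- This is completeness. A content depends on that of the right neighbour one step earlier, so the
known part of the tape shrinks by one position per step, whence `j + t ≤ N`. After `t` steps the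
heads are at positions at most `t + 1`, which stay in the known part when `2 * t + 1 < N`. Once the
machine halts no rule leads to the next step, which is why `hrun` is required. -/
theorem derived_of_respects {w : List α} {N : ℕ} {S : Set (Atom M)}
    (hS : ∀ r ∈ rules M w N, r.Respects S) {t : ℕ} (ht : 2 * t + 1 < N)
    (hrun : ∀ s < t, transition (situation w (M.cfgAt w s)) ≠ none) :
    (state (M.cfgAt w t).state, [t]) ∈ S ∧ (sit (situation w (M.cfgAt w t)), [t]) ∈ S ∧
      ∀ j, j + t ≤ N → (cell (content w (M.cfgAt w t) j), [t, j]) ∈ S := by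
  have hrules : ∀ t < N, ∀ k < N, ∀ r ∈ runSchemas M, (Schema.inst t k r).Respects S := by
    intro t ht k hk r hr
    refine hS _ ?_
    simp only [rules, List.mem_append, List.mem_flatMap, List.mem_map, List.mem_range]
    exact .inr (.inr ⟨t, ht, .inr ⟨k, hk, r, hr, rfl⟩⟩)
  have hwall : ∀ t < N, ((cell none, [t, 0]) : Atom M) ∈ S := by
    intro t ht
    refine hS ([], (cell none, [t, 0])) ?_ (by simp)
    simp only [rules, List.mem_append, List.mem_flatMap, List.mem_map, List.mem_range]
    exact .inr (.inr ⟨t, ht, .inl ⟨_, List.mem_singleton_self _, rfl⟩⟩)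
  -- the situation follows from the state and the contents of the cells
  have hsit : ∀ t, 2 * t + 1 < N → (state (M.cfgAt w t).state, [t]) ∈ S →
      (∀ j, j + t ≤ N → (cell (content w (M.cfgAt w t) j), [t, j]) ∈ S) →
      (sit (situation w (M.cfgAt w t)), [t]) ∈ S := by
    intro t ht h1 h2
    obtain ⟨hin, hwork⟩ := head_cfgAt_le (M := M) w t
    have h3 : (readIn (readInput w (M.cfgAt w t).inPos), [t]) ∈ S := by
      refine hrules t (by omega) ((M.cfgAt w t).inPos + 1) (by omega)
        ([(cell (content w (M.cfgAt w t) ((M.cfgAt w t).inPos + 1)), [(false, 0), (true, 0)])],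
          (readIn (readInput w (M.cfgAt w t).inPos), [(false, 0)])) ?_ ?_
      · exact List.mem_append_left _ (readIn_mem_readSchemas _ (decide_eq_true rfl))
      · intro a ha
        rw [List.mem_singleton.1 ha]
        exact h2 _ (by omega)
    have h4 : ∀ i, (readWork i ((M.cfgAt w t).work i ((M.cfgAt w t).head i)), [t]) ∈ S := by
      intro i
      have := hwork i
      refine hrules t (by omega) ((M.cfgAt w t).head i + 1) (by omega)
        ([(cell (content w (M.cfgAt w t) ((M.cfgAt w t).head i + 1)), [(false, 0), (true, 0)])],
          (readWork i ((M.cfgAt w t).work i ((M.cfgAt w t).head i)), [(false, 0)])) ?_ ?_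
      · exact List.mem_append_left _ (readWork_mem_readSchemas _ i (decide_eq_true rfl))
      · intro a ha
        rw [List.mem_singleton.1 ha]
        exact h2 _ (by omega)
    -- The schema does not mention the position, so any admissible value may be chosen for it.
    refine hrules t (by omega) 0 (by omega) _ (List.mem_append_right _ (List.mem_append_left _
      (List.mem_map_of_mem (mem_univList (situation w (M.cfgAt w t)))))) ?_
    intro a ha
    simp only [Schema.inst, List.map_cons, List.mem_cons, List.map_map, List.mem_map] at ha
    rcases ha with rfl | rfl | ⟨i, -, rfl⟩
    · exact h1
    · exact h3
    · exact h4 i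
  suffices h : (state (M.cfgAt w t).state, [t]) ∈ S ∧
      ∀ j, j + t ≤ N → (cell (content w (M.cfgAt w t) j), [t, j]) ∈ S from
    ⟨h.1, hsit t ht h.1 h.2, h.2⟩
  induction t with
  | zero =>
    constructor
    · refine hS ([], (state M.start, [0])) ?_ (by simp)
      simp only [rules, List.mem_append, List.mem_map]
      exact .inl ⟨_, List.mem_singleton_self _, rfl⟩
    · intro j hj
      cases j with
      | zero => exact hwall 0 (by omega)
      | succ k =>
        refine hS ([], (cell (content w (M.cfgAt w 0) (k + 1)), [0, k + 1])) ?_ (by simp)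
        simp only [rules, List.mem_append, List.mem_flatMap, List.mem_map, List.mem_range]
        refine .inr (.inl ⟨k, by omega, _, List.mem_singleton_self _, ?_⟩)
        rw [isLeftEnd_readInput]
        simp [content, Machine.cfgAt, Machine.initial, Schema.inst, AtomSchema.inst, Term.val,
          eq_comm]
  | succ t ih =>
    obtain ⟨ih1, ih2⟩ := ih (by omega) fun s hs => hrun s (hs.trans (Nat.lt_succ_self t))
    have ih3 := hsit t (by omega) ih1 ih2
    obtain ⟨a, ha⟩ := Option.ne_none_iff_exists'.1 (hrun t (Nat.lt_succ_self t))
    have hs := step_eq_some ha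
    have hact : ∀ r ∈ actionSchemas (situation w (M.cfgAt w t)) a, r ∈ runSchemas M := by
      intro r hr
      refine List.mem_append_right _ (List.mem_append_right _ (List.mem_flatMap.2
        ⟨situation w (M.cfgAt w t), mem_univList _, ?_⟩))
      rw [ha]
      exact hr
    constructor
    · have h1 := hrules t (by omega) 0 (by omega) _ (hact _ List.mem_cons_self) (by
        intro b hb
        rw [List.mem_singleton.1 hb]
        exact ih3)
      rw [Machine.cfgAt_succ, hs]
      exact h1
    · intro j hj
      cases j with
      | zero => exact hwall _ (by omega)
      | succ k =>
        obtain ⟨m, hm⟩ : ∃ m, content w (M.cfgAt w t) (k + 1) = some m := ⟨_, rfl⟩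
        obtain ⟨r, hr⟩ : ∃ r, content w (M.cfgAt w t) (k + 2) = some r := ⟨_, rfl⟩
        rw [Machine.cfgAt_succ,
          content_step ha (by rw [hs]; rfl) (inPos_cfgAt_le w t) hm hr]
        refine hrules t (by omega) k (by omega) _ (hact _ (List.mem_cons_of_mem _
          (List.mem_append_right _ (List.mem_map_of_mem (mem_univList
            -- The rightmost premise is at position `k + 2` in step `t`, which satisfies the same
            -- bound as position `k + 1` in step `t + 1`.
            (content w (M.cfgAt w t) k, m, r)))))) ?_
        intro b hb
        simp only [Schema.inst, List.map_cons, List.map_nil, List.mem_cons, List.not_mem_nil,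
          or_false] at hb
        rcases hb with rfl | rfl | rfl | rfl
        · exact ih3
        · exact ih2 k (by omega)
        · exact hm ▸ ih2 (k + 1) (by omega)
        · exact hr ▸ ih2 (k + 2) (by omega)

/-- The goal is derivable from the rules if and only if it is true. -/
theorem goal_mem_of_respects {w : List α} {b : Bool} {T N : ℕ} {S : Set (Atom M)}
    (hS : ∀ r ∈ rules M w N, r.Respects S) (hN : 2 * T + 1 < N) (hout : M.OutputsIn w [b] T)
    (h : ((goal, []) : Atom M) ∈ truth w) : ((goal, []) : Atom M) ∈ S := by
  obtain ⟨t, a, ha, he⟩ := h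
  have ht : t < T := by
    by_contra hle
    have h2 := hout.1
    rw [← Machine.cfgAt_of_le hout.1 (not_lt.1 hle), step_eq_none, ha] at h2
    exact absurd h2 (by simp)
  -- The machine cannot have halted before step `t`: its configuration would not have changed since,
  -- yet a transition is possible at step `t`.
  obtain ⟨-, h1, -⟩ := derived_of_respects hS (t := t) (by omega) fun s hs h2 => by
    rw [Machine.cfgAt_of_le (step_eq_none.2 h2) hs.le, h2] at ha
    exact absurd ha (by simp)
  have hr : (([(sit (situation w (M.cfgAt w t)), [t])], (goal, [])) : Rule (Atom M)) ∈
      rules M w N := by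
    simp only [rules, List.mem_append, List.mem_flatMap, List.mem_map, List.mem_range]
    refine .inr (.inr ⟨t, by omega, .inr ⟨t, by omega,
      ([(sit (situation w (M.cfgAt w t)), [(false, 0)])], (goal, [])), ?_, rfl⟩⟩)
    refine List.mem_append_right _ (List.mem_append_right _ (List.mem_flatMap.2
      ⟨situation w (M.cfgAt w t), mem_univList _, ?_⟩))
    rw [ha]
    refine List.mem_cons_of_mem _ (List.mem_append_left _ ?_)
    rw [if_pos he]
    exact List.mem_singleton_self _
  refine hS _ hr ?_
  intro b hb
  rw [List.mem_singleton.1 hb]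
  exact h1

end

end Simulation
end MinMod

namespace MinMod

/-! ## Propositional Horn rules as EL knowledge bases -/

/-- The conjunction of concept names. -/
def Concept.conj (l : List Name) : Concept := l.foldr (fun A C => .inter (.atom A) C) .top

theorem Concept.isEL_conj (l : List Name) : (Concept.conj l).IsEL := by
  induction l with
  | nil => trivial
  | cons A l ih => exact ⟨trivial, ih⟩

theorem Concept.keys_conj (l : List Name) : (Concept.conj l).keys = l.map fun A => (false, A) := by
  induction l with
  | nil => rfl
  | cons A l ih => simpa [Concept.conj, Concept.keys] using ih

section
variable {X : Type} (nm : X → Name)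

def hornInclusion (r : Rule X) : Inclusion := ⟨.conj (r.1.map nm), .atom (nm r.2)⟩

/-- No ABox is needed: a rule without premises becomes an inclusion with left side `⊤`. -/
def hornKB (rs : List (Rule X)) : KB := ⟨rs.map (hornInclusion nm), []⟩

theorem isEL_hornKB (rs : List (Rule X)) : (hornKB nm rs).IsEL := by
  refine ⟨fun i hi => ?_, by simp [hornKB]⟩
  obtain ⟨r, -, rfl⟩ := List.mem_map.1 hi
  exact ⟨Concept.isEL_conj _, trivial⟩

variable {nm}

/-- The atoms whose names belong to the least closed set respect all rules. -/
theorem satInMinimalModel_hornKB {rs : List (Rule X)} {g : X}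
    (h : ∀ S : Set X, (∀ r ∈ rs, r.Respects S) → g ∈ S) :
    SatInMinimalModel.{u} (hornKB nm rs) (.atom (nm g)) := by
  rw [satInMinimalModel_iff_keys]
  intro k hk
  obtain rfl : k = (false, nm g) := by simpa [Concept.keys] using hk
  refine h {x | (false, nm x) ∈ (hornKB nm rs).representative.keys} fun r hr hS => ?_
  refine (hornKB nm rs).closed_representative.2 (hornInclusion nm r) (List.mem_map_of_mem hr) ?_ _
    List.mem_cons_self
  intro k hk
  simp only [hornInclusion, Concept.keys_conj, List.map_map, List.mem_map] at hk
  obtain ⟨x, hx, rfl⟩ := hk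
  exact hS x hx

/-- The names of the atoms in `S` form a closed set. Injectivity ensures that an atom outside `S`
does not share its name with one inside. -/
theorem mem_of_satInMinimalModel_hornKB (hnm : nm.Injective) {rs : List (Rule X)} {g : X}
    {S : Set X} (hS : ∀ r ∈ rs, r.Respects S)
    (h : SatInMinimalModel.{u} (hornKB nm rs) (.atom (nm g))) : g ∈ S := by
  rw [satInMinimalModel_iff_keys] at h
  have hc : (hornKB nm rs).Closed {k | ∃ x ∈ S, k = (false, nm x)} := by
    refine ⟨by simp [hornKB], fun i hi hl k hk => ?_⟩
    obtain ⟨r, hr, rfl⟩ := List.mem_map.1 hi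
    obtain rfl : k = (false, nm r.2) := by simpa [hornInclusion, Concept.keys] using hk
    refine ⟨r.2, hS r hr fun x hx => ?_, rfl⟩
    obtain ⟨y, hy, hxy⟩ := hl (false, nm x) (by
      simp only [hornInclusion, Concept.keys_conj, List.map_map]
      exact List.mem_map_of_mem (f := _ ∘ nm) hx)
    rw [hnm (Prod.ext_iff.1 hxy).2]
    exact hy
  obtain ⟨x, hx, hxg⟩ := hc.representative_subset (h (false, nm g) (by simp [Concept.keys]))
  rw [hnm (Prod.ext_iff.1 hxg).2]
  exact hx

end

/-! ## Names for lists of numbers -/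

/-- The `m` last digits of a number in base `B`, followed by the rest. -/
def digits (B : ℕ) : ℕ → ℕ → List ℕ
  | 0, v => [v]
  | m + 1, v => v % B :: digits B m (v / B)

theorem length_digits (B m v : ℕ) : (digits B m v).length = m + 1 := by
  induction m generalizing v with
  | zero => rfl
  | succ m ih => simp [digits, ih]

/-- The last entry is the whole remaining quotient, so numbers from `B ^ m` on are not confused with
smaller ones. They do occur, since rules refer to the next step and to neighbouring positions. -/
theorem digits_injective (B m : ℕ) : (digits B m).Injective := by
  induction m with
  | zero =>
    intro v v' h
    simpa [digits] using h
  | succ m ih =>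
    intro v v' h
    simp only [digits, List.cons.injEq] at h
    rw [← Nat.div_add_mod v B, ← Nat.div_add_mod v' B, h.1, ih h.2]

/-- All blocks have the same positive length, so their boundaries can be recovered. -/
theorem flatMap_digits_injective (B m : ℕ) :
    (fun l : List ℕ => l.flatMap (digits B m)).Injective := by
  intro l l' h
  induction l generalizing l' with
  | nil =>
    cases l' with
    | nil => rfl
    | cons v l' =>
      simp only [List.flatMap_cons, List.flatMap_nil] at h
      have := congrArg List.length h
      simp only [List.length_append, List.length_nil, length_digits] at this
      omega
  | cons v l ih =>
    cases l' with
    | nil =>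
      simp only [List.flatMap_cons, List.flatMap_nil] at h
      have := congrArg List.length h
      simp only [List.length_append, List.length_nil, length_digits] at this
      omega
    | cons v' l' =>
      simp only [List.flatMap_cons] at h
      obtain ⟨h1, h2⟩ := List.append_inj h (by simp [length_digits])
      rw [digits_injective B m h1, ih h2]

/-- A prefix code: the final `false` delimits each number. -/
def unary (d : ℕ) : Name := List.replicate d true ++ [false]

theorem flatMap_unary_injective : (fun l : List ℕ => l.flatMap unary).Injective := by
  have key : ∀ d d' : ℕ, ∀ s s' : List Bool, unary d ++ s = unary d' ++ s' → d = d' ∧ s = s' := by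
    intro d
    induction d with
    | zero =>
      intro d' s s' h
      cases d' with
      | zero => simpa [unary] using h
      | succ d' => simp [unary, List.replicate_succ] at h
    | succ d ih =>
      intro d' s s' h
      cases d' with
      | zero => simp [unary, List.replicate_succ] at h
      | succ d' =>
        obtain ⟨rfl, rfl⟩ := ih d' s s' (by simpa [unary, List.replicate_succ] using h)
        exact ⟨rfl, rfl⟩
  intro l l' h
  induction l generalizing l' with
  | nil =>
    cases l' with
    | nil => rfl
    | cons d l' => simp [unary] at h
  | cons d l ih =>
    cases l' with
    | nil => simp [unary] at h
    | cons d' l' =>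
      obtain ⟨rfl, h'⟩ := key _ _ _ _ (by simpa only [List.flatMap_cons] using h)
      rw [ih h']

/-! ### The knowledge base of a run -/

namespace Simulation
variable {α : Type} [Finite α] {M : Machine α Bool}

instance : Finite (Tag M) :=
  Finite.of_injective
    (fun a : Tag M => (match a with
      | .state q => .inl q
      | .cell c => .inr (.inl c)
      | .readIn s => .inr (.inr (.inl s))
      | .readWork i x => .inr (.inr (.inr (.inl (i, x))))
      | .sit x => .inr (.inr (.inr (.inr (.inl x))))
      | .goal => .inr (.inr (.inr (.inr (.inr ())))) :
        M.Q ⊕ Option (Content M) ⊕ InSymbol α ⊕ (M.ι × M.Γ) ⊕ Situation M ⊕ Unit))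
    fun a b h => by cases a <;> cases b <;> simp_all

/-- The number of a tag. -/
noncomputable def Tag.code (a : Tag M) : ℕ := Finite.equivFin (Tag M) a

theorem Tag.code_injective : (Tag.code (M := M)).Injective :=
  Fin.val_injective.comp (Finite.equivFin (Tag M)).injective

/-- The concept name of an atom, where numbers are written in base `B` with `m` digits. -/
noncomputable def atomName (B m : ℕ) (a : Atom M) : Name :=
  (a.1.code :: a.2.flatMap (digits B m)).flatMap unary

theorem atomName_injective (B m : ℕ) : (atomName (M := M) B m).Injective := by
  intro a b h
  have h1 := flatMap_unary_injective h
  simp only [List.cons.injEq] at h1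
  exact Prod.ext (Tag.code_injective h1.1) (flatMap_digits_injective B m h1.2)

variable (M) in
/-- The knowledge base that describes the run on `w`. -/
noncomputable def runKB (w : List α) (B m : ℕ) : KB := hornKB (atomName B m) (rules M w (B ^ m))

variable (M) in
noncomputable def goalConcept (B m : ℕ) : Concept := .atom (atomName B m ((Tag.goal, []) : Atom M))

theorem satInMinimalModel_runKB {w : List α} {B m T : ℕ} {b : Bool} (h : M.OutputsIn w [b] T)
    (hN : 2 * T + 1 < B ^ m) :
    SatInMinimalModel.{u} (runKB M w B m) (goalConcept M B m) ↔ b = true := by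
  rw [← goal_mem_truth_iff h]
  refine ⟨mem_of_satInMinimalModel_hornKB (atomName_injective B m) fun r => respects_truth,
    fun hg => satInMinimalModel_hornKB fun S hS => goal_mem_of_respects hS hN h hg⟩

/-- The same word serves both problems, because the knowledge base and the goal lie in EL and the
encoding determines the instance. -/
theorem encodeInstance_runKB_mem {w : List α} {B m T : ℕ} {b : Bool} (h : M.OutputsIn w [b] T)
    (hN : 2 * T + 1 < B ^ m) :
    (encodeInstance (runKB M w B m) (goalConcept M B m) ∈ minModSatELIO.{u} ↔ b = true) ∧
    (encodeInstance (runKB M w B m) (goalConcept M B m) ∈ minModSatEL.{u} ↔ b = true) := by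
  rw [← satInMinimalModel_runKB.{u} h hN]
  refine ⟨⟨?_, fun hs => ⟨_, _, rfl, hs⟩⟩, ⟨?_, fun hs =>
    ⟨_, goalConcept M B m, isEL_hornKB _ _, trivial, rfl, hs⟩⟩⟩
  · rintro ⟨K, C, he, hs⟩
    obtain ⟨rfl, rfl⟩ := encodeInstance_injective he
    exact hs
  · rintro ⟨K, C, -, -, he, hs⟩
    obtain ⟨rfl, rfl⟩ := encodeInstance_injective he
    exact hs

end Simulation
end MinMod

namespace MinMod

/-! ## Programs that print in logarithmic space -/

namespace Prog
variable {α β ι Γ E E' S X : Type}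

/-- Where the input head is, and what the stacks hold. -/
abbrev State (ι Γ : Type) : Type := ℕ × (ι → List Γ)

def State.Valid (w : List α) (L : ℕ) (s : State ι Γ) : Prop :=
  s.1 ≤ w.length + 1 ∧ ∀ i, (s.2 i).length ≤ L

/-- The program stops with result `e`, having taken `s` to `s'` and printed `v`, with stacks of
height at most `L`. -/
def Emits (P : Prog α β ι Γ E) (w : List α) (L : ℕ) (s : State ι Γ) (e : E) (v : List β)
    (s' : State ι Γ) : Prop :=
  ∀ out, ∃ T, P.Runs w (· ≤ L) ⟨s.1, s.2, out⟩ e ⟨s'.1, s'.2, out ++ v⟩ T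

variable {w : List α} {L : ℕ} {s s₁ s' : State ι Γ} {v v' : List β}

theorem Emits.bind [Finite E] {P : Prog α β ι Γ E} {k : E → Prog α β ι Γ E'} {e : E} {e' : E'}
    (h : P.Emits w L s e v s₁) (h' : (k e).Emits w L s₁ e' v' s') :
    (P.bind k).Emits w L s e' (v ++ v') s' := by
  intro out
  obtain ⟨T, hT⟩ := h out
  obtain ⟨T', hT'⟩ := h' (out ++ v)
  rw [← List.append_assoc]
  exact ⟨T + T', hT.bind hT'⟩

theorem Emits.bind_silent [Finite E] {P : Prog α β ι Γ E} {k : E → Prog α β ι Γ E'} {e : E}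
    {e' : E'} (h : P.Emits w L s e [] s₁) (h' : (k e).Emits w L s₁ e' v s') :
    (P.bind k).Emits w L s e' v s' := h.bind h'

theorem Emits.bind_last [Finite E] {P : Prog α β ι Γ E} {k : E → Prog α β ι Γ E'} {e : E}
    {e' : E'} (h : P.Emits w L s e v s₁) (h' : (k e).Emits w L s₁ e' [] s') :
    (P.bind k).Emits w L s e' v s' := by
  simpa using h.bind h'

theorem Emits.loop_exit [Finite S] {body : S → Prog α β ι Γ (S ⊕ E)} {x : S} {e : E}
    (h : (body x).Emits w L s (.inr e) v s') : (loop body x).Emits w L s e v s' := by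
  intro out
  obtain ⟨T, hT⟩ := h out
  exact ⟨T, hT.loop_exit⟩

theorem Emits.loop_next [Finite S] {body : S → Prog α β ι Γ (S ⊕ E)} {x y : S} {e : E}
    (h : (body x).Emits w L s (.inl y) v s₁) (h' : (loop body y).Emits w L s₁ e v' s') :
    (loop body x).Emits w L s e (v ++ v') s' := by
  intro out
  obtain ⟨T, hT⟩ := h out
  obtain ⟨T', hT'⟩ := h' (out ++ v)
  rw [← List.append_assoc]
  exact ⟨T + T', hT.loop_next hT'⟩

theorem emits_act {f : InSymbol α → (ι → Option Γ) → Op ι Γ β × E} {e : E} (o : Op ι Γ β)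
    (h : f (readInput w s.1) (fun i => (s.2 i).head?) = (o, e))
    (hpos : min (o.inMove.apply s.1) (w.length + 1) = s'.1)
    (hstk : ∀ i, (o.stk i).apply (s.2 i) = s'.2 i) (hv : s'.Valid w L) :
    (act f).Emits w L s e o.emit s' := by
  intro out
  refine ⟨1, runs_act (o := o) h ?_ hv.2⟩
  exact Mem.ext hpos (funext hstk) rfl

theorem emits_ret {e : E} (hs : s.Valid w L) :
    (ret e : Prog α β ι Γ E).Emits w L s e [] s :=
  fun out => ⟨1, by rw [List.append_nil]; exact runs_ret hs.1 hs.2⟩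

theorem emits_emit (hs : s.Valid w L) : (emit v : Prog α β ι Γ Unit).Emits w L s () v s :=
  fun _ => ⟨1, runs_emit hs.1 hs.2⟩

/-- Run a program for every element of a list. -/
def forEach (l : List X) (f : X → Prog α β ι Γ Unit) : Prog α β ι Γ Unit :=
  l.foldr (fun x P => (f x).bind fun _ => P) (ret ())

theorem emits_forEach {l : List X} {f : X → Prog α β ι Γ Unit} {g : X → List β}
    (hs : s.Valid w L) (h : ∀ x ∈ l, (f x).Emits w L s () (g x) s) :
    (forEach l f).Emits w L s () (l.flatMap g) s := by
  induction l with
  | nil => exact emits_ret hs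
  | cons x l ih =>
    exact (h x List.mem_cons_self).bind (ih fun y hy => h y (List.mem_cons_of_mem x hy))

/-- Repeat a program until `next` returns `true`. -/
def repeatUntil (body : Prog α β ι Γ Unit) (next : Prog α β ι Γ Bool) : Prog α β ι Γ Unit :=
  loop (S := Unit) (fun _ => body.bind fun _ => next.bind fun b =>
    ret (if b then .inr () else .inl ())) ()

/-- `σ j` is the state before round `j`, and `τ j` the state between the body and the test that ends
the round. -/
theorem emits_repeatUntil {body : Prog α β ι Γ Unit} {next : Prog α β ι Γ Bool} {N : ℕ}
    (hN : 0 < N) {σ τ : ℕ → State ι Γ} {g : ℕ → List β}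
    (hσ : ∀ j ≤ N, (σ j).Valid w L)
    (hbody : ∀ j < N, body.Emits w L (σ j) () (g j) (τ j))
    (hnext : ∀ j < N, next.Emits w L (τ j) (decide (j + 1 = N)) [] (σ (j + 1))) :
    (repeatUntil body next).Emits w L (σ 0) () ((List.range N).flatMap g) (σ N) := by
  suffices h : ∀ d j, j + (d + 1) = N → (repeatUntil body next).Emits w L (σ j) ()
      ((List.range' j (d + 1)).flatMap g) (σ N) by
    obtain ⟨d, rfl⟩ := Nat.exists_eq_succ_of_ne_zero hN.ne'
    rw [List.range_eq_range']
    exact h d 0 (by omega)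
  intro d
  induction d with
  | zero =>
    intro j hj
    have h1 := hnext j (by omega)
    rw [decide_eq_true (by omega)] at h1
    obtain rfl : N = j + 1 := by omega
    have h2 : (repeatUntil body next).Emits w L (σ j) () (g j) (σ (j + 1)) :=
      .loop_exit ((hbody j (by omega)).bind_last (h1.bind_silent (emits_ret (hσ _ le_rfl))))
    simpa using h2
  | succ d ih =>
    intro j hj
    have h1 := hnext j (by omega)
    rw [decide_eq_false (by omega)] at h1
    rw [List.range'_succ, List.flatMap_cons]
    exact .loop_next ((hbody j (by omega)).bind_last
      (h1.bind_silent (emits_ret (hσ _ (by omega))))) (ih (j + 1) (by omega))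

/-! ### Two counters and an auxiliary stack -/

/-- The stacks of a program with an auxiliary stack `none`. -/
def stks (a : List Γ) (F : Bool → List Γ) : Option Bool → List Γ
  | none => a
  | some x => F x

theorem valid_stks {pos : ℕ} {a : List Γ} {F : Bool → List Γ} (hpos : pos ≤ w.length + 1)
    (ha : a.length ≤ L) (hF : ∀ x, (F x).length ≤ L) :
    State.Valid w L (pos, stks a F) :=
  ⟨hpos, fun i => by cases i; exacts [ha, hF _]⟩

theorem emits_pour_back {pos : ℕ} {a : List Γ} {F : Bool → List Γ} {i : Bool}
    (hpos : pos ≤ w.length + 1) (ha : a.length + (F i).length ≤ L) (hF : ∀ x, (F x).length ≤ L) :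
    (pour none (some i) : Prog α β (Option Bool) Γ Unit).Emits w L (pos, stks a F) () []
      (pos, stks [] (Function.update F i (a.reverse ++ F i))) := by
  intro out
  refine ⟨_, runs_pour (by simp) hpos (valid_stks hpos (by omega) hF).2 ?_ rfl (by simp) rfl ?_ ?_⟩
  · exact fun k hk => hk.trans ha
  · simp [stks]
  · intro k h h'
    cases k with
    | none => exact absurd rfl h
    | some x =>
      have : x ≠ i := fun hx => h' (congrArg some hx)
      simp [stks, this]

section
variable {b : ℕ}

/-- The `m` last digits of a number in base `q`, as symbols. -/
def cells (b q : ℕ) : ℕ → ℕ → List (Fin (b + 2))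
  | 0, _ => []
  | m + 1, v => Fin.ofNat (b + 2) (v % q) :: cells b q m (v / q)

theorem length_cells (q m v : ℕ) : (cells b q m v).length = m := by
  induction m generalizing v with
  | zero => rfl
  | succ m ih => simp [cells, ih]

theorem cells_zero (q m : ℕ) : cells b q m 0 = List.replicate m 0 := by
  induction m with
  | zero => rfl
  | succ m ih => simp [cells, ih, List.replicate_succ]

theorem cells_pow {q : ℕ} (hq : 0 < q) (m : ℕ) : cells b q m (q ^ m) = cells b q m 0 := by
  induction m with
  | zero => rfl
  | succ m ih => simp [cells, ih, pow_succ, hq]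

/-- Add one to the counter `i`, up to the point where there is no further carry. The digits that
have
been changed are moved to the auxiliary stack. The result tells whether there is a carry left. -/
def carry (q : ℕ) (i : Bool) : Prog α β (Option Bool) (Fin (b + 2)) Bool :=
  loop (S := Unit) (fun _ => act fun _ t => match t (some i) with
    | some d => if d.val + 1 = q
      then (onStk fun k => if k = some i then .pop else if k = none then .push 0 else .keep, .inl
          ())
      else (onStk fun k => if k = some i then .pop else
        if k = none then .push (Fin.ofNat (b + 2) (d.val + 1)) else .keep, .inr false)
    | none => (nop, .inr true)) ()

/-- The altered low digits lie reversed in `c`, the untouched high digits in `r`. The carry leaves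
the counter exactly when all digits were `q - 1`, that is when `q ^ m` divides `v + 1`, and then all
digits have been moved. `a` holds the digits altered earlier. -/
theorem emits_carry {q : ℕ} (hq : 2 ≤ q) (hqb : q ≤ b + 2) {pos m : ℕ} {i : Bool}
    (hpos : pos ≤ w.length + 1) {a : List (Fin (b + 2))} {F : Bool → List (Fin (b + 2))} {v : ℕ}
    (hi : F i = cells b q m v) (hF : ∀ x, (F x).length ≤ L) (ha : a.length + m ≤ L) :
    ∃ c r, c.reverse ++ r = a.reverse ++ cells b q m (v + 1) ∧
      (q ^ m ∣ v + 1 → r = []) ∧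
      (carry q i : Prog α β (Option Bool) (Fin (b + 2)) Bool).Emits w L (pos, stks a F)
        (decide (q ^ m ∣ v + 1)) [] (pos, stks c (Function.update F i r)) := by
  induction m generalizing a F v with
  | zero =>
    refine ⟨a, [], by simp [cells], fun _ => rfl, ?_⟩
    have : Function.update F i [] = F := by
      rw [show [] = F i from hi.symm, Function.update_eq_self]
    rw [this, decide_eq_true (by simp)]
    refine .loop_exit (emits_act nop ?_ (by simpa [nop, Move.apply] using hpos) (fun k => rfl)
      (valid_stks hpos (by omega) hF))
    simp [stks, hi, cells]
  | succ m ih =>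
    have hd : (Fin.ofNat (b + 2) (v % q)).val = v % q :=
      Nat.mod_eq_of_lt ((Nat.mod_lt _ (by omega)).trans_le hqb)
    have hv := Nat.div_add_mod v q
    have hFv : ∀ l : List (Fin (b + 2)), l.length ≤ L →
        ∀ x, (Function.update F i l x).length ≤ L := by
      intro l hl x
      by_cases hx : x = i
      · subst hx
        simpa using hl
      · simpa [hx] using hF x
    have hstk : ∀ (y : Fin (b + 2)) (k : Option Bool),
        ((if k = some i then .pop else if k = none then .push y else .keep : StkOp _).apply
          (stks a F k)) = stks (y :: a) (Function.update F i (cells b q m (v / q))) k := by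
      intro y k
      cases k with
      | none => simp [stks, StkOp.apply]
      | some x =>
        by_cases hx : x = i
        · subst hx
          simp [stks, StkOp.apply, hi, cells]
        · simp [stks, StkOp.apply, hx]
    by_cases h : v % q + 1 = q
    · have hv1 : v + 1 = q * (v / q + 1) := by
        rw [mul_add, mul_one]
        omega
      have hdiv : (v + 1) / q = v / q + 1 := by
        rw [hv1, Nat.mul_div_cancel_left _ (by omega)]
      have hmod : (v + 1) % q = 0 := by
        rw [hv1, Nat.mul_mod_right]
      obtain ⟨c, r, h1, h2, h3⟩ := ih (a := 0 :: a)
        (F := Function.update F i (cells b q m (v / q))) (v := v / q) (by simp)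
        (hFv _ (by rw [length_cells]; omega)) (by simp; omega)
      have hiff : q ^ (m + 1) ∣ v + 1 ↔ q ^ m ∣ v / q + 1 := by
        rw [hv1, pow_succ', Nat.mul_dvd_mul_iff_left (by omega)]
      refine ⟨c, r, ?_, fun hdvd => h2 (hiff.1 hdvd), ?_⟩
      · rw [h1]
        simp [cells, hdiv, hmod]
      · rw [decide_eq_decide.2 hiff]
        rw [Function.update_idem] at h3
        refine .loop_next (v := [])
          (s₁ := (pos, stks (0 :: a) (Function.update F i (cells b q m (v / q)))))
          (emits_act (onStk fun k => if k = some i then .pop else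
          if k = none then .push 0 else .keep) ?_ (by simpa [onStk, Move.apply] using hpos)
          (hstk 0) (valid_stks hpos (by simp; omega) (hFv _ (by rw [length_cells]; omega)))) h3
        simp only [stks, hi, cells, List.head?_cons, hd, if_pos h]
    · have hlt : v % q + 1 < q := by
        have := Nat.mod_lt v (by omega : q > 0)
        omega
      have hv1 : v + 1 = (v % q + 1) + q * (v / q) := by omega
      have hdiv : (v + 1) / q = v / q := by
        rw [hv1, Nat.add_mul_div_left _ _ (by omega), Nat.div_eq_of_lt hlt, zero_add]
      have hmod : (v + 1) % q = v % q + 1 := by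
        rw [hv1, Nat.add_mul_mod_self_left, Nat.mod_eq_of_lt hlt]
      have hn : ¬ q ^ (m + 1) ∣ v + 1 := by
        intro hdvd
        have := Nat.mod_eq_zero_of_dvd ((Dvd.intro_left _ (pow_succ q m).symm).trans hdvd)
        omega
      refine ⟨Fin.ofNat (b + 2) (v % q + 1) :: a, cells b q m (v / q), ?_,
        fun hdvd => absurd hdvd hn, ?_⟩
      · simp [cells, hdiv, hmod]
      · rw [decide_eq_false hn]
        refine .loop_exit (emits_act (onStk fun k => if k = some i then .pop else
          if k = none then .push (Fin.ofNat (b + 2) (v % q + 1)) else .keep) ?_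
          (by simpa [onStk, Move.apply] using hpos) (hstk _)
          (valid_stks hpos (by simp; omega) (hFv _ (by rw [length_cells]; omega))))
        simp only [stks, hi, cells, List.head?_cons, hd, if_neg h]

/-- Add one to the counter `i`. The result tells whether the counter is `0` afterwards. -/
def increment (i : Bool) : Prog α β (Option Bool) (Fin (b + 2)) Bool :=
  (carry (b + 2) i).bind fun e => (pour none (some i)).bind fun _ => ret e

/-- Both counters have `m` digits. -/
def counters (b m pos : ℕ) (V : Bool → ℕ) : State (Option Bool) (Fin (b + 2)) :=
  (pos, stks [] fun x => cells b (b + 2) m (V x))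

theorem valid_counters {m pos : ℕ} (hpos : pos ≤ w.length + 1) (hm : m ≤ L) (V : Bool → ℕ) :
    (counters b m pos V).Valid w L :=
  valid_stks hpos (Nat.zero_le _) fun x => by rwa [length_cells]

theorem emits_increment {m pos : ℕ} (hpos : pos ≤ w.length + 1) (hm : m ≤ L) (V : Bool → ℕ)
    (i : Bool) :
    (increment i : Prog α β (Option Bool) (Fin (b + 2)) Bool).Emits w L (counters b m pos V)
      (decide ((b + 2) ^ m ∣ V i + 1)) []
      (counters b m pos (Function.update V i (V i + 1))) := by
  obtain ⟨c, r, h1, -, h2⟩ := emits_carry (α := α) (β := β) (w := w) (L := L) (q := b + 2)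
    (b := b) (by omega) le_rfl hpos
    (i := i) (a := []) (F := fun x => cells b (b + 2) m (V x)) (v := V i) rfl
    (fun x => by rwa [length_cells]) (by simpa using hm)
  rw [List.reverse_nil, List.nil_append] at h1
  have hlen := congrArg List.length h1
  rw [List.length_append, List.length_reverse, length_cells] at hlen
  have h3 : ∀ x, (Function.update (fun x => cells b (b + 2) m (V x)) i r x).length ≤ L := by
    intro x
    by_cases hx : x = i
    · subst hx
      simp only [Function.update_self]
      omega
    · simpa [hx, length_cells] using hm
  have h4 := emits_pour_back (α := α) (β := β) (w := w) (L := L) (a := c) (i := i) hpos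
    (by simp only [Function.update_self]; omega) h3
  rw [Function.update_self, h1, Function.update_idem] at h4
  have h5 : (fun x => cells b (b + 2) m (Function.update V i (V i + 1) x)) =
      Function.update (fun x => cells b (b + 2) m (V x)) i (cells b (b + 2) m (V i + 1)) := by
    funext x
    by_cases hx : x = i
    · subst hx
      simp
    · simp [hx]
  rw [counters, counters, h5]
  refine h2.bind_silent (h4.bind_silent (emits_ret ?_))
  rw [← h5]
  exact valid_counters hpos hm _

/-- Run a program for all values of the counter `i`, which is `0` at the beginning. -/
def forAll (i : Bool) (body : Prog α β (Option Bool) (Fin (b + 2)) Unit) :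
    Prog α β (Option Bool) (Fin (b + 2)) Unit :=
  repeatUntil body (increment i)

/-- The body may move the input head, which `p` records. Since the counter is `0` again at the end,
loops can be nested. -/
theorem emits_forAll {m : ℕ} (hm : m ≤ L) {i : Bool}
    {body : Prog α β (Option Bool) (Fin (b + 2)) Unit} {V : Bool → ℕ} (hV : V i = 0)
    {p : ℕ → ℕ} (hp : ∀ j, p j ≤ w.length + 1) {g : ℕ → List β}
    (h : ∀ j < (b + 2) ^ m, body.Emits w L (counters b m (p j) (Function.update V i j)) () (g j)
      (counters b m (p (j + 1)) (Function.update V i j))) :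
    (forAll i body).Emits w L (counters b m (p 0) V) () ((List.range ((b + 2) ^ m)).flatMap g)
      (counters b m (p ((b + 2) ^ m)) V) := by
  have h1 := emits_repeatUntil (body := body) (next := increment i) (w := w) (L := L)
    (N := (b + 2) ^ m) (by positivity)
    (σ := fun j => counters b m (p j) (Function.update V i j))
    (τ := fun j => counters b m (p (j + 1)) (Function.update V i j))
    (fun j _ => valid_counters (hp j) hm _) h (fun j hj => ?_)
  · have h2 : counters b m (p ((b + 2) ^ m)) (Function.update V i ((b + 2) ^ m)) =
        counters b m (p ((b + 2) ^ m)) V := by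
      rw [counters, counters]
      congr 2
      funext x
      by_cases hx : x = i
      · subst hx
        simp [cells_pow, hV]
      · simp [hx]
    have h3 : Function.update V i 0 = V := by
      rw [← hV, Function.update_eq_self]
    simp only [h2, h3] at h1
    exact h1
  · have h2 := emits_increment (α := α) (β := β) (b := b) (w := w) (L := L) (m := m)
      (hp (j + 1)) hm (Function.update V i j) i
    simp only [Function.update_self, Function.update_idem] at h2
    -- As `j + 1` is positive and within range, it is divisible by the modulus only in the last
    -- round.
    have h3 : (b + 2) ^ m ∣ j + 1 ↔ j + 1 = (b + 2) ^ m :=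
      ⟨fun hd => le_antisymm hj (Nat.le_of_dvd (Nat.succ_pos _) hd), fun he => he ▸ dvd_rfl⟩
    rwa [decide_eq_decide.2 h3] at h2

/-- Print the digits of the counter `i` plus `c`. -/
def emitSum (code : ℕ → List β) (i : Bool) (c : Fin 3) :
    Prog α β (Option Bool) (Fin (b + 2)) Unit :=
  (loop (S := Fin 3) (fun c => act fun _ t => match t (some i) with
    | some d => (⟨.stay, fun k => if k = some i then .pop else if k = none then .push d else .keep,
        code ((d.val + c.val) % (b + 2))⟩, .inl (Fin.ofNat 3 ((d.val + c.val) / (b + 2))))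
    | none => (⟨.stay, fun _ => .keep, code c.val⟩, .inr ())) c).bind fun _ => pour none (some i)

/-- The summand `c` is the initial carry, and the carry is updated while the unchanged digits move
to the auxiliary stack and back. The carry that is left at the end is the last entry of `digits`. -/
theorem emits_emitSum {code : ℕ → List β} {m pos : ℕ} (hpos : pos ≤ w.length + 1) (hm : m ≤ L)
    {V : Bool → ℕ} {i : Bool} (hi : V i < (b + 2) ^ m) (c : Fin 3) :
    (emitSum code i c : Prog α β (Option Bool) (Fin (b + 2)) Unit).Emits w L (counters b m pos V)
      () ((digits (b + 2) m (V i + c)).flatMap code) (counters b m pos V) := by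
  suffices key : ∀ (k : ℕ) (a : List (Fin (b + 2))) (F : Bool → List (Fin (b + 2))) (v : ℕ)
      (c : Fin 3), v < (b + 2) ^ k → F i = cells b (b + 2) k v → (∀ x, (F x).length ≤ L) →
      a.length + k ≤ L →
      (loop (S := Fin 3) (fun c => act fun _ t => match t (some i) with
        | some d => (⟨.stay, fun k => if k = some i then .pop else if k = none then .push d else
            .keep,
            code ((d.val + c.val) % (b + 2))⟩, .inl (Fin.ofNat 3 ((d.val + c.val) / (b + 2))))
        | none => (⟨.stay, fun _ => .keep, code c.val⟩, .inr ())) c :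
        Prog α β (Option Bool) (Fin (b + 2)) Unit).Emits w L (pos, stks a F) ()
        ((digits (b + 2) k (v + c)).flatMap code)
        (pos, stks ((cells b (b + 2) k v).reverse ++ a) (Function.update F i [])) by
    have h1 := key m [] (fun x => cells b (b + 2) m (V x)) (V i) c hi rfl
      (fun x => by rwa [length_cells]) (by simpa using hm)
    have h2 := emits_pour_back (α := α) (β := β) (w := w) (L := L) (i := i) (pos := pos)
      (a := (cells b (b + 2) m (V i)).reverse ++ [])
      (F := Function.update (fun x => cells b (b + 2) m (V x)) i []) hpos
      (by simpa [length_cells] using hm) (fun x => by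
        by_cases hx : x = i
        · subst hx
          simp
        · simpa [hx, length_cells] using hm)
    rw [Function.update_self, Function.update_idem, List.append_nil, List.append_nil,
      List.reverse_reverse, Function.update_eq_self i (fun x => cells b (b + 2) m (V x))] at h2
    rw [List.append_nil] at h1
    exact h1.bind_last h2
  intro k
  induction k with
  | zero =>
    intro a F v c hv hF hL ha
    have hF' : Function.update F i [] = F := by
      rw [show [] = F i from hF.symm, Function.update_eq_self]
    obtain rfl : v = 0 := by simpa using hv
    rw [hF', show (digits (b + 2) 0 (0 + c)).flatMap code = code c by simp [digits]]
    refine .loop_exit (emits_act ⟨.stay, fun _ => .keep, code c.val⟩ ?_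
      (by simpa [Move.apply] using hpos) (fun k => rfl) (valid_stks hpos (by simpa [cells] using
          ha) hL))
    simp [stks, hF, cells]
  | succ k ih =>
    intro a F v c hv hF hL ha
    have hd : (Fin.ofNat (b + 2) (v % (b + 2))).val = v % (b + 2) :=
      Nat.mod_eq_of_lt (Nat.mod_lt _ (by omega))
    -- The carry stays below `3`, so no reduction takes place in `Fin 3`.
    have hc : (Fin.ofNat 3 ((v % (b + 2) + c.val) / (b + 2))).val =
        (v % (b + 2) + c.val) / (b + 2) := by
      refine Nat.mod_eq_of_lt (Nat.div_lt_of_lt_mul ?_)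
      have := Nat.mod_lt v (by omega : b + 2 > 0)
      have := c.isLt
      omega
    have hdiv : (v + c) / (b + 2) = v / (b + 2) + (v % (b + 2) + c) / (b + 2) := by
      conv_lhs => rw [← Nat.div_add_mod v (b + 2), add_assoc]
      rw [Nat.mul_add_div (by omega)]
    have hF1 : ∀ x, (Function.update F i (cells b (b + 2) k (v / (b + 2))) x).length ≤ L := by
      intro x
      by_cases hx : x = i
      · subst hx
        simp only [Function.update_self, length_cells]
        omega
      · simpa [hx] using hL x
    have h1 := ih (Fin.ofNat (b + 2) (v % (b + 2)) :: a)
      (Function.update F i (cells b (b + 2) k (v / (b + 2)))) (v / (b + 2))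
      (Fin.ofNat 3 ((v % (b + 2) + c.val) / (b + 2)))
      (Nat.div_lt_of_lt_mul (by rwa [← pow_succ'])) (by simp) hF1 (by simp; omega)
    rw [Function.update_idem, hc, ← hdiv] at h1
    have h2 : (digits (b + 2) (k + 1) (v + c)).flatMap code =
        code ((v % (b + 2) + c) % (b + 2)) ++
          (digits (b + 2) k ((v + c) / (b + 2))).flatMap code := by
      simp [digits]
    rw [h2, show (cells b (b + 2) (k + 1) v).reverse ++ a =
      (cells b (b + 2) k (v / (b + 2))).reverse ++ Fin.ofNat (b + 2) (v % (b + 2)) :: a by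
        simp [cells]]
    refine .loop_next (emits_act ⟨.stay, fun k => if k = some i then .pop else
      if k = none then .push (Fin.ofNat (b + 2) (v % (b + 2))) else .keep,
      code ((v % (b + 2) + c.val) % (b + 2))⟩ ?_ (by simpa [Move.apply] using hpos) ?_
      (valid_stks hpos (by simp; omega) hF1)) h1
    · simp only [stks, hF, cells, List.head?_cons, hd]
    · intro k
      cases k with
      | none => simp [stks, StkOp.apply]
      | some x =>
        by_cases hx : x = i
        · subst hx
          simp [stks, StkOp.apply, hF, cells]
        · simp [stks, StkOp.apply, hx]

end

end Prog
end MinMod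

namespace MinMod

namespace Prog
variable {α β : Type} {b : ℕ} {w : List α} {L : ℕ}

/-! ### Counters with as many digits as the length of the input has in binary -/

/-- `cells` starts with the least significant digit; this splits off the most significant one, which
is the digit that appears when a binary number gets longer. -/
theorem cells_succ_eq_append (q m v : ℕ) :
    cells b q (m + 1) v = cells b q m v ++ [Fin.ofNat (b + 2) (v / q ^ m % q)] := by
  induction m generalizing v with
  | zero => simp [cells]
  | succ m ih =>
    rw [cells, ih, cells, Nat.div_div_eq_div_mul, ← pow_succ', List.cons_append]

/-- The first counter holds a number in binary without leading zeros; the second one is empty. -/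
def binary (b pos v : ℕ) : State (Option Bool) (Fin (b + 2)) :=
  (pos, stks [] (Function.update (fun _ => []) false (cells b 2 (Nat.log 2 v + 1) v)))

theorem length_update_nil_le {Γ : Type} {l : List Γ} (hl : l.length ≤ L) (i x : Bool) :
    (Function.update (fun _ => []) i l x).length ≤ L := by
  by_cases hx : x = i
  · subst hx
    simpa using hl
  · simp [hx]

theorem valid_binary {pos v : ℕ} (hpos : pos ≤ w.length + 1) (hv : Nat.log 2 v + 1 ≤ L) :
    (binary b pos v).Valid w L :=
  valid_stks hpos (Nat.zero_le _) (length_update_nil_le (by rwa [length_cells]) _)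

/-- Add one to a number in binary. -/
def incrementBinary : Prog α β (Option Bool) (Fin (b + 2)) Unit :=
  (carry 2 false).bind fun e => (pushes (some false) (if e then [1] else [])).bind fun _ =>
    pour none (some false)

/-- A carry is left exactly if `v + 1` is the next power of two. All digits are then zeros on the
auxiliary stack, and a leading `1` is placed below them. -/
theorem emits_incrementBinary {pos v : ℕ} (hpos : pos ≤ w.length + 1)
    (hv : Nat.log 2 (v + 1) + 1 ≤ L) :
    (incrementBinary : Prog α β (Option Bool) (Fin (b + 2)) Unit).Emits w L (binary b pos v) () []
      (binary b pos (v + 1)) := by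
  have hle : Nat.log 2 v ≤ Nat.log 2 (v + 1) := Nat.log_mono_right (Nat.le_succ v)
  have hlt : v < 2 ^ (Nat.log 2 v + 1) := Nat.lt_pow_succ_log_self (by omega) v
  obtain ⟨c, r, h1, h2, h3⟩ := emits_carry (α := α) (β := β) (w := w) (L := L) (q := 2) (b := b)
    le_rfl (by omega) hpos (i := false) (a := [])
    (F := Function.update (fun _ => []) false (cells b 2 (Nat.log 2 v + 1) v)) (v := v)
    (m := Nat.log 2 v + 1) (by simp) (length_update_nil_le (by rw [length_cells]; omega) _)
    (by simp; omega)
  rw [List.reverse_nil, List.nil_append] at h1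
  rw [Function.update_idem] at h3
  have hlen := congrArg List.length h1
  rw [List.length_append, List.length_reverse, length_cells] at hlen
  obtain ⟨l, hl, h4⟩ : ∃ l, l = (if decide (2 ^ (Nat.log 2 v + 1) ∣ v + 1) then
      [(1 : Fin (b + 2))] else []) ∧
      c.reverse ++ (l ++ r) = cells b 2 (Nat.log 2 (v + 1) + 1) (v + 1) := by
    refine ⟨_, rfl, ?_⟩
    by_cases hd : 2 ^ (Nat.log 2 v + 1) ∣ v + 1
    · have he : v + 1 = 2 ^ (Nat.log 2 v + 1) :=
        le_antisymm hlt (Nat.le_of_dvd (Nat.succ_pos _) hd)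
      have hlog : Nat.log 2 (v + 1) = Nat.log 2 v + 1 := by
        conv_lhs => rw [he, Nat.log_pow (by omega)]
      rw [hlog, cells_succ_eq_append, ← h1, h2 hd, ← he, Nat.div_self (by omega)]
      simp
      rfl
    · have hlog : Nat.log 2 (v + 1) = Nat.log 2 v := by
        refine Nat.log_eq_of_pow_le_of_lt_pow ?_ ?_
        · rcases Nat.eq_zero_or_pos v with rfl | hpos
          · simp
          · exact (Nat.pow_log_le_self 2 hpos.ne').trans (Nat.le_succ v)
        · exact lt_of_le_of_ne hlt fun he => hd (he ▸ dvd_rfl)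
      rw [hlog, ← h1]
      simp [hd]
  have h5 := congrArg List.length h4
  simp only [List.length_append, List.length_reverse, length_cells] at h5
  have h6 : (pushes (some false) l : Prog α β (Option Bool) (Fin (b + 2)) Unit).Emits w L
      (pos, stks c (Function.update (fun _ => []) false r)) () []
      (pos, stks c (Function.update (fun _ => []) false (l ++ r))) := by
    intro out
    refine ⟨_, runs_pushes hpos (valid_stks hpos (by omega)
      (length_update_nil_le (by omega) _)).2 ?_ rfl (by simp) (by simp [stks]) ?_⟩
    · intro k hk
      simp only [stks, Function.update_self] at hk
      omega
    · intro k hk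
      cases k with
      | none => rfl
      | some x =>
        have : x ≠ false := fun hx => hk (congrArg some hx)
        simp [stks, this]
  have h7 := emits_pour_back (α := α) (β := β) (w := w) (L := L) (a := c) (i := false)
    (F := Function.update (fun _ => []) false (l ++ r)) hpos
    (by simp only [Function.update_self, List.length_append]; omega)
    (length_update_nil_le (by simp only [List.length_append]; omega) _)
  rw [Function.update_self, h4, Function.update_idem] at h7
  refine h3.bind_silent (.bind_silent (e := ()) ?_ h7)
  rw [← hl]
  exact h6

/-- Add the length of the input to a number in binary, starting on the first letter. -/
def countInput : Prog α β (Option Bool) (Fin (b + 2)) Unit :=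
  loop (S := Unit) (fun _ => (act fun s _ => match s with
    | .rightEnd => (nop, false)
    | _ => (onInput .right, true)).bind fun e =>
      (if e then incrementBinary else ret ()).bind fun _ => ret (if e then .inl () else .inr ())) ()

/-- With the head on cell `j + 1`, exactly `j` letters have been counted, so the counter never needs
more digits than the final length. -/
theorem emits_countInput (hL : Nat.log 2 w.length + 1 ≤ L) {j : ℕ} (hj : j ≤ w.length) :
    (countInput : Prog α β (Option Bool) (Fin (b + 2)) Unit).Emits w L (binary b (j + 1) j) () []
      (binary b (w.length + 1) w.length) := by
  obtain ⟨d, hd⟩ := Nat.exists_eq_add_of_le hj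
  induction d generalizing j with
  | zero =>
    obtain rfl : j = w.length := by omega
    have hval : (binary b (w.length + 1) w.length).Valid w L := valid_binary le_rfl hL
    refine .loop_exit (.bind_silent (e := false) (s₁ := binary b (w.length + 1) w.length)
      (emits_act nop ?_ (by simp [nop, Move.apply, binary]) (fun k => rfl) hval)
      (.bind_silent (emits_ret hval) (emits_ret hval)))
    dsimp only [binary]
    rw [readInput_eq_rightEnd.2 le_rfl]
  | succ d ih =>
    have hlog : ∀ i ≤ w.length, Nat.log 2 i + 1 ≤ L := fun i hi =>
      (Nat.succ_le_succ (Nat.log_mono_right hi)).trans hL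
    have hne : readInput w (j + 1) ≠ .rightEnd := by
      rw [Ne, readInput_eq_rightEnd]
      omega
    refine .loop_next (v := []) (.bind_silent (e := true) (s₁ := binary b (j + 1 + 1) j)
      (emits_act (onInput .right) ?_ ?_ (fun k => rfl)
      (valid_binary (by omega) (hlog j hj))) (.bind_silent (e := ())
        (emits_incrementBinary (by omega) (hlog _ (by omega)))
        (emits_ret (valid_binary (by omega) (hlog _ (by omega)))))) (ih (by omega) (by omega))
    · dsimp only [binary]
      split
      · contradiction
      · rfl
    · simp [onInput, Move.apply, binary]
      omega

/-- Replace the digits of the first counter by zeros, which are put on the auxiliary stack. -/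
def zeros : Prog α β (Option Bool) (Fin (b + 2)) Unit :=
  loop (S := Unit) (fun _ => act fun _ t => match t (some false) with
    | some _ => (onStk fun k => if k = some false then .pop else if k = none then .push 0 else
        .keep,
        .inl ())
    | none => (nop, .inr ())) ()

theorem emits_zeros {pos : ℕ} (hpos : pos ≤ w.length + 1) {l a : List (Fin (b + 2))}
    (hl : l.length + a.length ≤ L) :
    (zeros : Prog α β (Option Bool) (Fin (b + 2)) Unit).Emits w L
      (pos, stks a (Function.update (fun _ => []) false l)) () []
      (pos, stks (List.replicate l.length 0 ++ a) fun _ => []) := by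
  induction l generalizing a with
  | nil =>
    refine .loop_exit (emits_act nop ?_ (by simpa [nop, Move.apply] using hpos) ?_
      (valid_stks hpos (by simpa using hl) fun _ => Nat.zero_le _))
    · simp [stks]
    · intro k
      cases k with
      | none => rfl
      | some x => cases x <;> rfl
  | cons y l ih =>
    rw [List.length_cons] at hl
    have h := ih (a := 0 :: a) (by simp; omega)
    rw [show List.replicate l.length 0 ++ 0 :: a = List.replicate (y :: l).length 0 ++ a by
      rw [List.length_cons, List.replicate_succ', List.append_assoc]; rfl] at h
    refine .loop_next (v := []) (s₁ := (pos, stks (0 :: a) (Function.update (fun _ => []) false l)))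
      (emits_act (onStk fun k => if k = some false then .pop else
        if k = none then .push 0 else .keep) ?_ (by simpa [onStk, Move.apply] using hpos) ?_
        (valid_stks hpos (by simp; omega) (length_update_nil_le (by omega) _))) h
    · simp [stks]
    · intro k
      cases k with
      | none => rfl
      | some x => cases x <;> rfl

/-- Move the content of the auxiliary stack to both counters. -/
def distribute : Prog α β (Option Bool) (Fin (b + 2)) Unit :=
  loop (S := Unit) (fun _ => act fun _ t => match t none with
    | some d => (onStk fun k => if k = none then .pop else .push d, .inl ())
    | none => (nop, .inr ())) ()

theorem emits_distribute {pos : ℕ} (hpos : pos ≤ w.length + 1) {a l : List (Fin (b + 2))}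
    (hl : a.length + l.length ≤ L) :
    (distribute : Prog α β (Option Bool) (Fin (b + 2)) Unit).Emits w L
      (pos, stks a fun _ => l) () [] (pos, stks [] fun _ => a.reverse ++ l) := by
  induction a generalizing l with
  | nil =>
    exact .loop_exit (emits_act nop (by simp [stks]) (by simpa [nop, Move.apply] using hpos)
      (fun k => rfl) (valid_stks hpos (Nat.zero_le _) fun _ => by simpa using hl))
  | cons d a ih =>
    rw [List.length_cons] at hl
    have h := ih (l := d :: l) (by simp; omega)
    rw [show a.reverse ++ d :: l = (d :: a).reverse ++ l by simp] at h
    refine .loop_next (v := []) (s₁ := (pos, stks a fun _ => d :: l))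
      (emits_act (onStk fun k => if k = none then .pop else .push d) (by simp [stks])
        (by simpa [onStk, Move.apply] using hpos) ?_
        (valid_stks hpos (by omega) fun _ => by simp; omega)) h
    intro k
    cases k <;> rfl

/-- Initialize the counters, where the number of their digits is the length of the input in binary.
-/
def setCounters : Prog α β (Option Bool) (Fin (b + 2)) Unit :=
  -- The binary counter starts as the number `0` with one digit, in line with `Nat.log 2 0 + 1 = 1`,
  -- and the head moves to the first letter.
  (act fun _ _ => (⟨.right, fun k => if k = some false then .push 0 else .keep, []⟩, ())).bind
    fun _ => countInput.bind fun _ => zeros.bind fun _ => distribute.bind fun _ =>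
      rewind.bind fun _ => act fun _ _ => (onInput .left, ())

theorem emits_setCounters :
    (setCounters : Prog α β (Option Bool) (Fin (b + 2)) Unit).Emits w (Nat.log 2 w.length + 1)
      (0, fun _ => []) () [] (counters b (Nat.log 2 w.length + 1) 0 fun _ => 0) := by
  refine .bind_silent (s₁ := binary b (0 + 1) 0) (emits_act
    ⟨.right, fun k => if k = some false then .push 0 else .keep, []⟩ rfl (by simp [Move.apply,
        binary])
    ?_ (valid_binary (by omega) (by simp))) ?_
  · intro k
    cases k with
    | none => rfl
    | some x => cases x <;> simp [binary, stks, StkOp.apply, cells]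
  refine .bind_silent (emits_countInput le_rfl (Nat.zero_le _)) ?_
  -- From here on only the number of digits of the length matters; it becomes the number of digits
  -- of both counters.
  refine .bind_silent (emits_zeros le_rfl (by simp [length_cells])) ?_
  rw [length_cells, List.append_nil]
  refine .bind_silent (emits_distribute le_rfl (by simp)) ?_
  rw [List.reverse_replicate, List.append_nil]
  have hv : ∀ pos ≤ w.length + 1, State.Valid w (Nat.log 2 w.length + 1)
      (pos, stks [] fun _ => List.replicate (Nat.log 2 w.length + 1) (0 : Fin (b + 2))) :=
    fun pos hpos => valid_stks hpos (Nat.zero_le _) fun _ => by simp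
  refine .bind_silent (e := ()) (s₁ := (1, stks [] fun _ => List.replicate (Nat.log 2 w.length + 1)
      0))
    (fun out => ⟨w.length + 1 + 1, ?_⟩) ?_
  · rw [List.append_nil]
    exact runs_rewind le_rfl (hv _ le_rfl).2
  · simp only [counters, cells_zero]
    exact emits_act (onInput .left) rfl (by simp [onInput, Move.apply]) (fun k => rfl)
      (hv _ (Nat.zero_le _))

end Prog
end MinMod

namespace MinMod

/-! ## The reduction -/

namespace Simulation
open Prog
variable {α : Type} [Finite α] {M : Machine α Bool} {b m L : ℕ} {w : List α}

/-- The values of the two counters. -/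
def vals (t k : ℕ) : Bool → ℕ := fun x => if x then k else t

theorem update_vals_true (t k j : ℕ) : Function.update (vals t k) true j = vals t j := by
  funext x
  cases x <;> simp [vals]

theorem update_vals_false (t k j : ℕ) : Function.update (vals t k) false j = vals j k := by
  funext x
  cases x <;> simp [vals]

def unaryTokens (d : ℕ) : List Token := (unary d).map .bit

/-- Print the concept name of an atom. -/
noncomputable def emitAtom (b : ℕ) (a : AtomSchema M) :
    Prog α Token (Option Bool) (Fin (b + 2)) Unit :=
  (emit (.atom :: unaryTokens a.1.code)).bind fun _ =>
    (forEach a.2 fun x => emitSum unaryTokens x.1 x.2).bind fun _ => emit [Token.endName]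

theorem emits_emitAtom {pos t k : ℕ} (hpos : pos ≤ w.length + 1) (hm : m ≤ L)
    (ht : t < (b + 2) ^ m) (hk : k < (b + 2) ^ m) (a : AtomSchema M) :
    (emitAtom b a : Prog α Token _ _ _).Emits w L (counters b m pos (vals t k)) ()
      (Concept.atom (atomName (b + 2) m (a.inst t k))).encode (counters b m pos (vals t k)) := by
  have hv : (counters b m pos (vals t k)).Valid w L := valid_counters hpos hm _
  have h1 := (emits_emit (β := Token) (v := .atom :: unaryTokens a.1.code) hv).bind
    (k := fun _ => (forEach a.2 fun x => emitSum unaryTokens x.1 x.2).bind fun _ => emit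
        [Token.endName])
    ((emits_forEach hv fun x _ => emits_emitSum (code := unaryTokens) hpos hm (V := vals t k)
      (i := x.1) (by unfold vals; split <;> assumption) x.2).bind
        (emits_emit (v := [Token.endName]) hv))
  have h2 : (Concept.atom (atomName (b + 2) m (a.inst t k))).encode =
      .atom :: unaryTokens a.1.code ++ ((a.2.flatMap fun x =>
        (digits (b + 2) m (vals t k x.1 + x.2)).flatMap unaryTokens) ++ [.endName]) := by
    simp only [Concept.encode, encodeName, atomName, AtomSchema.inst, List.flatMap_cons,
      List.map_append, List.map_flatMap, List.flatMap_map, List.flatMap_assoc, List.cons_append,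
      List.append_assoc]
    rfl
  rw [h2]
  exact h1

/-- Print the inclusion of a rule. -/
noncomputable def emitRule (b : ℕ) (r : Schema M) : Prog α Token (Option Bool) (Fin (b + 2)) Unit :=
  (emit [Token.incl]).bind fun _ =>
    (forEach r.1 fun a => (emit [Token.inter]).bind fun _ => emitAtom b a).bind fun _ =>
      (emit [Token.top]).bind fun _ => emitAtom b r.2

/-- In prefix notation a right-nested conjunction needs no closing symbols, so it can be printed
from left to right without memory. -/
theorem encode_conj (l : List Name) : (Concept.conj l).encode =
    (l.flatMap fun A => .inter :: (Concept.atom A).encode) ++ [Token.top] := by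
  induction l with
  | nil => rfl
  | cons A l ih =>
    simp only [List.flatMap_cons, List.cons_append, List.append_assoc, ← ih]
    rfl

theorem emits_emitRule {pos t k : ℕ} (hpos : pos ≤ w.length + 1) (hm : m ≤ L)
    (ht : t < (b + 2) ^ m) (hk : k < (b + 2) ^ m) (r : Schema M) :
    (emitRule b r : Prog α Token _ _ _).Emits w L (counters b m pos (vals t k)) ()
      (hornInclusion (atomName (b + 2) m) (r.inst t k)).encode
      (counters b m pos (vals t k)) := by
  have hv : (counters b m pos (vals t k)).Valid w L := valid_counters hpos hm _
  have h1 := (emits_emit (β := Token) (v := [Token.incl]) hv).bind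
    (k := fun _ => (forEach r.1 fun a => (emit [Token.inter]).bind fun _ => emitAtom b a).bind fun
        _ =>
      (emit [Token.top]).bind fun _ => emitAtom b r.2)
    ((emits_forEach hv fun a _ => (emits_emit (v := [Token.inter]) hv).bind
      (emits_emitAtom hpos hm ht hk a)).bind ((emits_emit (v := [Token.top]) hv).bind
        (emits_emitAtom hpos hm ht hk r.2)))
  have h2 : (hornInclusion (atomName (b + 2) m) (r.inst t k)).encode =
      [.incl] ++ ((r.1.flatMap fun a => [.inter] ++
        (Concept.atom (atomName (b + 2) m (a.inst t k))).encode) ++ ([.top] ++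
          (Concept.atom (atomName (b + 2) m (r.2.inst t k))).encode)) := by
    simp only [hornInclusion, Inclusion.encode, Schema.inst, encode_conj, List.map_map,
      List.flatMap_map, List.append_assoc]
    rfl
  rw [h2]
  exact h1

/-- Print the inclusions of a list of rules. -/
noncomputable def emitRules (b : ℕ) (l : List (Schema M)) :
    Prog α Token (Option Bool) (Fin (b + 2)) Unit :=
  forEach l (emitRule b)

theorem emits_emitRules {pos t k : ℕ} (hpos : pos ≤ w.length + 1) (hm : m ≤ L)
    (ht : t < (b + 2) ^ m) (hk : k < (b + 2) ^ m) (l : List (Schema M)) :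
    (emitRules b l : Prog α Token _ _ _).Emits w L (counters b m pos (vals t k)) ()
      ((l.map (Schema.inst t k)).flatMap fun r => (hornInclusion (atomName (b + 2) m) r).encode)
      (counters b m pos (vals t k)) := by
  rw [List.flatMap_map]
  exact emits_forEach (valid_counters hpos hm _) fun r _ => emits_emitRule hpos hm ht hk r

variable (M) in
/-- Print the inclusion that describes the initial content of a cell, and go to the next cell. -/
noncomputable def emitInput (b : ℕ) : Prog α Token (Option Bool) (Fin (b + 2)) Unit :=
  (act fun s _ => (nop, s)).bind fun s => (emitRules b (inputSchemas M s)).bind fun _ =>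
    act fun _ _ => (onInput .right, ())

/-- The input head advances with the counter until it rests on the right end marker, which is also
what all later cells show. -/
theorem emits_emitInput {k : ℕ} (hm : m ≤ L) (hk : k < (b + 2) ^ m) :
    (emitInput M b).Emits w L (counters b m (min k (w.length + 1)) (vals 0 k)) ()
      (((inputSchemas M (readInput w k)).map (Schema.inst 0 k)).flatMap fun r =>
        (hornInclusion (atomName (b + 2) m) r).encode)
      (counters b m (min (k + 1) (w.length + 1)) (vals 0 k)) := by
  have hpos : ∀ j, min j (w.length + 1) ≤ w.length + 1 := fun j => min_le_right _ _
  refine .bind_silent (e := readInput w k)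
    (s₁ := counters b m (min k (w.length + 1)) (vals 0 k)) (emits_act nop ?_
      (by simp [nop, Move.apply, counters]) (fun i => rfl) (valid_counters (hpos k) hm _))
      ((emits_emitRules (hpos k) hm (by positivity) hk _).bind_last
        (emits_act (onInput .right) rfl ?_ (fun i => rfl) (valid_counters (hpos _) hm _)))
  · simp only [counters, readInput_min]
  · simp only [onInput, Move.apply, counters]
    omega

variable (M) in
/-- Print the instance of the problem. -/
noncomputable def printer (b : ℕ) : Prog α Token (Option Bool) (Fin (b + 2)) Unit :=
  setCounters.bind fun _ => (emitRules b (startSchemas M)).bind fun _ =>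
    (forAll true (emitInput M b)).bind fun _ =>
      (forAll false ((emitRules b (wallSchemas M)).bind fun _ =>
        forAll true (emitRules b (runSchemas M)))).bind fun _ =>
          (emit [Token.goal]).bind fun _ => emitAtom b ((.goal, []) : AtomSchema M)

/-- The order of `rules` is that of the printing loops, so the output is the encoding literally. -/
theorem emits_printer : ∃ s, (printer M b).Emits w (Nat.log 2 w.length + 1) (0, fun _ => []) ()
    (encodeInstance (runKB M w (b + 2) (Nat.log 2 w.length + 1))
      (goalConcept M (b + 2) (Nat.log 2 w.length + 1))) s := by
  have hset := emits_setCounters (α := α) (β := Token) (b := b) (w := w)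
  generalize Nat.log 2 w.length + 1 = m at hset ⊢
  have hN : 0 < (b + 2) ^ m := by positivity
  have hvals : (fun _ => 0 : Bool → ℕ) = vals 0 0 := by
    funext x
    cases x <;> rfl
  rw [hvals] at hset
  have hinput := emits_forAll (α := α) (β := Token) (w := w) (b := b) (le_refl m) (i := true)
    (body := emitInput M b) (V := vals 0 0) rfl (p := fun j => min j (w.length + 1))
    (fun j => min_le_right _ _) fun j hj => by
      rw [update_vals_true]
      exact emits_emitInput le_rfl hj
  have hpos : min ((b + 2) ^ m) (w.length + 1) ≤ w.length + 1 := min_le_right _ _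
  simp only [Nat.zero_min] at hinput
  have hrun : ∀ t < (b + 2) ^ m, _ := fun t ht =>
    emits_forAll (α := α) (β := Token) (w := w) (b := b) (le_refl m) (i := true)
      (body := emitRules b (runSchemas M)) (V := vals t 0) rfl
      (p := fun _ => min ((b + 2) ^ m) (w.length + 1)) (fun _ => hpos) fun j hj => by
        rw [update_vals_true]
        exact emits_emitRules hpos le_rfl ht hj _
  have hall := emits_forAll (α := α) (β := Token) (w := w) (b := b) (le_refl m) (i := false)
    (body := (emitRules b (wallSchemas M)).bind fun _ => forAll true (emitRules b (runSchemas M)))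
    (V := vals 0 0) rfl
    (p := fun _ => min ((b + 2) ^ m) (w.length + 1)) (fun _ => hpos) fun t ht => by
        rw [update_vals_false]
        exact (emits_emitRules hpos le_rfl ht hN _).bind (hrun t ht)
  have hgoal := emits_emitAtom (b := b) hpos (le_refl m) hN hN ((.goal, []) : AtomSchema M)
  refine ⟨counters b m (min ((b + 2) ^ m) (w.length + 1)) (vals 0 0), ?_⟩
  have henc : encodeInstance (runKB M w (b + 2) m) (goalConcept M (b + 2) m) =
      ((startSchemas M).map (Schema.inst 0 0)).flatMap (fun r =>
        (hornInclusion (atomName (b + 2) m) r).encode) ++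
      ((List.range ((b + 2) ^ m)).flatMap (fun k =>
        ((inputSchemas M (readInput w k)).map (Schema.inst 0 k)).flatMap fun r =>
          (hornInclusion (atomName (b + 2) m) r).encode) ++
      ((List.range ((b + 2) ^ m)).flatMap (fun t =>
        ((wallSchemas M).map (Schema.inst t 0)).flatMap (fun r =>
          (hornInclusion (atomName (b + 2) m) r).encode) ++
        (List.range ((b + 2) ^ m)).flatMap fun k =>
          ((runSchemas M).map (Schema.inst t k)).flatMap fun r =>
            (hornInclusion (atomName (b + 2) m) r).encode) ++
      ([.goal] ++ (goalConcept M (b + 2) m).encode))) := by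
    simp only [encodeInstance, runKB, hornKB, rules, List.flatMap_nil, List.nil_append,
      List.flatMap_map, List.flatMap_append, List.flatMap_assoc, List.append_assoc]
    rfl
  rw [henc]
  exact hset.bind_silent (.bind (e := ())
    (emits_emitRules (pos := 0) (Nat.zero_le _) le_rfl hN hN (startSchemas M))
    (.bind (e := ()) hinput (.bind (e := ()) hall
      (.bind (e := ()) (emits_emit (valid_counters hpos le_rfl _)) hgoal))))

theorem logSpaceComputable_printer (M : Machine α Bool) (b : ℕ) :
    LogSpaceComputable fun w : List α =>
      encodeInstance (runKB M w (b + 2) (Nat.log 2 w.length + 1))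
        (goalConcept M (b + 2) (Nat.log 2 w.length + 1)) := by
  -- Head positions equal stack heights, which are at most the number of digits; the factor `2`
  -- makes the bound strict.
  refine ⟨(printer M b).toMachine, 2, fun w => ?_⟩
  obtain ⟨s, h⟩ := emits_printer (M := M) (b := b) (w := w)
  obtain ⟨T, hT⟩ := h []
  have hT : (printer M b).Runs w _ initialMem () _ T := hT
  have h0 : 0 ≤ Nat.log 2 w.length + 1 := Nat.zero_le _
  have hout := Runs.outputsIn (Ok := (· ≤ Nat.log 2 w.length + 1)) h0 hT
  refine ⟨⟨_, hout⟩, fun t i => ?_⟩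
  have := Runs.head_ok (Ok := (· ≤ Nat.log 2 w.length + 1)) h0 hT t i
  omega

/-! ### Hardness -/

/-- Since `x ≥ 2`, a coefficient `a` is absorbed by `x ^ a`, and a sum of two terms by one more
factor `x`. -/
theorem exists_eval_le_pow (p : Polynomial ℕ) : ∃ e : ℕ, ∀ x n, 2 ≤ x → n ≤ x → p.eval n ≤ x ^ e :=
    by
  induction p using Polynomial.induction_on' with
  | add p q hp hq =>
    obtain ⟨d, hd⟩ := hp
    obtain ⟨e, he⟩ := hq
    refine ⟨max d e + 1, fun x n hx hn => ?_⟩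
    have h1 := (hd x n hx hn).trans (Nat.pow_le_pow_right (by omega) (le_max_left d e))
    have h2 := (he x n hx hn).trans (Nat.pow_le_pow_right (by omega) (le_max_right d e))
    rw [Polynomial.eval_add, pow_succ]
    calc _ ≤ x ^ max d e * 2 := by omega
      _ ≤ _ := Nat.mul_le_mul_left _ hx
  | monomial d a =>
    refine ⟨a + d, fun x n hx hn => ?_⟩
    rw [Polynomial.eval_monomial, pow_add]
    exact Nat.mul_le_mul (Nat.lt_two_pow_self.le.trans (Nat.pow_le_pow_left hx a))
      (Nat.pow_le_pow_left hn d)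

/-- Raising `2 ^ (e + 2)` to the number of binary digits of `n` is the same as raising `x = 2 ^
(Nat.log 2 n + 1)`, which exceeds `n`, to the power `e + 2`. The exponent `e` bounds the polynomial
and the two extra factors absorb `2 * _ + 1`. -/
theorem exists_base (p : Polynomial ℕ) :
    ∃ b : ℕ, ∀ n, 2 * p.eval n + 1 < (b + 2) ^ (Nat.log 2 n + 1) := by
  obtain ⟨e, he⟩ := exists_eval_le_pow p
  have h4 : 4 ≤ 2 ^ (e + 2) := by
    have := Nat.one_le_two_pow (n := e)
    rw [pow_add]
    omega
  -- Bases are written as `b + 2`; the subtraction is exact because `2 ^ (e + 2)` is at least `4`.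
  refine ⟨2 ^ (e + 2) - 2, fun n => ?_⟩
  rw [Nat.sub_add_cancel (by omega), pow_right_comm]
  have hx : 2 ≤ 2 ^ (Nat.log 2 n + 1) := Nat.le_self_pow (by omega) 2
  have h1 := he (2 ^ (Nat.log 2 n + 1)) n hx (Nat.lt_pow_succ_log_self (by omega) n).le
  generalize 2 ^ (Nat.log 2 n + 1) = x at hx h1 ⊢
  have h2 : 1 ≤ x ^ e := Nat.one_le_pow _ _ (by omega)
  have h3 : x ^ e * (2 * 2) ≤ x ^ (e + 2) := by
    rw [pow_add, pow_two]
    exact Nat.mul_le_mul_left _ (Nat.mul_le_mul hx hx)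
  omega

end Simulation

/-- The base depends only on the time bound of the machine, so a single printer handles inputs of
all lengths. -/
theorem pHard_of_runKB {L' : Language Token}
    (h : ∀ (α : Type) [Finite α] (M : Machine α Bool) (w : List α) (B m T : ℕ) (b : Bool),
      M.OutputsIn w [b] T → 2 * T + 1 < B ^ m →
        (encodeInstance (Simulation.runKB M w B m) (Simulation.goalConcept M B m) ∈ L' ↔ b = true))
            :
    PHard L' := by
  intro α _ L ⟨M, p, hM⟩
  obtain ⟨b, hb⟩ := Simulation.exists_base p
  refine ⟨_, Simulation.logSpaceComputable_printer M b, fun w => ?_⟩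
  obtain ⟨v, hv, hvw⟩ := hM w
  rw [h α M w _ _ _ v hv (hb w.length), hvw]

theorem pHard_minModSatELIO : PHard minModSatELIO.{u} :=
  pHard_of_runKB fun _ _ _ _ _ _ _ _ h hN => (Simulation.encodeInstance_runKB_mem h hN).1

theorem pHard_minModSatEL : PHard minModSatEL.{u} :=
  pHard_of_runKB fun _ _ _ _ _ _ _ _ h hN => (Simulation.encodeInstance_runKB_mem h hN).2

end MinMod

theorem theorem8 :
    MinMod.PComplete MinMod.minModSatELIO.{u} ∧
    MinMod.PHard MinMod.minModSatEL.{u} ∧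
    ∀ K : MinMod.KB,
      MinMod.IsMinimalModel K.representative K ∧
      K.fire K.representative = K.representative ∧
      ∀ C : MinMod.Concept,
        MinMod.SatInMinimalModel.{u} K C ↔ (C.ext K.representative).Nonempty :=
  ⟨⟨MinMod.inP_minModSatELIO, MinMod.pHard_minModSatELIO⟩, MinMod.pHard_minModSatEL, fun K =>
    ⟨MinMod.isMinimalModel_of_keys_eq rfl, K.fire_representative, fun _ =>
      MinMod.satInMinimalModel_iff⟩⟩
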